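/- Let $Q$ be a smooth manifold of finite dimension $n$ and let $k\ge 1$. For $r\ge 0$ let ${\rm T}^rQ$ be the manifold of $r$-jets $\tilde\sigma^r(0)$ at $0$ of smooth curves in $Q$, with projections $\rho^r_s\colon {\rm T}^rQ\to{\rm T}^sQ$ ($s\le r$) and natural coordinates $(q_0^A,\dots,q_r^A)$ induced by charts of $Q$; the canonical lifting of a curve $\gamma$ in $Q$ is $\tilde\gamma^r(t)=\tilde{\gamma_t}^{\,r}(0)$, where $\gamma_t(s)=\gamma(s+t)$. Let $j_{s}\colon{\rm T}^{r}Q\to{\rm T}({\rm T}^{s-1}Q)$ ($1\le s\le r$) map $\tilde\sigma^r(0)$ to the velocity at $t=0$ of $t\mapsto\tilde\sigma^{s-1}(t)$. Let $\mathcal L\in C^\infty({\rm T}^kQ)$. Its Lagrangian forms on ${\rm T}^{2k-1}Q$ are $$\theta_{\mathcal L}=\sum_{r=1}^k\frac{(-1)^{r-1}}{r!}\,d_T^{\,r-1}\bigl({\rm d}\mathcal L\circ J_r\bigr),\qquad \omega_{\mathcal L}=-{\rm d}\theta_{\mathcal L},$$ each summand being pulled back to ${\rm T}^{2k-1}Q$,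 where $J_r=\sum_{i=0}^{k-r}\frac{(r+i)!}{i!}\,{\rm d}q_i^A\otimes\partial/\partial q_{r+i}^A$ is the $r$th vertical endomorphism of ${\rm T}({\rm T}^kQ)$ and $d_T$ is Tulczyjew's derivation, which commutes with ${\rm d}$ and satisfies $d_Tf=\sum_i q_{i+1}^A\,\partial f/\partial q_i^A$ on functions. Assume that $\mathcal L$ is regular, i.e. that $\omega_{\mathcal L}$ is symplectic. Let $\mathcal W={\rm T}^{2k-1}Q\times_{{\rm T}^{k-1}Q}{\rm T}^*({\rm T}^{k-1}Q)$ with projections ${\rm pr}_1,{\rm pr}_2$, let $\Omega={\rm pr}_2^*\omega_{k-1}$, where $\omega_{k-1}$ is the canonical symplectic form of ${\rm T}^*({\rm T}^{k-1}Q)$ (locally ${\rm d}q_i^A\wedge{\rm d}p^i_A$), and let $H\in C^\infty(\mathcal W)$ be $H(p,\alpha)=\langle\alpha, j_k(p)\rangle-\mathcal L(\rho^{2k-1}_k(p))$. Let $\mathcal W_o\subset\mathcal W$ be the graph of the Legendre–Ostrogradsky map $\mathcal{FL}\colon{\rm T}^{2k-1}Q\to{\rm T}^*({\rm T}^{k-1}Q)$,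 where $\mathcal{FL}(p)\in {\rm T}^*_{\rho^{2k-1}_{k-1}(p)}({\rm T}^{k-1}Q)$ is defined by $\theta_{\mathcal L}(u)=\langle\mathcal{FL}(p),{\rm T}\rho^{2k-1}_{k-1}(u)\rangle$ for all $u\in{\rm T}_p({\rm T}^{2k-1}Q)$. Let $X$ be a smooth vector field of $\mathcal W$ along $\mathcal W_o$ such that $[\,i(X)\Omega-{\rm d}H\,]|_{\mathcal W_o}=0$, let $I\subset\mathbb R$ be open (for instance an open interval), and let $\sigma\colon I\to\mathcal W$ be an integral curve of $X$ with $\sigma(I)\subset\mathcal W_o$. Then ${\rm pr}_1\circ\sigma\colon I\to{\rm T}^{2k-1}Q$ is the canonical lifting of a curve in $Q$: there is a smooth $\gamma\colon I\to Q$ with ${\rm pr}_1\circ\sigma=\tilde\gamma^{2k-1}$. -/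

import Mathlib

open Set Filter Topology Bundle Manifold ContDiff

noncomputable section

namespace HigherOrder

/-! ### Jets of curves -/

section Calculus

variable {E : Type*} [NormedAddCommGroup E] [NormedSpace ℝ E]

/-- The polynomial curve `t ↦ ∑ qᵢ tⁱ / i!`, whose derivatives at `0` are the `qᵢ`. -/
def polyCurve {k : ℕ} (q : Fin (k + 1) → E) (t : ℝ) : E :=
  ∑ i : Fin (k + 1), (t ^ (i : ℕ) / ((i : ℕ).factorial : ℝ)) • q i

theorem polyCurve_zero {k : ℕ} (q : Fin (k + 1) → E) : polyCurve q 0 = q 0 := by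
  simp [polyCurve, Fin.sum_univ_succ]

theorem contDiff_polyCurve {k : ℕ} :
    ContDiff ℝ ∞ (fun x : (Fin (k + 1) → E) × ℝ => polyCurve x.1 x.2) := by
  unfold polyCurve
  fun_prop

theorem contDiff_polyCurve' {k : ℕ} (q : Fin (k + 1) → E) : ContDiff ℝ ∞ (polyCurve q) := by
  unfold polyCurve
  fun_prop

theorem iteratedDeriv_polyCurve {k : ℕ} (q : Fin (k + 1) → E) (i : Fin (k + 1)) :
    iteratedDeriv i (polyCurve q) 0 = q i := by
  unfold polyCurve
  rw [iteratedDeriv_fun_sum (fun j _ => by fun_prop)]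
  rw [Finset.sum_eq_single i]
  · rw [iteratedDeriv_smul_const (by fun_prop)]
    simp only [div_eq_inv_mul]
    rw [iteratedDeriv_const_mul _ (by fun_prop), iteratedDeriv_fun_pow_zero]
    simp [Nat.factorial_ne_zero]
  · intro j _ hj
    rw [iteratedDeriv_smul_const (by fun_prop)]
    simp only [div_eq_inv_mul]
    rw [iteratedDeriv_const_mul _ (by fun_prop), iteratedDeriv_fun_pow_zero]
    rw [if_neg (fun h => hj (Fin.ext h.symm))]
    simp
  · simp

theorem iteratedDeriv_comp_congr {φ : E → E} {f g : ℝ → E} {k : ℕ}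
    (hφ : ContDiffAt ℝ ∞ φ (f 0)) (hf : ContDiffAt ℝ ∞ f 0) (hg : ContDiffAt ℝ ∞ g 0)
    (h : ∀ i ≤ k, iteratedDeriv i f 0 = iteratedDeriv i g 0) {i : ℕ} (hi : i ≤ k) :
    iteratedDeriv i (φ ∘ f) 0 = iteratedDeriv i (φ ∘ g) 0 := by
  have h0 : f 0 = g 0 := by simpa using h 0 (Nat.zero_le _)
  have hle : (i : WithTop ℕ∞) ≤ ∞ := by exact_mod_cast le_top
  rw [iteratedDeriv_vcomp_eq_sum_orderedFinpartition hφ hf hle,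
    iteratedDeriv_vcomp_eq_sum_orderedFinpartition (h0 ▸ hφ) hg hle, h0]
  refine Finset.sum_congr rfl fun c _ => ?_
  congr 1
  funext j
  exact h _ ((c.partSize_le j).trans hi)

/-- The derivatives at `0` of `φ ∘ polyCurve q` depend smoothly on `q`. -/
theorem contDiffOn_iteratedDeriv_polyCurve {φ : E → E} {S : Set E} (hS : IsOpen S)
    (hφ : ContDiffOn ℝ ∞ φ S) {k : ℕ} (i : ℕ) :
    ContDiffOn ℝ ∞ (fun q : Fin (k + 1) → E => iteratedDeriv i (φ ∘ polyCurve q) 0)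
      {q | q 0 ∈ S} := by
  set U : Set ((Fin (k + 1) → E) × ℝ) := {x | polyCurve x.1 x.2 ∈ S}
  have hU : IsOpen U := hS.preimage contDiff_polyCurve.continuous
  have key : ∀ i : ℕ, ContDiffOn ℝ ∞
      (fun x : (Fin (k + 1) → E) × ℝ => iteratedDeriv i (φ ∘ polyCurve x.1) x.2) U := by
    intro i
    induction i with
    | zero =>
      simp only [iteratedDeriv_zero]
      exact hφ.comp contDiff_polyCurve.contDiffOn fun x hx => hx
    | succ i ih =>
      have h1 := (ih.fderiv_of_isOpen hU (m := ∞) (by simp)).clm_apply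
        (contDiffOn_const (c := ((0, 1) : (Fin (k + 1) → E) × ℝ)))
      refine h1.congr fun x hx => ?_
      rw [iteratedDeriv_succ]
      have hd : DifferentiableAt ℝ
          (fun x : (Fin (k + 1) → E) × ℝ => iteratedDeriv i (φ ∘ polyCurve x.1) x.2) x :=
        (ih.contDiffAt (hU.mem_nhds hx)).differentiableAt (by simp)
      have hc : HasDerivAt (fun t : ℝ => (x.1, t)) ((0, 1) : (Fin (k + 1) → E) × ℝ) x.2 :=
        (hasDerivAt_const _ _).prodMk (hasDerivAt_id _)
      have := HasFDerivAt.comp_hasDerivAt (x := x.2) (f := fun t : ℝ => (x.1, t))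
        (l := fun x : (Fin (k + 1) → E) × ℝ => iteratedDeriv i (φ ∘ polyCurve x.1) x.2)
        (by exact hd.hasFDerivAt) hc
      exact this.deriv
  refine (key i).comp (t := U) (f := fun q : Fin (k + 1) → E => (q, (0 : ℝ)))
    (by fun_prop) fun q hq => ?_
  show polyCurve q 0 ∈ S
  rw [polyCurve_zero]
  exact hq

end Calculus

variable (E : Type*) [NormedAddCommGroup E] [NormedSpace ℝ E]
  (Q : Type*) [TopologicalSpace Q] [ChartedSpace E Q]

/-- Curves in `Q` that are smooth near the source point `0`. -/
structure Curve where
  /-- The underlying map; only its germ at `0` matters. -/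
  toFun : ℝ → Q
  smooth : ∀ᶠ t in 𝓝 (0 : ℝ), ContMDiffAt 𝓘(ℝ, ℝ) 𝓘(ℝ, E) ∞ toFun t

variable {E Q} in
/-- Equality of `k`-jets at `0`: same value and same derivatives up to order `k` in a chart. -/
def JetRel (k : ℕ) (σ τ : Curve E Q) : Prop :=
  σ.1 0 = τ.1 0 ∧ ∀ i ≤ k, iteratedDeriv i (chartAt E (σ.1 0) ∘ σ.1) 0 =
    iteratedDeriv i (chartAt E (σ.1 0) ∘ τ.1) 0

def jetSetoid (k : ℕ) : Setoid (Curve E Q) where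
  r := JetRel k
  iseqv :=
    { refl := fun _ => ⟨rfl, fun _ _ => rfl⟩
      symm := fun {σ τ} h => ⟨h.1.symm, fun i hi => by rw [← h.1]; exact (h.2 i hi).symm⟩
      trans := fun {σ τ υ} h h' => ⟨h.1.trans h'.1, fun i hi => by
        rw [h.2 i hi, h.1]; exact h'.2 i hi⟩ }

/-- The `k`th-order tangent bundle `TᵏQ = J₀ᵏ(ℝ, Q)`: `k`-jets at `0` of curves in `Q`. -/
def HOTangent (k : ℕ) : Type _ := Quotient (jetSetoid E Q k)

variable {E Q}

/-- The `k`-jet at `0` of a curve. -/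
def jet (k : ℕ) (σ : Curve E Q) : HOTangent E Q k := Quotient.mk (jetSetoid E Q k) σ

/-- The projection `βᵏ : TᵏQ → Q`. -/
def baseProj {k : ℕ} : HOTangent E Q k → Q := Quotient.lift (fun σ => σ.1 0) fun _ _ h => h.1

/-- The projection `ρᵏ_r : TᵏQ → TʳQ`. -/
def jetProj {r k : ℕ} (h : r ≤ k) : HOTangent E Q k → HOTangent E Q r :=
  Quotient.map id fun _ _ hσ => ⟨hσ.1, fun i hi => hσ.2 i (hi.trans h)⟩

theorem Curve.contMDiffAt (σ : Curve E Q) : ContMDiffAt 𝓘(ℝ, ℝ) 𝓘(ℝ, E) ∞ σ.1 0 :=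
  σ.smooth.self_of_nhds

theorem Curve.contDiffAt_chart [IsManifold 𝓘(ℝ, E) ∞ Q] (σ : Curve E Q)
    {e : OpenPartialHomeomorph Q E} (he : e ∈ atlas E Q) (h : σ.1 0 ∈ e.source) :
    ContDiffAt ℝ ∞ (e ∘ σ.1) 0 := by
  have h1 : ContMDiffAt 𝓘(ℝ, E) 𝓘(ℝ, E) ∞ e (σ.1 0) :=
    contMDiffAt_of_mem_maximalAtlas (IsManifold.subset_maximalAtlas he) h
  exact (h1.comp 0 σ.contMDiffAt).contDiffAt

theorem contDiffOn_transition [IsManifold 𝓘(ℝ, E) ∞ Q] {e e' : OpenPartialHomeomorph Q E}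
    (he : e ∈ atlas E Q) (he' : e' ∈ atlas E Q) :
    ContDiffOn ℝ ∞ (e' ∘ e.symm) (e.symm.trans e').source := by
  have h1 := contMDiffOn_of_mem_maximalAtlas (I := 𝓘(ℝ, E)) (n := ∞)
    (IsManifold.subset_maximalAtlas he')
  have h2 := contMDiffOn_symm_of_mem_maximalAtlas (I := 𝓘(ℝ, E)) (n := ∞)
    (IsManifold.subset_maximalAtlas he)
  have := h1.comp' h2
  rw [contMDiffOn_iff_contDiffOn] at this
  simpa [OpenPartialHomeomorph.trans_source] using this

theorem JetRel.iteratedDeriv_eq [IsManifold 𝓘(ℝ, E) ∞ Q] {k : ℕ} {σ τ : Curve E Q}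
    (h : JetRel k σ τ) {e : OpenPartialHomeomorph Q E} (he : e ∈ atlas E Q)
    (hs : σ.1 0 ∈ e.source) {i : ℕ} (hi : i ≤ k) :
    iteratedDeriv i (e ∘ σ.1) 0 = iteratedDeriv i (e ∘ τ.1) 0 := by
  set c := chartAt E (σ.1 0) with hc
  have hcs : σ.1 0 ∈ c.source := mem_chart_source E _
  have hcs' : τ.1 0 ∈ c.source := h.1 ▸ hcs
  have hca : c ∈ atlas E Q := chart_mem_atlas E _
  have aux : ∀ υ : Curve E Q, υ.1 0 ∈ c.source →
      e ∘ υ.1 =ᶠ[𝓝 0] (e ∘ c.symm) ∘ (c ∘ υ.1) := by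
    intro υ hυ
    filter_upwards [υ.contMDiffAt.continuousAt (c.open_source.mem_nhds hυ)] with t ht
    simp only [Function.comp_apply]
    rw [c.left_inv ht]
  rw [(aux σ hcs).iteratedDeriv_eq i, (aux τ hcs').iteratedDeriv_eq i]
  refine iteratedDeriv_comp_congr ?_ (σ.contDiffAt_chart hca hcs) (τ.contDiffAt_chart hca hcs')
    h.2 hi
  refine (contDiffOn_transition hca he).contDiffAt ((c.symm.trans e).open_source.mem_nhds ?_)
  simp [hcs, hs]

variable [IsManifold 𝓘(ℝ, E) ∞ Q]

open Classical in
/-- The natural coordinates `(q₀, …, q_k)` on `TᵏQ` induced by a chart of `Q`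
(with junk value `0` off the domain of the chart). -/
def jetCoord (k : ℕ) {e : OpenPartialHomeomorph Q E} (he : e ∈ atlas E Q) :
    HOTangent E Q k → (Fin (k + 1) → E) :=
  Quotient.lift
    (fun σ i => if σ.1 0 ∈ e.source then iteratedDeriv (i : ℕ) (e ∘ σ.1) 0 else 0)
    fun σ τ h => by
      funext i
      by_cases hs : σ.1 0 ∈ e.source
      · rw [if_pos hs, if_pos (h.1 ▸ hs), h.iteratedDeriv_eq he hs (Nat.lt_succ_iff.1 i.2)]
      · rw [if_neg hs, if_neg (h.1 ▸ hs)]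

theorem jetCoord_jet {k : ℕ} {e : OpenPartialHomeomorph Q E} (he : e ∈ atlas E Q) {σ : Curve E Q}
    (h : σ.1 0 ∈ e.source) (i : Fin (k + 1)) :
    jetCoord k he (jet k σ) i = iteratedDeriv (i : ℕ) (e ∘ σ.1) 0 :=
  if_pos h

open Classical in
/-- The curve whose expression in the chart `e` is `polyCurve q` (a constant curve if `q₀`
is not in the target of the chart). -/
def coordCurve {k : ℕ} {e : OpenPartialHomeomorph Q E} (he : e ∈ atlas E Q)
    (q : Fin (k + 1) → E) : Curve E Q :=
  if h : q 0 ∈ e.target then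
    ⟨e.symm ∘ polyCurve q, by
      have hc : ContinuousAt (polyCurve q) 0 := (contDiff_polyCurve' q).continuous.continuousAt
      filter_upwards [hc (e.open_target.mem_nhds (by rwa [polyCurve_zero]))] with t ht
      have h1 : ContMDiffAt 𝓘(ℝ, E) 𝓘(ℝ, E) ∞ e.symm (polyCurve q t) :=
        contMDiffAt_symm_of_mem_maximalAtlas (IsManifold.subset_maximalAtlas he) ht
      exact h1.comp t (contDiff_polyCurve' q).contMDiff.contMDiffAt⟩
  else ⟨fun _ => e.symm (q 0), .of_forall fun _ => contMDiffAt_const⟩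

theorem coordCurve_of_mem {k : ℕ} {e : OpenPartialHomeomorph Q E} (he : e ∈ atlas E Q)
    {q : Fin (k + 1) → E} (h : q 0 ∈ e.target) : (coordCurve he q).1 = e.symm ∘ polyCurve q := by
  rw [coordCurve, dif_pos h]

theorem coordCurve_zero {k : ℕ} {e : OpenPartialHomeomorph Q E} (he : e ∈ atlas E Q)
    {q : Fin (k + 1) → E} (h : q 0 ∈ e.target) : (coordCurve he q).1 0 = e.symm (q 0) := by
  rw [coordCurve_of_mem he h, Function.comp_apply, polyCurve_zero]

theorem comp_coordCurve {k : ℕ} {e : OpenPartialHomeomorph Q E} (he : e ∈ atlas E Q)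
    {q : Fin (k + 1) → E} (h : q 0 ∈ e.target) :
    e ∘ (coordCurve he q).1 =ᶠ[𝓝 0] polyCurve q := by
  rw [coordCurve_of_mem he h]
  have hc : ContinuousAt (polyCurve q) 0 := (contDiff_polyCurve' q).continuous.continuousAt
  filter_upwards [hc (e.open_target.mem_nhds (by rwa [polyCurve_zero]))] with t ht
  exact e.right_inv ht

/-- The natural chart of `TᵏQ` induced by a chart of `Q`. -/
def jetChart (k : ℕ) {e : OpenPartialHomeomorph Q E} (he : e ∈ atlas E Q) :
    PartialEquiv (HOTangent E Q k) (Fin (k + 1) → E) where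
  toFun := jetCoord k he
  invFun q := jet k (coordCurve he q)
  source := {p | baseProj p ∈ e.source}
  target := {q | q 0 ∈ e.target}
  map_source' := by
    intro p
    induction p using Quotient.inductionOn with
    | h σ =>
      intro (h : σ.1 0 ∈ e.source)
      show jetCoord k he (jet k σ) 0 ∈ e.target
      rw [jetCoord_jet he h]
      simpa using e.map_source h
  map_target' := by
    intro q (hq : q 0 ∈ e.target)
    show (coordCurve he q).1 0 ∈ e.source
    rw [coordCurve_zero he hq]
    exact e.map_target hq
  left_inv' := by
    intro p
    induction p using Quotient.inductionOn with
    | h σ =>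
      intro (h : σ.1 0 ∈ e.source)
      have hq : jetCoord k he (jet k σ) 0 ∈ e.target := by
        rw [jetCoord_jet he h]
        simpa using e.map_source h
      have h0 : (coordCurve he (jetCoord k he (jet k σ))).1 0 = σ.1 0 := by
        rw [coordCurve_zero he hq, jetCoord_jet he h]
        simpa using e.left_inv h
      set τ := coordCurve he (jetCoord k he (jet k σ))
      have hder : ∀ i ≤ k, iteratedDeriv i (e ∘ τ.1) 0 = iteratedDeriv i (e ∘ σ.1) 0 := by
        intro i hi
        rw [(comp_coordCurve he hq).iteratedDeriv_eq i]
        have := iteratedDeriv_polyCurve (jetCoord k he (jet k σ)) ⟨i, Nat.lt_succ_iff.2 hi⟩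
        rw [jetCoord_jet he h] at this
        exact this
      refine Quotient.sound (s := jetSetoid E Q k) ⟨h0, fun i hi => ?_⟩
      change iteratedDeriv i (chartAt E (τ.1 0) ∘ τ.1) 0 = iteratedDeriv i (chartAt E (τ.1 0) ∘ σ.1) 0
      set c := chartAt E (τ.1 0) with hc
      have hca : c ∈ atlas E Q := chart_mem_atlas E _
      have hcs : τ.1 0 ∈ c.source := mem_chart_source E _
      have aux : ∀ υ : Curve E Q, υ.1 0 ∈ e.source →
          c ∘ υ.1 =ᶠ[𝓝 0] (c ∘ e.symm) ∘ (e ∘ υ.1) := by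
        intro υ hυ
        filter_upwards [υ.contMDiffAt.continuousAt (e.open_source.mem_nhds hυ)] with t ht
        simp only [Function.comp_apply]
        rw [e.left_inv ht]
      have hτ : τ.1 0 ∈ e.source := h0 ▸ h
      rw [(aux τ hτ).iteratedDeriv_eq i, (aux σ h).iteratedDeriv_eq i]
      refine iteratedDeriv_comp_congr ?_ (τ.contDiffAt_chart he hτ) (σ.contDiffAt_chart he h)
        hder hi
      refine (contDiffOn_transition he hca).contDiffAt
        ((e.symm.trans c).open_source.mem_nhds ?_)
      simp [hcs, hτ]
  right_inv' := by
    intro q (hq : q 0 ∈ e.target)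
    funext i
    show jetCoord k he (jet k (coordCurve he q)) i = q i
    rw [jetCoord_jet he (by rw [coordCurve_zero he hq]; exact e.map_target hq),
      (comp_coordCurve he hq).iteratedDeriv_eq, iteratedDeriv_polyCurve]

theorem jetChart_trans_source {k : ℕ} {e e' : OpenPartialHomeomorph Q E} (he : e ∈ atlas E Q)
    (he' : e' ∈ atlas E Q) : ((jetChart k he).symm.trans (jetChart k he')).source =
      {q | q 0 ∈ (e.symm.trans e').source} := by
  ext q
  simp only [PartialEquiv.trans_source, PartialEquiv.symm_source, mem_inter_iff, mem_preimage,
    OpenPartialHomeomorph.trans_source, mem_ofPred_eq, OpenPartialHomeomorph.symm_source]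
  refine and_congr_right fun (hq : q 0 ∈ e.target) => ?_
  show (coordCurve he q).1 0 ∈ e'.source ↔ _
  rw [coordCurve_zero he hq]

theorem contDiffOn_jetChart_trans {k : ℕ} {e e' : OpenPartialHomeomorph Q E} (he : e ∈ atlas E Q)
    (he' : e' ∈ atlas E Q) :
    ContDiffOn ℝ ∞ ((jetChart k he).symm.trans (jetChart k he'))
      ((jetChart k he).symm.trans (jetChart k he')).source := by
  rw [jetChart_trans_source]
  rw [contDiffOn_pi]
  intro i
  refine (contDiffOn_iteratedDeriv_polyCurve (e.symm.trans e').open_source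
    (contDiffOn_transition he he') (i : ℕ)).congr fun q hq => ?_
  have hq1 : q 0 ∈ e.target := hq.1
  have hq2 : e.symm (q 0) ∈ e'.source := hq.2
  show jetCoord k he' (jet k (coordCurve he q)) i = _
  rw [jetCoord_jet he' (by rwa [coordCurve_zero he hq1]), coordCurve_of_mem he hq1]
  rfl

variable (E Q) in
/-- The natural charts of `TᵏQ`, one for each chart in the atlas of `Q`. -/
def jetCore (k : ℕ) : ChartedSpaceCore (Fin (k + 1) → E) (HOTangent E Q k) where
  atlas := {c | ∃ (e : OpenPartialHomeomorph Q E) (he : e ∈ atlas E Q), c = jetChart k he}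
  chartAt p := jetChart k (chart_mem_atlas E (baseProj p))
  mem_chart_source p := mem_chart_source E (baseProj p)
  chart_mem_atlas p := ⟨_, _, rfl⟩
  open_source := by
    rintro _ _ ⟨e, he, rfl⟩ ⟨e', he', rfl⟩
    rw [jetChart_trans_source]
    exact (e.symm.trans e').open_source.preimage (continuous_apply 0)
  continuousOn_toFun := by
    rintro _ _ ⟨e, he, rfl⟩ ⟨e', he', rfl⟩
    exact (contDiffOn_jetChart_trans he he').continuousOn

instance (k : ℕ) : TopologicalSpace (HOTangent E Q k) := (jetCore E Q k).toTopologicalSpace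

instance (k : ℕ) : ChartedSpace (Fin (k + 1) → E) (HOTangent E Q k) :=
  (jetCore E Q k).toChartedSpace

instance (k : ℕ) : IsManifold 𝓘(ℝ, Fin (k + 1) → E) ∞ (HOTangent E Q k) := by
  refine isManifold_of_contDiffOn _ _ _ fun c c' hc hc' => ?_
  change c ∈ ⋃ (e : PartialEquiv _ _) (he : e ∈ (jetCore E Q k).atlas),
    {(jetCore E Q k).openPartialHomeomorph e he} at hc
  change c' ∈ ⋃ (e : PartialEquiv _ _) (he : e ∈ (jetCore E Q k).atlas),
    {(jetCore E Q k).openPartialHomeomorph e he} at hc'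
  simp only [mem_iUnion, mem_singleton_iff] at hc hc'
  obtain ⟨_, ⟨e, he, rfl⟩, rfl⟩ := hc
  obtain ⟨_, ⟨e', he', rfl⟩, rfl⟩ := hc'
  have := contDiffOn_jetChart_trans (k := k) he he'
  simp only [modelWithCornersSelf_coe, modelWithCornersSelf_coe_symm, range_id, inter_univ,
    preimage_id, Function.id_comp, Function.comp_id]
  exact this


theorem chartAt_apply {k : ℕ} (p p' : HOTangent E Q k) :
    chartAt (Fin (k + 1) → E) p p' = jetCoord k (chart_mem_atlas E (baseProj p)) p' := rfl

theorem chartAt_source {k : ℕ} (p : HOTangent E Q k) :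
    (chartAt (Fin (k + 1) → E) p).source = {p' | baseProj p' ∈ (chartAt E (baseProj p)).source} :=
  rfl

theorem jetCoord_jetProj {r k : ℕ} (h : r ≤ k) {e : OpenPartialHomeomorph Q E}
    (he : e ∈ atlas E Q) (p : HOTangent E Q k) (i : Fin (r + 1)) :
    jetCoord r he (jetProj h p) i = jetCoord k he p (Fin.castLE (Nat.succ_le_succ h) i) := by
  induction p using Quotient.inductionOn with
  | h σ => rfl

theorem contMDiff_jetProj {r k : ℕ} (h : r ≤ k) :
    ContMDiff 𝓘(ℝ, Fin (k + 1) → E) 𝓘(ℝ, Fin (r + 1) → E) ∞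
      (jetProj h : HOTangent E Q k → HOTangent E Q r) := by
  intro p
  set c := chartAt (Fin (k + 1) → E) p with hc
  set c' := chartAt (Fin (r + 1) → E) (jetProj h p) with hc'
  set l : (Fin (k + 1) → E) → (Fin (r + 1) → E) :=
    fun q i => q (Fin.castLE (Nat.succ_le_succ h) i) with hl
  have hb : ∀ p' : HOTangent E Q k, baseProj (jetProj h p') = baseProj p' := by
    intro p'
    induction p' using Quotient.inductionOn with
    | h σ => rfl
  have hp : p ∈ c.source := mem_chart_source _ p
  have hsrc : ∀ p' ∈ c.source, jetProj h p' ∈ c'.source := by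
    intro p' hp'
    rw [hc', chartAt_source, mem_ofPred_eq, hb, hb]
    rwa [hc, chartAt_source] at hp'
  have hval : ∀ p', c' (jetProj h p') = l (c p') := by
    intro p'
    funext i
    rw [hc', chartAt_apply, jetCoord_jetProj, hl, hc, chartAt_apply]
    have : ∀ (x y : Q) (j : Fin (k + 1)), x = y → jetCoord k (chart_mem_atlas E x) p' j =
        jetCoord k (chart_mem_atlas E y) p' j := by
      rintro x _ j rfl
      rfl
    exact this _ _ _ (hb p)
  have h1 : ContMDiffAt 𝓘(ℝ, Fin (k + 1) → E) 𝓘(ℝ, Fin (k + 1) → E) ∞ c p :=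
    contMDiffAt_of_mem_maximalAtlas (IsManifold.chart_mem_maximalAtlas p) hp
  have h2 : ContMDiffAt 𝓘(ℝ, Fin (k + 1) → E) 𝓘(ℝ, Fin (r + 1) → E) ∞ l (c p) := by
    refine ContDiffAt.contMDiffAt ?_
    rw [hl]
    fun_prop
  have h3 : ContMDiffAt 𝓘(ℝ, Fin (r + 1) → E) 𝓘(ℝ, Fin (r + 1) → E) ∞ c'.symm (l (c p)) := by
    refine contMDiffAt_symm_of_mem_maximalAtlas (IsManifold.chart_mem_maximalAtlas (jetProj h p)) ?_
    rw [← hval]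
    exact c'.map_source (hsrc p hp)
  refine (h3.comp p (h2.comp p h1)).congr_of_eventuallyEq ?_
  filter_upwards [c.open_source.mem_nhds hp] with p' hp'
  simp only [Function.comp_apply]
  rw [← hval, c'.left_inv (hsrc p' hp')]

/-! ### Canonical liftings and the canonical injections -/

open Classical in
/-- The translated curve `σ_t(s) = σ(s + t)` (a constant curve if `σ` is not smooth near `t`). -/
def shiftCurve (γ : ℝ → Q) (t : ℝ) : Curve E Q :=
  if h : ∀ᶠ s in 𝓝 t, ContMDiffAt 𝓘(ℝ, ℝ) 𝓘(ℝ, E) ∞ γ s then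
    ⟨fun s => γ (s + t), by
      have hc : Tendsto (fun s : ℝ => s + t) (𝓝 0) (𝓝 t) := by
        have : ContinuousAt (fun s : ℝ => s + t) 0 := by fun_prop
        simpa [ContinuousAt] using this
      filter_upwards [hc.eventually h] with s hs
      have h2 : ContDiff ℝ ∞ (fun s : ℝ => s + t) := by fun_prop
      exact ContMDiffAt.comp (x := s) (f := fun s : ℝ => s + t) (g := γ) (I' := 𝓘(ℝ, ℝ)) hs
        h2.contMDiff.contMDiffAt⟩
  else ⟨fun _ => γ t, .of_forall fun _ => contMDiffAt_const⟩

/-- The canonical lifting `γ̃ᵏ(t) = (γ_t)~ᵏ(0)` of a curve `γ` in `Q` to `TᵏQ`. -/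
def canonicalLift (k : ℕ) (γ : ℝ → Q) (t : ℝ) : HOTangent E Q k := jet k (shiftCurve γ t)

theorem canonicalLift_eventually {k : ℕ} (σ : Curve E Q) {e : OpenPartialHomeomorph Q E}
    (he : e ∈ atlas E Q) (hs : σ.1 0 ∈ e.source) :
    ∀ᶠ t in 𝓝 (0 : ℝ), baseProj (canonicalLift (E := E) k σ.1 t) ∈ e.source ∧
      ∀ i : Fin (k + 1), jetCoord k he (canonicalLift k σ.1 t) i =
        iteratedDeriv (i : ℕ) (e ∘ σ.1) t := by
  filter_upwards [eventually_eventually_nhds.2 σ.smooth, σ.contMDiffAt.continuousAt (e.open_source.mem_nhds hs)] with t ht ht'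
  have h2 : (shiftCurve (E := E) σ.1 t).1 = fun s => σ.1 (s + t) := by
    rw [shiftCurve, dif_pos ht]
  have h3 : (shiftCurve (E := E) σ.1 t).1 0 ∈ e.source := by
    rw [h2]
    simpa using ht'
  refine ⟨h3, fun i => ?_⟩
  rw [canonicalLift, jetCoord_jet he h3, h2]
  have := congrFun (iteratedDeriv_comp_add_const (i : ℕ) (e ∘ σ.1) t) 0
  simp only [zero_add] at this
  exact this

theorem baseProj_canonicalLift (k : ℕ) (γ : ℝ → Q) (t : ℝ) :
    baseProj (canonicalLift (E := E) k γ t) = γ t := by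
  show (shiftCurve (E := E) γ t).1 0 = γ t
  rw [shiftCurve]
  split_ifs
  · show γ (0 + t) = γ t
    rw [zero_add]
  · rfl

/-- In natural coordinates the velocity of the lifting `t ↦ σ̃ʳ(t)` at `t = 0` is
`(q₁, …, q_{r+1})`. -/
theorem mfderiv_canonicalLift {r : ℕ} (σ : Curve E Q) (i : Fin (r + 1)) :
    (mfderiv 𝓘(ℝ, ℝ) 𝓘(ℝ, Fin (r + 1) → E) (canonicalLift (E := E) r σ.1) 0 (1 : ℝ) :
      Fin (r + 1) → E) i = iteratedDeriv (i + 1 : ℕ) (chartAt E (σ.1 0) ∘ σ.1) 0 := by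
  have hb : baseProj (canonicalLift (E := E) r σ.1 0) = σ.1 0 := baseProj_canonicalLift r σ.1 0
  rw [← hb]
  set p := canonicalLift (E := E) r σ.1 0 with hp
  set e := chartAt E (baseProj p) with he
  have hea : e ∈ atlas E Q := chart_mem_atlas E _
  have hs : σ.1 0 ∈ e.source := hb ▸ mem_chart_source E (baseProj p)
  set c := chartAt (Fin (r + 1) → E) p with hc
  have hev := canonicalLift_eventually (k := r) σ hea hs
  set g : ℝ → (Fin (r + 1) → E) := fun t i => iteratedDeriv (i : ℕ) (e ∘ σ.1) t with hg
  have hcg : (fun t => c (canonicalLift (E := E) r σ.1 t)) =ᶠ[𝓝 0] g := by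
    filter_upwards [hev] with t ht
    funext i
    exact ht.2 i
  have hgi : ∀ i : Fin (r + 1), HasDerivAt (fun t => g t i)
      (iteratedDeriv (i + 1 : ℕ) (e ∘ σ.1) 0) 0 := by
    intro i
    have hd : DifferentiableAt ℝ (iteratedDeriv (i : ℕ) (e ∘ σ.1)) 0 := by
      have h1 := σ.contDiffAt_chart hea hs
      have h2 : ContDiffAt ℝ ((i : ℕ) + 1 : ℕ) (e ∘ σ.1) 0 := h1.of_le (by exact_mod_cast le_top)
      have h3 := (h2.contDiffWithinAt (s := univ)).differentiableWithinAt_iteratedDerivWithin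
        (m := (i : ℕ)) (by exact_mod_cast Nat.lt_succ_self _) (by simp)
      rw [iteratedDerivWithin_univ] at h3
      exact h3.differentiableAt univ_mem
    rw [iteratedDeriv_succ]
    exact hd.hasDerivAt
  have hgd : HasDerivAt g (fun i => iteratedDeriv (i + 1 : ℕ) (e ∘ σ.1) 0) 0 :=
    hasDerivAt_pi.2 hgi
  have hcont : ContinuousAt (canonicalLift (E := E) r σ.1) 0 := by
    have h1 : canonicalLift (E := E) r σ.1 =ᶠ[𝓝 0] fun t => c.symm (g t) := by
      filter_upwards [hev, hcg] with t ht ht'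
      rw [← ht']
      exact (c.left_inv ht.1).symm
    have h0 : g 0 ∈ c.target := by
      rw [← hcg.self_of_nhds]
      exact c.map_source (mem_chart_source _ p)
    have h2 : ContinuousAt (fun t => c.symm (g t)) 0 :=
      ContinuousAt.comp (f := g) (g := c.symm) (c.symm.continuousAt h0) hgd.continuousAt
    exact h2.congr h1.symm
  have hder : HasMFDerivAt 𝓘(ℝ, ℝ) 𝓘(ℝ, Fin (r + 1) → E) (canonicalLift (E := E) r σ.1) 0
      (ContinuousLinearMap.toSpanSingleton ℝ
        (fun i : Fin (r + 1) => iteratedDeriv (i + 1 : ℕ) (e ∘ σ.1) 0)) := by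
    refine ⟨hcont, ?_⟩
    have h1 : HasFDerivAt g (ContinuousLinearMap.toSpanSingleton ℝ
        (fun i : Fin (r + 1) => iteratedDeriv (i + 1 : ℕ) (e ∘ σ.1) 0)) 0 := hgd.hasFDerivAt
    exact (h1.congr_of_eventuallyEq hcg).hasFDerivWithinAt
  rw [hder.mfderiv]
  show ((1 : ℝ) • (fun i : Fin (r + 1) => iteratedDeriv (i + 1 : ℕ) (e ∘ σ.1) 0)) i = _
  rw [one_smul]

/-- The velocity at `0` of the lifting of a curve to `TʳQ`, in the tangent space at its `r`-jet. -/
def liftVelocity (r : ℕ) (σ : Curve E Q) : Fin (r + 1) → E :=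
  mfderiv 𝓘(ℝ, ℝ) 𝓘(ℝ, Fin (r + 1) → E) (canonicalLift (E := E) r σ.1) 0 (1 : ℝ)

theorem liftVelocity_congr {r k : ℕ} (h : r + 1 ≤ k) {σ τ : Curve E Q} (hst : JetRel k σ τ) :
    liftVelocity r σ = liftVelocity r τ := by
  funext i
  unfold liftVelocity
  have hi : (i : ℕ) + 1 ≤ k := (Nat.succ_le_of_lt i.2).trans h
  rw [mfderiv_canonicalLift, mfderiv_canonicalLift, hst.2 _ hi, hst.1]

/-- The canonical injection `TᵏQ → T(TʳQ)`, sending `σ̃ᵏ(0)` to the velocity at `t = 0` of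
`t ↦ σ̃ʳ(t)`, for `r + 1 ≤ k` (this is `j_{r+1}`). -/
def canonicalInj {r k : ℕ} (h : r + 1 ≤ k) (p : HOTangent E Q k) :
    TangentSpace 𝓘(ℝ, Fin (r + 1) → E) (jetProj (r := r) (Nat.le_of_succ_le h) p) :=
  (Quotient.lift (liftVelocity r) (fun _ _ hst => liftVelocity_congr h hst) p : Fin (r + 1) → E)

/-! ### Differential forms -/

/-- A (not necessarily smooth) one-form on a manifold. -/
abbrev OneForm {V H : Type*} [NormedAddCommGroup V] [NormedSpace ℝ V] [TopologicalSpace H]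
    (I : ModelWithCorners ℝ V H) (M : Type*) [TopologicalSpace M] [ChartedSpace H M] : Type _ :=
  ∀ x : M, TangentSpace I x →L[ℝ] ℝ

/-- The differential of a real function, as a one-form. -/
def diffFun {V H : Type*} [NormedAddCommGroup V] [NormedSpace ℝ V] [TopologicalSpace H]
    (I : ModelWithCorners ℝ V H) {M : Type*} [TopologicalSpace M] [ChartedSpace H M]
    (f : M → ℝ) : OneForm I M :=
  fun x => mfderiv I 𝓘(ℝ, ℝ) f x

/-- The exterior derivative of a one-form at `x`, computed in the preferred chart at `x`:
`dα(u, v) = ∂_u (α(v)) - ∂_v (α(u))` for `u`, `v` constant in the chart. -/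
def extDerivOne {V H : Type*} [NormedAddCommGroup V] [NormedSpace ℝ V] [TopologicalSpace H]
    {I : ModelWithCorners ℝ V H} {M : Type*} [TopologicalSpace M] [ChartedSpace H M]
    (α : OneForm I M) (x : M) : TangentSpace I x →L[ℝ] TangentSpace I x →L[ℝ] ℝ :=
  let a : V → (V →L[ℝ] ℝ) := fun y =>
    (α ((extChartAt I x).symm y)).comp (mfderivWithin 𝓘(ℝ, V) I (extChartAt I x).symm (range I) y)
  let D : V →L[ℝ] V →L[ℝ] ℝ := fderivWithin ℝ a (range I) (extChartAt I x x)
  D - D.flip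

/-- The `r`th vertical endomorphism `J_r` of `T(TᵏQ)`, in the natural coordinates around the
point: `(v₀, …, v_k) ↦ (0, …, 0, r!/0! v₀, (r+1)!/1! v₁, …, k!/(k-r)! v_{k-r})`. -/
def vertEndo {k : ℕ} (r : ℕ) (p : HOTangent E Q k) :
    TangentSpace 𝓘(ℝ, Fin (k + 1) → E) p →L[ℝ] TangentSpace 𝓘(ℝ, Fin (k + 1) → E) p :=
  (ContinuousLinearMap.pi fun i : Fin (k + 1) =>
    if h : r ≤ (i : ℕ) then
      (((i : ℕ).factorial : ℝ) / (((i : ℕ) - r).factorial : ℝ)) •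
        ContinuousLinearMap.proj (R := ℝ) (φ := fun _ : Fin (k + 1) => E)
          ⟨(i : ℕ) - r, lt_of_le_of_lt (Nat.sub_le _ _) i.2⟩
    else 0 : (Fin (k + 1) → E) →L[ℝ] (Fin (k + 1) → E))

/-- The one-form `d_{J_r} f = df ∘ J_r`. -/
def vertDiff {k : ℕ} (r : ℕ) (f : HOTangent E Q k → ℝ) :
    OneForm 𝓘(ℝ, Fin (k + 1) → E) (HOTangent E Q k) :=
  fun p => (diffFun 𝓘(ℝ, Fin (k + 1) → E) f p).comp (vertEndo r p)

/-- Pull-back of a one-form from `TʳQ` to `TᵏQ`. -/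
def pullOne {r k : ℕ} (h : r ≤ k) (α : OneForm 𝓘(ℝ, Fin (r + 1) → E) (HOTangent E Q r)) :
    OneForm 𝓘(ℝ, Fin (k + 1) → E) (HOTangent E Q k) :=
  fun p => (α (jetProj h p)).comp
    (mfderiv 𝓘(ℝ, Fin (k + 1) → E) 𝓘(ℝ, Fin (r + 1) → E) (jetProj h) p)

/-- Tulczyjew's derivation `d_T α` of a one-form `α` on `TᵏQ`, i.e. `d_T = i_T d + d i_T`, where
`i_T` is the contraction with the canonical injection `T^{k+1}Q → T(TᵏQ)`. In natural coordinates
`d_T (a dqᵢ) = (d_T a) dqᵢ + a dq_{i+1}`, where `d_T a = ∑ q_{j+1} ∂a/∂q_j`. -/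
def tulczyjew {k : ℕ} (α : OneForm 𝓘(ℝ, Fin (k + 1) → E) (HOTangent E Q k)) :
    OneForm 𝓘(ℝ, Fin (k + 1 + 1) → E) (HOTangent E Q (k + 1)) :=
  fun p =>
    (extDerivOne α (jetProj (Nat.le_succ k) p) (canonicalInj le_rfl p)).comp
      (mfderiv 𝓘(ℝ, Fin (k + 1 + 1) → E) 𝓘(ℝ, Fin (k + 1) → E) (jetProj (Nat.le_succ k)) p) +
    diffFun 𝓘(ℝ, Fin (k + 1 + 1) → E) (fun p' : HOTangent E Q (k + 1) =>
      α (jetProj (Nat.le_succ k) p') (canonicalInj le_rfl p')) p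

/-- The iterate `d_Tˢ` on one-forms. -/
def tulczyjewIter {k : ℕ} (α : OneForm 𝓘(ℝ, Fin (k + 1) → E) (HOTangent E Q k)) :
    (s : ℕ) → OneForm 𝓘(ℝ, Fin (k + s + 1) → E) (HOTangent E Q (k + s))
  | 0 => α
  | s + 1 => tulczyjew (tulczyjewIter α s)

/-! ### The Lagrangian side. The order is `m + 1`, so `2(m + 1) - 1 = 2m + 1`. -/

/-- The Lagrangian one-form `θ_L = ∑_{r=1}^{k} (-1)^{r-1} (1/r!) d_T^{r-1} d_{J_r} L` on
`T^{2k-1}Q`, with `k = m + 1` and `r = s + 1`. -/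
def lagrangianOne {m : ℕ} (L : HOTangent E Q (m + 1) → ℝ) :
    OneForm 𝓘(ℝ, Fin (2 * m + 1 + 1) → E) (HOTangent E Q (2 * m + 1)) :=
  fun p => ∑ s : Fin (m + 1), ((-1 : ℝ) ^ (s : ℕ) / (((s : ℕ) + 1).factorial : ℝ)) •
    pullOne (r := m + 1 + s) (k := 2 * m + 1) (by have := s.2; omega)
      (tulczyjewIter (vertDiff ((s : ℕ) + 1) L) s) p

/-- The Lagrangian two-form `ω_L = -dθ_L`. -/
def lagrangianTwo {m : ℕ} (L : HOTangent E Q (m + 1) → ℝ) (p : HOTangent E Q (2 * m + 1)) :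
    TangentSpace 𝓘(ℝ, Fin (2 * m + 1 + 1) → E) p →L[ℝ]
      TangentSpace 𝓘(ℝ, Fin (2 * m + 1 + 1) → E) p →L[ℝ] ℝ :=
  -extDerivOne (lagrangianOne L) p

/-- A Lagrangian is regular if `ω_L` is symplectic. As `ω_L` is exact, this means that it is
nondegenerate at every point. -/
def IsRegularLagrangian {m : ℕ} (L : HOTangent E Q (m + 1) → ℝ) : Prop :=
  ∀ (p : HOTangent E Q (2 * m + 1)) (u : TangentSpace 𝓘(ℝ, Fin (2 * m + 1 + 1) → E) p),
    (∀ v, lagrangianTwo L p u v = 0) → u = 0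

/-! ### Cotangent bundles -/

section Cotangent

variable {V H : Type*} [NormedAddCommGroup V] [NormedSpace ℝ V] [TopologicalSpace H]
  (I : ModelWithCorners ℝ V H) (M : Type*) [TopologicalSpace M] [ChartedSpace H M]

/-- The cotangent spaces of a manifold. -/
abbrev CotangentSpace (x : M) : Type _ := TangentSpace I x →L[ℝ] Bundle.Trivial M ℝ x

/-- The cotangent bundle of a manifold. -/
abbrev CotangentBundle : Type _ := TotalSpace (V →L[ℝ] ℝ) (CotangentSpace I M)

variable [IsManifold I ∞ M]

/-- The canonical one-form `θ` of `T*M`: `θ_α(u) = α(Tπ u)`. -/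
def canonicalOne : OneForm (I.prod 𝓘(ℝ, V →L[ℝ] ℝ)) (CotangentBundle I M) :=
  fun α => ContinuousLinearMap.comp (α.2 : TangentSpace I α.1 →L[ℝ] ℝ)
    (mfderiv (I.prod 𝓘(ℝ, V →L[ℝ] ℝ)) I (TotalSpace.proj : CotangentBundle I M → M) α)

/-- The canonical symplectic form `ω = -dθ` of `T*M`. -/
def canonicalTwo (α : CotangentBundle I M) :
    TangentSpace (I.prod 𝓘(ℝ, V →L[ℝ] ℝ)) α →L[ℝ]
      TangentSpace (I.prod 𝓘(ℝ, V →L[ℝ] ℝ)) α →L[ℝ] ℝ :=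
  -extDerivOne (canonicalOne I M) α

end Cotangent

/-! ### The unified phase space `W = T^{2k-1}Q ×_{T^{k-1}Q} T*(T^{k-1}Q)`, with `k = m + 1` -/

variable (E Q) in
/-- The projection `ρ : T^{2k-1}Q → T^{k-1}Q` as a smooth map. -/
def rho (m : ℕ) : ContMDiffMap 𝓘(ℝ, Fin (2 * m + 1 + 1) → E) 𝓘(ℝ, Fin (m + 1) → E)
    (HOTangent E Q (2 * m + 1)) (HOTangent E Q m) ∞ :=
  ⟨jetProj (by omega), contMDiff_jetProj _⟩

variable (E Q) in
/-- The unified phase space: pairs `(p, α)` with `p ∈ T^{2k-1}Q` and `α ∈ T*_{ρ(p)}(T^{k-1}Q)`,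
as the pull-back of the bundle `T*(T^{k-1}Q)` along `ρ`. -/
abbrev UnifiedSpace (m : ℕ) : Type _ :=
  TotalSpace ((Fin (m + 1) → E) →L[ℝ] ℝ)
    (rho E Q m *ᵖ (CotangentSpace 𝓘(ℝ, Fin (m + 1) → E) (HOTangent E Q m)))

variable (E) in
/-- The model of the unified phase space. -/
abbrev unifiedModel (m : ℕ) := 𝓘(ℝ, Fin (2 * m + 1 + 1) → E).prod
  𝓘(ℝ, (Fin (m + 1) → E) →L[ℝ] ℝ)

/-- The covector component `α ∈ T*_{ρ(p)}(T^{k-1}Q)` of a point `(p, α)` of `W`. -/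
def covector {m : ℕ} (w : UnifiedSpace E Q m) :
    TangentSpace 𝓘(ℝ, Fin (m + 1) → E) (rho E Q m w.proj) →L[ℝ] ℝ := w.snd

/-- The graph `W_o` of the Legendre-Ostrogradsky map `FL : T^{2k-1}Q → T*(T^{k-1}Q)`, where
`FL(p)` is the covector `α` at `ρ(p)` determined by `θ_L(u) = α(Tρ(u))` for all `u` tangent to
`T^{2k-1}Q` at `p` (it is unique since `Tρ` is onto). -/
def legendreGraph {m : ℕ} (L : HOTangent E Q (m + 1) → ℝ) : Set (UnifiedSpace E Q m) :=
  {w | ∀ u : TangentSpace 𝓘(ℝ, Fin (2 * m + 1 + 1) → E) w.proj, lagrangianOne L w.proj u =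
    covector w (mfderiv 𝓘(ℝ, Fin (2 * m + 1 + 1) → E) 𝓘(ℝ, Fin (m + 1) → E) (rho E Q m) w.proj u)}

/-- The projection `pr₂ : W → T*(T^{k-1}Q)`. -/
def prTwo {m : ℕ} (w : UnifiedSpace E Q m) :
    CotangentBundle 𝓘(ℝ, Fin (m + 1) → E) (HOTangent E Q m) :=
  Pullback.lift (rho E Q m) w

/-- The presymplectic form `Ω = pr₂^* ω_{k-1}`. -/
def unifiedTwo {m : ℕ} (w : UnifiedSpace E Q m) (u v : TangentSpace (unifiedModel E m) w) : ℝ :=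
  canonicalTwo 𝓘(ℝ, Fin (m + 1) → E) (HOTangent E Q m) (prTwo w)
    (mfderiv (unifiedModel E m)
      (𝓘(ℝ, Fin (m + 1) → E).prod 𝓘(ℝ, (Fin (m + 1) → E) →L[ℝ] ℝ)) prTwo w u)
    (mfderiv (unifiedModel E m)
      (𝓘(ℝ, Fin (m + 1) → E).prod 𝓘(ℝ, (Fin (m + 1) → E) →L[ℝ] ℝ)) prTwo w v)

/-- The coupling function `C(p, α) = ⟨α, j_k(p)⟩`. -/
def coupling {m : ℕ} (w : UnifiedSpace E Q m) : ℝ :=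
  covector w (canonicalInj (r := m) (k := 2 * m + 1) (by omega) w.proj)

/-- The Hamiltonian function `H = C - L` on `W`. -/
def unifiedHamiltonian {m : ℕ} (L : HOTangent E Q (m + 1) → ℝ) (w : UnifiedSpace E Q m) : ℝ :=
  coupling w - L (jetProj (by omega) w.proj)

/-- `X` is a vector field solution of the dynamical equation `i(X)Ω = dH` along `W_o`: a smooth
vector field of `W` with support on `W_o` (its values off `W_o` are irrelevant), with
`Ω(X, v) = dH(v)` for every vector `v` tangent to `W` at a point of `W_o`. -/
structure IsUnifiedSolution {m : ℕ} (L : HOTangent E Q (m + 1) → ℝ)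
    (X : ∀ w : UnifiedSpace E Q m, TangentSpace (unifiedModel E m) w) : Prop where
  smooth : ContMDiffOn (unifiedModel E m) (unifiedModel E m).tangent ∞
    (fun w => (⟨w, X w⟩ : TangentBundle (unifiedModel E m) (UnifiedSpace E Q m)))
    (legendreGraph L)
  equation : ∀ w ∈ legendreGraph L, ∀ v : TangentSpace (unifiedModel E m) w,
    unifiedTwo w (X w) v = diffFun (unifiedModel E m) (unifiedHamiltonian L) w v

end HigherOrder
end

open HigherOrder

open Set Filter Topology Bundle Manifold ContDiff

noncomputable section

namespace HigherOrder

/-! Put k = m + 1 and use natural coordinates q_0, …, q_{2m+1} with momenta p^0, …, p^m, so that Ω =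
dq_i ∧ dp^i and H = p^i q_{i+1} − L. Let (X₁, X₂) be the value of X at a point of the curve. Testing
the equation on momentum directions gives (X₁)_i = q_{i+1} for i ≤ m only. Testing it on the
remaining directions gives X₂(v_0, …, v_m) + p(v_1, …, v_{m+1}) = dL(v). The curve stays on the
Legendre graph, where p is θ_L, so differentiating this relation in time turns X₂ into Dθ_L(X₁).
Hence Dθ_L(X₁)(v) + θ_L(shift of v) = dL(v).

Every holonomic vector Y (that is, Y_i = q_{i+1} for i ≤ 2m, last component free) satisfies the same
equation for all v with v_0 = 0, whatever the dynamics: this is d_T θ_L = dL modulo dq_0, proved in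
`fderiv_lagrangianRep_add`. Subtracting, and using that θ_L involves only dq_0, …, dq_m, one finds
that X₁ − Y is ω_L-orthogonal to {v_0 = 0}. Since the last component of Y is free, every vector in
the direction of q_{2m+1} is orthogonal to it too. By nondegeneracy this orthogonal embeds in the
dual of E, and the last-coordinate vectors already fill a space of dimension dim E. So X₁ − Y is a
last-coordinate vector, and it vanishes once Y is given the last component of X₁
(`holonomic_of_nondegenerate`). A curve with holonomic velocity is a canonical lifting
(`eq_canonicalLift_of_holonomic`).

The identity d_T θ_L = dL modulo dq_0 rests on the commutator of d_T with the first vertical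
endomorphism (`totalDeriv_iterate_timeMul`): on variations v(t) of a curve the former is d/dt and
the latter is multiplication by t. With J_r the rth power of J_1, the alternating sum of the d_T^r
d_{J_r} L / r! evaluated on the image of J_1 telescopes to a term in J_{k+1} = 0. The same picture
shows that the J_r do not depend on the chart: a coordinate change acts on v(t) linearly at each
time t, hence commutes with multiplication by t. -/

/-! ### One-forms in charts -/

section Charts

variable {V : Type*} [NormedAddCommGroup V] [NormedSpace ℝ V]
  {M : Type*} [TopologicalSpace M] [ChartedSpace V M]

/-- The derivative of a chart, as a map of the model space. -/
def chartDeriv (c : OpenPartialHomeomorph M V) (x : M) : V →L[ℝ] V :=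
  mfderiv 𝓘(ℝ, V) 𝓘(ℝ, V) c x

/-- The derivative of the inverse of a chart, as a map of the model space. -/
def chartSymmDeriv (c : OpenPartialHomeomorph M V) (y : V) : V →L[ℝ] V :=
  mfderiv 𝓘(ℝ, V) 𝓘(ℝ, V) c.symm y

/-- The expression of a one-form in a chart. -/
def formRep (c : OpenPartialHomeomorph M V) (α : OneForm 𝓘(ℝ, V) M) (y : V) : V →L[ℝ] ℝ :=
  ContinuousLinearMap.comp (show V →L[ℝ] ℝ from α (c.symm y)) (chartSymmDeriv c y)

theorem extDerivOne_eq_formRep (α : OneForm 𝓘(ℝ, V) M) (x : M) (u v : V) :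
    extDerivOne α x u v = fderiv ℝ (formRep (chartAt V x) α) (chartAt V x x) u v -
      fderiv ℝ (formRep (chartAt V x) α) (chartAt V x x) v u := by
  simp only [extDerivOne, mfld_simps, fderivWithin_univ, mfderivWithin_univ]
  rfl

variable [IsManifold 𝓘(ℝ, V) ∞ M]

theorem mdifferentiableAt_chart {c : OpenPartialHomeomorph M V} (hc : c ∈ atlas V M) {x : M}
    (hx : x ∈ c.source) : MDifferentiableAt 𝓘(ℝ, V) 𝓘(ℝ, V) c x :=
  (contMDiffAt_of_mem_maximalAtlas (IsManifold.subset_maximalAtlas (n := ∞) hc) hx).mdifferentiableAt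
    (by simp)

theorem mdifferentiableAt_chart_symm {c : OpenPartialHomeomorph M V} (hc : c ∈ atlas V M) {y : V}
    (hy : y ∈ c.target) : MDifferentiableAt 𝓘(ℝ, V) 𝓘(ℝ, V) c.symm y :=
  (contMDiffAt_symm_of_mem_maximalAtlas (IsManifold.subset_maximalAtlas (n := ∞) hc)
    hy).mdifferentiableAt (by simp)

theorem chartSymmDeriv_chartDeriv {c : OpenPartialHomeomorph M V} (hc : c ∈ atlas V M) {x : M}
    (hx : x ∈ c.source) (u : V) :
    chartSymmDeriv c (c x)
      (chartDeriv c x u) = u := by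
  have h := mfderiv_comp x (mdifferentiableAt_chart_symm hc (c.map_source hx))
    (mdifferentiableAt_chart hc hx)
  have h' : mfderiv 𝓘(ℝ, V) 𝓘(ℝ, V) (c.symm ∘ c) x = ContinuousLinearMap.id ℝ _ := by
    rw [← mfderiv_id]
    refine Filter.EventuallyEq.mfderiv_eq ?_
    filter_upwards [c.open_source.mem_nhds hx] with z hz using c.left_inv hz
  rw [h'] at h
  exact (DFunLike.congr_fun h u).symm

theorem chartDeriv_chartSymmDeriv {c : OpenPartialHomeomorph M V} (hc : c ∈ atlas V M) {y : V}
    (hy : y ∈ c.target) (u : V) :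
    chartDeriv c (c.symm y)
      (chartSymmDeriv c y u) = u := by
  have h := mfderiv_comp y (mdifferentiableAt_chart hc (c.map_target hy))
    (mdifferentiableAt_chart_symm hc hy)
  have h' : mfderiv 𝓘(ℝ, V) 𝓘(ℝ, V) (c ∘ c.symm) y = ContinuousLinearMap.id ℝ _ := by
    rw [← mfderiv_id]
    refine Filter.EventuallyEq.mfderiv_eq ?_
    filter_upwards [c.open_target.mem_nhds hy] with z hz using c.right_inv hz
  rw [h'] at h
  exact (DFunLike.congr_fun h u).symm

theorem formRep_apply_chartDeriv {c : OpenPartialHomeomorph M V} (hc : c ∈ atlas V M) {x : M}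
    (hx : x ∈ c.source) (α : OneForm 𝓘(ℝ, V) M) (u : V) :
    formRep c α (c x) (chartDeriv c x u) = (show V →L[ℝ] ℝ from α x) u := by
  rw [formRep, ContinuousLinearMap.comp_apply, chartSymmDeriv_chartDeriv hc hx, c.left_inv hx]

theorem contDiffOn_chart_transition {c c' : OpenPartialHomeomorph M V} (hc : c ∈ atlas V M)
    (hc' : c' ∈ atlas V M) : ContDiffOn ℝ ∞ (c' ∘ c.symm) (c.symm.trans c').source :=
  contDiffOn_transition hc hc'

theorem chartDeriv_trans {c c' : OpenPartialHomeomorph M V} (hc : c ∈ atlas V M)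
    (hc' : c' ∈ atlas V M) {y : V} (hy : y ∈ (c.symm.trans c').source) (u : V) :
    chartDeriv c' (c.symm y)
      (chartSymmDeriv c y u) = fderiv ℝ (c' ∘ c.symm) y u := by
  have hy1 : y ∈ c.target := hy.1
  have hy2 : c.symm y ∈ c'.source := hy.2
  have h := mfderiv_comp y (mdifferentiableAt_chart hc' hy2) (mdifferentiableAt_chart_symm hc hy1)
  rw [mfderiv_eq_fderiv] at h
  exact (DFunLike.congr_fun h u).symm

theorem formRep_trans {c c' : OpenPartialHomeomorph M V} (hc : c ∈ atlas V M)
    (hc' : c' ∈ atlas V M) (α : OneForm 𝓘(ℝ, V) M) {y : V} (hy : y ∈ (c.symm.trans c').source) :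
    formRep c α y = (formRep c' α (c' (c.symm y))).comp (fderiv ℝ (c' ∘ c.symm) y) := by
  ext u
  rw [ContinuousLinearMap.comp_apply, ← chartDeriv_trans hc hc' hy,
    formRep_apply_chartDeriv hc' (show c.symm y ∈ c'.source from hy.2)]
  rfl

/-- The exterior derivative of a one-form may be computed in any chart. -/
theorem extDerivOne_eq_of_chart {c : OpenPartialHomeomorph M V} (hc : c ∈ atlas V M) {x : M}
    (hx : x ∈ c.source) {α : OneForm 𝓘(ℝ, V) M} (hα : DifferentiableAt ℝ (formRep c α) (c x))
    (u v : V) :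
    extDerivOne α x u v =
      fderiv ℝ (formRep c α) (c x) (chartDeriv c x u)
        (chartDeriv c x v) -
      fderiv ℝ (formRep c α) (c x) (chartDeriv c x v)
        (chartDeriv c x u) := by
  set d := chartAt V x with hd
  have hda : d ∈ atlas V M := chart_mem_atlas V x
  have hxd : x ∈ d.source := mem_chart_source V x
  set y := d x with hy
  have hys : y ∈ (d.symm.trans c).source := by simp [hy, hxd, hx]
  have hyx : d.symm y = x := d.left_inv hxd
  set ψ : V → V := c ∘ d.symm with hψ
  have hψy : ψ y = c x := by simp [hψ, hyx]
  have hO : (d.symm.trans c).source ∈ 𝓝 y := (d.symm.trans c).open_source.mem_nhds hys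
  have hψs : ContDiffAt ℝ ∞ ψ y := (contDiffOn_chart_transition hda hc).contDiffAt hO
  have hψ1 : DifferentiableAt ℝ ψ y := hψs.differentiableAt (by simp)
  have hψ2 : DifferentiableAt ℝ (fderiv ℝ ψ) y :=
    (hψs.fderiv_right (m := ∞) (by simp)).differentiableAt (by simp)
  have hsym : IsSymmSndFDerivAt ℝ ψ y := hψs.isSymmSndFDerivAt (by
    rw [minSmoothness_of_isRCLikeNormedField]; exact WithTop.coe_le_coe.2 le_top)
  -- Tangent vectors at `x` are expressed in the preferred chart `d`, whose inverse therefore has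
  -- derivative the identity at `y`; so the derivative of `c` at `x` is that of the transition map.
  have hD : ∀ w : V, chartDeriv c x w = fderiv ℝ ψ y w := by
    intro w
    have h1 := chartDeriv_trans hda hc hys w
    have h2 : chartSymmDeriv d y = ContinuousLinearMap.id ℝ V := by
      have := mfderivWithin_range_extChartAt_symm (I := 𝓘(ℝ, V)) (x := x)
      simpa only [mfld_simps, mfderivWithin_univ] using! this
    rw [h2, hyx] at h1
    exact h1
  have hev : formRep d α =ᶠ[𝓝 y] fun z => (formRep c α (ψ z)).comp (fderiv ℝ ψ z) := by
    filter_upwards [hO] with z hz using formRep_trans hda hc α hz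
  rw [← hψy] at hα
  have hb : HasFDerivAt (fun z => formRep c α (ψ z))
      ((fderiv ℝ (formRep c α) (ψ y)).comp (fderiv ℝ ψ y)) y :=
    hα.hasFDerivAt.comp y hψ1.hasFDerivAt
  have hda' := hb.clm_comp hψ2.hasFDerivAt
  rw [extDerivOne_eq_formRep, ← hd, ← hy, hev.fderiv_eq, hda'.fderiv, hD, hD, ← hψy]
  simp only [add_apply, ContinuousLinearMap.comp_apply,
    ContinuousLinearMap.compL_apply, ContinuousLinearMap.flip_apply]
  -- The product rule leaves the form applied to the second derivative of `ψ`; this is symmetric in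
  -- `u`, `v` and drops out of the antisymmetrization.
  rw [hsym.eq u v]
  ring

theorem formRep_diffFun {c : OpenPartialHomeomorph M V} (hc : c ∈ atlas V M) {f : M → ℝ} {y : V}
    (hy : y ∈ c.target) (hf : MDifferentiableAt 𝓘(ℝ, V) 𝓘(ℝ, ℝ) f (c.symm y)) :
    formRep c (diffFun 𝓘(ℝ, V) f) y = fderiv ℝ (f ∘ c.symm) y := by
  have h := mfderiv_comp y hf (mdifferentiableAt_chart_symm hc hy)
  rw [mfderiv_eq_fderiv] at h
  exact h.symm

end Charts

/-! ### Variations of polynomial curves -/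

section Variations

variable {E : Type*} [NormedAddCommGroup E] [NormedSpace ℝ E]

theorem polyCurve_add {k : ℕ} (q v : Fin (k + 1) → E) (t : ℝ) :
    polyCurve (q + v) t = polyCurve q t + polyCurve v t := by
  simp [polyCurve, Finset.sum_add_distrib]

theorem polyCurve_smul {k : ℕ} (c : ℝ) (q : Fin (k + 1) → E) (t : ℝ) :
    polyCurve (c • q) t = c • polyCurve q t := by
  simp [polyCurve, Finset.smul_sum, smul_comm c]

/-- Derivatives in the last variable of a smooth function of `(q, t)` are smooth, and commute
with derivatives in the first variable. -/
theorem iteratedDeriv_snd {F G : Type*} [NormedAddCommGroup F] [NormedSpace ℝ F]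
    [NormedAddCommGroup G] [NormedSpace ℝ G] {Φ : F × ℝ → G} {U : Set (F × ℝ)} (hU : IsOpen U)
    (hΦ : ContDiffOn ℝ ∞ Φ U) (i : ℕ) :
    ContDiffOn ℝ ∞ (fun x : F × ℝ => iteratedDeriv i (fun t => Φ (x.1, t)) x.2) U ∧
    ∀ x ∈ U, ∀ v : F,
      fderiv ℝ (fun x : F × ℝ => iteratedDeriv i (fun t => Φ (x.1, t)) x.2) x (v, 0) =
        iteratedDeriv i (fun t => fderiv ℝ Φ (x.1, t) (v, 0)) x.2 := by
  have key : ∀ Ψ : F × ℝ → G, ContDiffOn ℝ ∞ Ψ U → ∀ i : ℕ, ∀ x ∈ U,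
      DifferentiableAt ℝ (fun x : F × ℝ => iteratedDeriv i (fun t => Ψ (x.1, t)) x.2) x →
      iteratedDeriv (i + 1) (fun t => Ψ (x.1, t)) x.2 =
        fderiv ℝ (fun x : F × ℝ => iteratedDeriv i (fun t => Ψ (x.1, t)) x.2) x (0, 1) := by
    intro Ψ _ i x _ hd
    rw [iteratedDeriv_succ]
    have hc : HasDerivAt (fun t : ℝ => (x.1, t)) ((0, 1) : F × ℝ) x.2 :=
      (hasDerivAt_const _ _).prodMk (hasDerivAt_id _)
    exact (HasFDerivAt.comp_hasDerivAt (x := x.2) (f := fun t : ℝ => (x.1, t))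
      (l := fun x : F × ℝ => iteratedDeriv i (fun t => Ψ (x.1, t)) x.2)
      (by exact hd.hasFDerivAt) hc).deriv
  have smooth : ∀ Ψ : F × ℝ → G, ContDiffOn ℝ ∞ Ψ U → ∀ i : ℕ,
      ContDiffOn ℝ ∞ (fun x : F × ℝ => iteratedDeriv i (fun t => Ψ (x.1, t)) x.2) U := by
    intro Ψ hΨ i
    induction i with
    | zero => simpa using hΨ
    | succ i ih =>
      refine ((ih.fderiv_of_isOpen hU (m := ∞) (by simp)).clm_apply
        (contDiffOn_const (c := ((0, 1) : F × ℝ)))).congr fun x hx => ?_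
      exact key Ψ hΨ i x hx ((ih.contDiffAt (hU.mem_nhds hx)).differentiableAt (by simp))
  refine ⟨smooth Φ hΦ i, ?_⟩
  induction i with
  | zero => simp
  | succ i ih =>
    intro x hx v
    set Φi : F × ℝ → G := fun x => iteratedDeriv i (fun t => Φ (x.1, t)) x.2 with hΦi
    -- The induction hypothesis identifies the `i`th time derivative of this variation `Ψ` with the
    -- variation of the `i`th time derivative `Φi`.
    set Ψ : F × ℝ → G := fun x => fderiv ℝ Φ x (v, 0) with hΨ
    have hΨs : ContDiffOn ℝ ∞ Ψ U :=
      (hΦ.fderiv_of_isOpen hU (m := ∞) (by simp)).clm_apply contDiffOn_const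
    have hs : ContDiffAt ℝ ∞ Φi x := (smooth Φ hΦ i).contDiffAt (hU.mem_nhds hx)
    have hs2 : DifferentiableAt ℝ (fderiv ℝ Φi) x :=
      (hs.fderiv_right (m := ∞) (by simp)).differentiableAt (by simp)
    have hsym : IsSymmSndFDerivAt ℝ Φi x := hs.isSymmSndFDerivAt (by
      rw [minSmoothness_of_isRCLikeNormedField]; exact WithTop.coe_le_coe.2 le_top)
    have h1 : (fun x : F × ℝ => iteratedDeriv (i + 1) (fun t => Φ (x.1, t)) x.2) =ᶠ[𝓝 x]
        fun x => fderiv ℝ Φi x (0, 1) := by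
      filter_upwards [hU.mem_nhds hx] with z hz
      exact key Φ hΦ i z hz (((smooth Φ hΦ i).contDiffAt (hU.mem_nhds hz)).differentiableAt
        (by simp))
    have h2 : (fun x : F × ℝ => iteratedDeriv i (fun t => Ψ (x.1, t)) x.2) =ᶠ[𝓝 x]
        fun x => fderiv ℝ Φi x (v, 0) := by
      filter_upwards [hU.mem_nhds hx] with z hz using (ih z hz v).symm
    have h3 := key Ψ hΨs i x hx (((smooth Ψ hΨs i).contDiffAt (hU.mem_nhds hx)).differentiableAt
      (by simp))
    rw [h2.fderiv_eq] at h3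
    change _ = iteratedDeriv (i + 1) (fun t => Ψ (x.1, t)) x.2
    rw [h3, h1.fderiv_eq, fderiv_clm_apply hs2 (by fun_prop), fderiv_clm_apply hs2 (by fun_prop)]
    -- Symmetry of the second derivative of `Φi` exchanges the variation with one more time
    -- derivative.
    simpa using hsym.eq (v, 0) (0, 1)

/-- Since `polyCurve` is linear in its coefficients, the variation of t ↦ φ(q(t)) along v is
Dφ(q(t)) v(t). Commuting it past the time derivatives presents the coordinate change on tangent
vectors as an operation that is linear in v(t) at each t. -/
theorem fderiv_iteratedDeriv_polyCurve {φ : E → E} {S : Set E} (hS : IsOpen S)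
    (hφ : ContDiffOn ℝ ∞ φ S) {k : ℕ} (i : ℕ) {q : Fin (k + 1) → E} (hq : q 0 ∈ S)
    (v : Fin (k + 1) → E) :
    fderiv ℝ (fun q : Fin (k + 1) → E => iteratedDeriv i (φ ∘ polyCurve q) 0) q v =
      iteratedDeriv i (fun t => fderiv ℝ φ (polyCurve q t) (polyCurve v t)) 0 := by
  set U : Set ((Fin (k + 1) → E) × ℝ) := {x | polyCurve x.1 x.2 ∈ S}
  have hU : IsOpen U := hS.preimage contDiff_polyCurve.continuous
  set Φ : (Fin (k + 1) → E) × ℝ → E := fun x => φ (polyCurve x.1 x.2) with hΦdef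
  have hΦ : ContDiffOn ℝ ∞ Φ U := hφ.comp contDiff_polyCurve.contDiffOn fun x hx => hx
  obtain ⟨h1, h2⟩ := iteratedDeriv_snd hU hΦ i
  have hqU : (q, (0 : ℝ)) ∈ U := by
    show polyCurve q 0 ∈ S
    rwa [polyCurve_zero]
  have hd := ((h1.contDiffAt (hU.mem_nhds hqU)).differentiableAt (by simp)).hasFDerivAt
  have hc : HasFDerivAt (fun q : Fin (k + 1) → E => (q, (0 : ℝ)))
      (ContinuousLinearMap.inl ℝ _ ℝ) q := (ContinuousLinearMap.inl ℝ (Fin (k + 1) → E) ℝ).hasFDerivAt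
  have h3 := (HasFDerivAt.comp q (f := fun q : Fin (k + 1) → E => (q, (0 : ℝ))) hd hc).fderiv
  have h4 := DFunLike.congr_fun h3 v
  refine h4.trans ((h2 _ hqU v).trans ?_)
  refine Filter.EventuallyEq.iteratedDeriv_eq i ?_
  have hcont : Continuous fun t : ℝ => (q, t) := by fun_prop
  filter_upwards [hcont.continuousAt.preimage_mem_nhds (hU.mem_nhds hqU)] with t ht
  have hpt : polyCurve q t ∈ S := ht
  have hφd : HasFDerivAt φ (fderiv ℝ φ (polyCurve q t)) (polyCurve q t) :=
    ((hφ.contDiffAt (hS.mem_nhds hpt)).differentiableAt (by simp)).hasFDerivAt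
  have hΦd : DifferentiableAt ℝ Φ (q, t) :=
    (hΦ.contDiffAt (hU.mem_nhds ht)).differentiableAt (by simp)
  have hl : HasDerivAt (fun s : ℝ => (q + s • v, t)) (v, (0 : ℝ)) 0 := by
    have h5 : HasDerivAt (fun s : ℝ => q + s • v) v 0 := by
      simpa using ((hasDerivAt_id (0 : ℝ)).smul_const v).const_add q
    exact h5.prodMk (hasDerivAt_const _ _)
  -- `e1` and `e2` compute one directional derivative twice, through `Φ` and through `φ`.
  have e1 : HasDerivAt (fun s : ℝ => Φ (q + s • v, t)) (fderiv ℝ Φ (q, t) (v, 0)) 0 :=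
    HasFDerivAt.comp_hasDerivAt (x := (0 : ℝ)) (f := fun s : ℝ => (q + s • v, t)) (l := Φ)
      (by simpa using hΦd.hasFDerivAt) hl
  have e2 : HasDerivAt (fun s : ℝ => Φ (q + s • v, t))
      (fderiv ℝ φ (polyCurve q t) (polyCurve v t)) 0 := by
    have h6 : HasDerivAt (fun s : ℝ => polyCurve q t + s • polyCurve v t) (polyCurve v t) 0 := by
      simpa using ((hasDerivAt_id (0 : ℝ)).smul_const (polyCurve v t)).const_add (polyCurve q t)
    have h7 := HasFDerivAt.comp_hasDerivAt (x := (0 : ℝ))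
      (f := fun s : ℝ => polyCurve q t + s • polyCurve v t) (l := φ)
      (l' := fderiv ℝ φ (polyCurve q t)) (by simpa using hφd) h6
    refine h7.congr_of_eventuallyEq (.of_forall fun s => ?_)
    simp [hΦdef, polyCurve_add, polyCurve_smul]
  exact e1.unique e2

/-- Leibniz rule: at 0 only the terms with exactly one derivative on the factor t survive. For `i =
0` the truncated index `i - 1` is harmless because its coefficient is zero. -/
theorem iteratedDeriv_id_smul_zero {f : ℝ → E} (hf : ContDiffAt ℝ ∞ f 0) (i : ℕ) :
    iteratedDeriv i (fun t => t • f t) 0 = (i : ℝ) • iteratedDeriv (i - 1) f 0 := by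
  induction i generalizing f with
  | zero => simp
  | succ i ih =>
    have hf' : ContDiffAt ℝ ∞ (deriv f) 0 :=
      (hf.fderiv_right (m := ∞) (by simp)).clm_apply contDiffAt_const
    have hev : deriv (fun t => t • f t) =ᶠ[𝓝 0] fun t => t • deriv f t + f t := by
      have h1 : ContDiffAt ℝ 1 f 0 := hf.of_le (by exact_mod_cast le_top)
      filter_upwards [h1.eventually (by simp)] with t ht
      have h2 := ((hasDerivAt_id t).smul (ht.differentiableAt (by simp)).hasDerivAt).deriv
      simpa using! h2
    have hle : (i : WithTop ℕ∞) ≤ ∞ := by exact_mod_cast le_top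
    rw [iteratedDeriv_succ', hev.iteratedDeriv_eq]
    have h3 := iteratedDeriv_add (n := i) (x := (0 : ℝ)) (f := fun t => t • deriv f t) (g := f)
      ((contDiffAt_id.smul hf').of_le hle) (hf.of_le hle)
    refine h3.trans ?_
    rw [ih hf']
    cases i with
    | zero => simp
    | succ j =>
      simp only [Nat.add_sub_cancel, ← iteratedDeriv_succ']
      push_cast
      module

theorem iteratedDeriv_pow_smul_zero {f : ℝ → E} (hf : ContDiffAt ℝ ∞ f 0) {i n : ℕ} (h : i < n) :
    iteratedDeriv i (fun t => t ^ n • f t) 0 = 0 := by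
  induction n generalizing f i with
  | zero => omega
  | succ n ih =>
    have h1 : (fun t : ℝ => t ^ (n + 1) • f t) = fun t => t • (t ^ n • f t) := by
      funext t
      rw [smul_smul, pow_succ']
    have h2 : ContDiffAt ℝ ∞ (fun t : ℝ => t ^ n • f t) 0 := (contDiffAt_id.pow n).smul hf
    rw [h1, iteratedDeriv_id_smul_zero h2]
    cases i with
    | zero => simp
    | succ j => rw [Nat.add_sub_cancel, ih hf (by omega), smul_zero]

/-- Multiplication of variations by the time parameter, in natural coordinates:
`(v₀, …, v_k) ↦ (0, v₀, 2 v₁, …, k v_{k-1})`. -/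
def timeMul (k : ℕ) : (Fin (k + 1) → E) →L[ℝ] (Fin (k + 1) → E) :=
  ContinuousLinearMap.pi fun i : Fin (k + 1) => ((i : ℕ) : ℝ) •
    ContinuousLinearMap.proj (R := ℝ) (φ := fun _ : Fin (k + 1) => E)
      ⟨(i : ℕ) - 1, lt_of_le_of_lt (Nat.sub_le _ _) i.2⟩

theorem timeMul_apply {k : ℕ} (v : Fin (k + 1) → E) (i : Fin (k + 1)) :
    timeMul k v i = ((i : ℕ) : ℝ) • v ⟨(i : ℕ) - 1, lt_of_le_of_lt (Nat.sub_le _ _) i.2⟩ := rfl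

/-- The i!-normalization of the coefficients produces the factors i in `timeMul`. The top
coefficient moves to degree k + 1, where a k-jet does not see it; this is the remainder. -/
theorem polyCurve_timeMul {k : ℕ} (v : Fin (k + 1) → E) (t : ℝ) :
    t • polyCurve v t =
      polyCurve (timeMul k v) t + t ^ (k + 1) • ((k.factorial : ℝ)⁻¹ • v (Fin.last k)) := by
  -- Peeling the last term on the left and the zeroth on the right (zero, since `timeMul` kills slot
  -- 0) aligns the two sums term by term.
  rw [polyCurve, Fin.sum_univ_castSucc, polyCurve, Fin.sum_univ_succ, smul_add, Finset.smul_sum]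
  congr 1
  · rw [timeMul_apply]
    simp only [Fin.val_zero, Nat.cast_zero, zero_smul, smul_zero, zero_add]
    refine Finset.sum_congr rfl fun j _ => ?_
    rw [timeMul_apply, smul_smul, smul_smul]
    have h1 : (⟨((j.succ : Fin (k + 1)) : ℕ) - 1, lt_of_le_of_lt (Nat.sub_le _ _) j.succ.2⟩ :
        Fin (k + 1)) = j.castSucc := by
      ext; simp
    rw [h1]
    congr 1
    have h2 : ((j : ℕ).factorial : ℝ) ≠ 0 := by exact_mod_cast Nat.factorial_ne_zero _
    have h3 : (((j : ℕ) : ℝ) + 1) ≠ 0 := by positivity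
    simp only [Fin.val_succ, Nat.factorial_succ, Fin.val_castSucc]
    push_cast
    field_simp
    ring
  · rw [smul_smul, smul_smul]
    simp only [Fin.val_last]
    congr 1
    field_simp
    ring

/-- Both sides are the derivatives at 0 of t · Dφ(q(t)) v(t): t passes through the linear map
Dφ(q(t)), and the remainder of order t^{k+1} has no derivative of order ≤ k at 0. Hence vertical
endomorphisms are independent of the natural chart. -/
theorem fderiv_iteratedDeriv_polyCurve_timeMul {φ : E → E} {S : Set E} (hS : IsOpen S)
    (hφ : ContDiffOn ℝ ∞ φ S) {k : ℕ} {q : Fin (k + 1) → E} (hq : q 0 ∈ S)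
    (v : Fin (k + 1) → E) :
    fderiv ℝ (fun (q : Fin (k + 1) → E) (i : Fin (k + 1)) =>
        iteratedDeriv (i : ℕ) (φ ∘ polyCurve q) 0) q (timeMul k v) =
      timeMul k (fderiv ℝ (fun (q : Fin (k + 1) → E) (i : Fin (k + 1)) =>
        iteratedDeriv (i : ℕ) (φ ∘ polyCurve q) 0) q v) := by
  have hO : IsOpen {q : Fin (k + 1) → E | q 0 ∈ S} := hS.preimage (continuous_apply 0)
  have hd : ∀ i : Fin (k + 1), DifferentiableAt ℝ
      (fun q : Fin (k + 1) → E => iteratedDeriv (i : ℕ) (φ ∘ polyCurve q) 0) q := fun i =>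
    ((contDiffOn_iteratedDeriv_polyCurve hS hφ (i : ℕ)).contDiffAt (hO.mem_nhds hq)).differentiableAt
      (by simp)
  have happ : ∀ (w : Fin (k + 1) → E) (i : Fin (k + 1)),
      fderiv ℝ (fun (q : Fin (k + 1) → E) (i : Fin (k + 1)) =>
        iteratedDeriv (i : ℕ) (φ ∘ polyCurve q) 0) q w i =
      iteratedDeriv (i : ℕ) (fun t => fderiv ℝ φ (polyCurve q t) (polyCurve w t)) 0 := by
    intro w i
    rw [fderiv_pi hd, ContinuousLinearMap.pi_apply, fderiv_iteratedDeriv_polyCurve hS hφ _ hq]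
  have hA : ContDiffAt ℝ ∞ (fun t => fderiv ℝ φ (polyCurve q t)) 0 := by
    have h1 : ContDiffAt ℝ ∞ (fderiv ℝ φ) (polyCurve q 0) := by
      rw [polyCurve_zero]
      exact (hφ.contDiffAt (hS.mem_nhds hq)).fderiv_right (m := ∞) (by simp)
    exact h1.comp (0 : ℝ) (contDiff_polyCurve' q).contDiffAt
  have hAw : ∀ w : Fin (k + 1) → E,
      ContDiffAt ℝ ∞ (fun t => fderiv ℝ φ (polyCurve q t) (polyCurve w t)) 0 := fun w =>
    hA.clm_apply (contDiff_polyCurve' w).contDiffAt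
  funext i
  have hle : ((i : ℕ) : WithTop ℕ∞) ≤ ∞ := by exact_mod_cast le_top
  rw [happ, timeMul_apply, happ, ← iteratedDeriv_id_smul_zero (hAw v)]
  have h0 := hA.clm_apply (contDiffAt_const (c := (k.factorial : ℝ)⁻¹ • v (Fin.last k)))
  have h1 : (fun t : ℝ => t • fderiv ℝ φ (polyCurve q t) (polyCurve v t)) =
      (fun t : ℝ => fderiv ℝ φ (polyCurve q t) (polyCurve (timeMul k v) t)) +
      fun t : ℝ => t ^ (k + 1) •
        fderiv ℝ φ (polyCurve q t) ((k.factorial : ℝ)⁻¹ • v (Fin.last k)) := by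
    funext t
    rw [← map_smul, polyCurve_timeMul, map_add, map_smul]
    rfl
  have h2 : ContDiffAt ℝ ∞ (fun t : ℝ => t ^ (k + 1) •
      fderiv ℝ φ (polyCurve q t) ((k.factorial : ℝ)⁻¹ • v (Fin.last k))) 0 :=
    (contDiffAt_id.pow (k + 1)).smul h0
  rw [h1, iteratedDeriv_add ((hAw _).of_le hle) (h2.of_le hle),
    iteratedDeriv_pow_smul_zero h0 i.2, add_zero]

end Variations

/-! ### Natural charts of the higher-order tangent bundles -/

section TruncationShift

variable {E : Type*} [NormedAddCommGroup E] [NormedSpace ℝ E]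

/-- The truncation `(q₀, …, q_k) ↦ (q₀, …, q_r)`. -/
def truncL {r k : ℕ} (h : r ≤ k) : (Fin (k + 1) → E) →L[ℝ] (Fin (r + 1) → E) :=
  ContinuousLinearMap.pi fun i : Fin (r + 1) =>
    ContinuousLinearMap.proj (R := ℝ) (φ := fun _ : Fin (k + 1) => E)
      (Fin.castLE (Nat.succ_le_succ h) i)

/-- The shift `(q₀, …, q_k) ↦ (q₁, …, q_{r+1})`. -/
def shiftL {r k : ℕ} (h : r + 1 ≤ k) : (Fin (k + 1) → E) →L[ℝ] (Fin (r + 1) → E) :=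
  ContinuousLinearMap.pi fun i : Fin (r + 1) =>
    ContinuousLinearMap.proj (R := ℝ) (φ := fun _ : Fin (k + 1) => E)
      ⟨(i : ℕ) + 1, Nat.succ_lt_succ (lt_of_lt_of_le i.2 h)⟩

theorem truncL_apply {r k : ℕ} (h : r ≤ k) (q : Fin (k + 1) → E) (i : Fin (r + 1)) :
    truncL h q i = q (Fin.castLE (Nat.succ_le_succ h) i) := rfl

theorem shiftL_apply {r k : ℕ} (h : r + 1 ≤ k) (q : Fin (k + 1) → E) (i : Fin (r + 1)) :
    shiftL h q i = q ⟨(i : ℕ) + 1, Nat.succ_lt_succ (lt_of_lt_of_le i.2 h)⟩ := rfl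

/-- The matrix of the `r`th vertical endomorphism in natural coordinates. -/
def vertL (k r : ℕ) : (Fin (k + 1) → E) →L[ℝ] (Fin (k + 1) → E) :=
  ContinuousLinearMap.pi fun i : Fin (k + 1) => (((i : ℕ).descFactorial r : ℕ) : ℝ) •
    ContinuousLinearMap.proj (R := ℝ) (φ := fun _ : Fin (k + 1) => E)
      ⟨(i : ℕ) - r, lt_of_le_of_lt (Nat.sub_le _ _) i.2⟩

theorem vertL_apply {k : ℕ} (r : ℕ) (v : Fin (k + 1) → E) (i : Fin (k + 1)) :
    vertL k r v i = (((i : ℕ).descFactorial r : ℕ) : ℝ) •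
      v ⟨(i : ℕ) - r, lt_of_le_of_lt (Nat.sub_le _ _) i.2⟩ := rfl

theorem vertL_zero (k : ℕ) : vertL k 0 = ContinuousLinearMap.id ℝ (Fin (k + 1) → E) := by
  ext v i
  simp [vertL_apply]

/-- The coefficients are falling factorials, and i times the rth falling factorial of i − 1 is the
(r+1)st of i. Thus J_r is the rth power of `timeMul`, and facts about all the J_r reduce to
multiplication by t. -/
theorem vertL_succ (k r : ℕ) :
    vertL k (r + 1) = (timeMul k).comp (vertL k r : (Fin (k + 1) → E) →L[ℝ] _) := by
  ext v i
  rw [ContinuousLinearMap.comp_apply, timeMul_apply, vertL_apply, vertL_apply, smul_smul]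
  obtain ⟨i, hi⟩ := i
  cases i with
  | zero => simp
  | succ i =>
    simp only [Nat.succ_descFactorial_succ, Nat.add_sub_cancel, Nat.add_sub_add_right]
    push_cast
    rfl

theorem vertL_comm_of_timeMul_comm {k : ℕ} {D : (Fin (k + 1) → E) →L[ℝ] (Fin (k + 1) → E)}
    (h : ∀ v, D (timeMul k v) = timeMul k (D v)) (r : ℕ) (v : Fin (k + 1) → E) :
    D (vertL k r v) = vertL k r (D v) := by
  induction r with
  | zero => simp [vertL_zero]
  | succ r ih => simp only [vertL_succ, ContinuousLinearMap.comp_apply, h, ih]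

end TruncationShift

/-! ### Vertical endomorphisms, projections and canonical injections in natural charts. -/

section NaturalCharts

variable {E : Type*} [NormedAddCommGroup E] [NormedSpace ℝ E]
  {Q : Type*} [TopologicalSpace Q] [ChartedSpace E Q] [IsManifold 𝓘(ℝ, E) ∞ Q]

/-- The falling factorial of i of length r vanishes for i < r, which absorbs the case distinction.
-/
theorem vertEndo_eq_vertL {k : ℕ} (r : ℕ) (p : HOTangent E Q k) (v : Fin (k + 1) → E) :
    (show (Fin (k + 1) → E) →L[ℝ] (Fin (k + 1) → E) from vertEndo r p) v = vertL k r v := by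
  funext i
  rw [vertL_apply]
  show (if h : r ≤ (i : ℕ) then
      (((i : ℕ).factorial : ℝ) / (((i : ℕ) - r).factorial : ℝ)) •
        ContinuousLinearMap.proj (R := ℝ) (φ := fun _ : Fin (k + 1) => E)
          ⟨(i : ℕ) - r, lt_of_le_of_lt (Nat.sub_le _ _) i.2⟩
    else 0 : (Fin (k + 1) → E) →L[ℝ] E) v = _
  split_ifs with h
  · have h1 := Nat.factorial_mul_descFactorial h
    have h2 : ((((i : ℕ) - r).factorial : ℕ) : ℝ) ≠ 0 := by
      exact_mod_cast Nat.factorial_ne_zero _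
    have h3 : ((i : ℕ).factorial : ℝ) / (((i : ℕ) - r).factorial : ℝ) =
        ((i : ℕ).descFactorial r : ℝ) := by
      rw [← h1]
      push_cast
      field_simp
    rw [h3]
    rfl
  · rw [Nat.descFactorial_eq_zero_iff_lt.2 (not_le.1 h)]
    simp

/-- The natural chart of `TᵏQ` induced by a chart of `Q`. -/
def natChart (k : ℕ) {e : OpenPartialHomeomorph Q E} (he : e ∈ atlas E Q) :
    OpenPartialHomeomorph (HOTangent E Q k) (Fin (k + 1) → E) :=
  (jetCore E Q k).openPartialHomeomorph (jetChart k he) ⟨e, he, rfl⟩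

variable {e e' : OpenPartialHomeomorph Q E} {k r : ℕ}

theorem natChart_mem_atlas (k : ℕ) (he : e ∈ atlas E Q) :
    natChart k he ∈ atlas (Fin (k + 1) → E) (HOTangent E Q k) :=
  mem_iUnion₂.2 ⟨jetChart k he, ⟨e, he, rfl⟩, mem_singleton _⟩

theorem chartAt_eq_natChart (p : HOTangent E Q k) :
    chartAt (Fin (k + 1) → E) p = natChart k (chart_mem_atlas E (baseProj p)) := rfl

theorem mem_natChart_source (he : e ∈ atlas E Q) {p : HOTangent E Q k} :
    p ∈ (natChart k he).source ↔ baseProj p ∈ e.source := Iff.rfl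

omit [IsManifold 𝓘(ℝ, E) ∞ Q] in
theorem baseProj_jetProj (h : r ≤ k) (p : HOTangent E Q k) :
    baseProj (jetProj h p) = baseProj p := by
  induction p using Quotient.inductionOn with
  | h σ => rfl

theorem chartAt_jetProj (h : r ≤ k) (p : HOTangent E Q k) :
    chartAt (Fin (r + 1) → E) (jetProj h p) = natChart r (chart_mem_atlas E (baseProj p)) := by
  rw [chartAt_eq_natChart]
  have : ∀ x y : Q, x = y → natChart r (chart_mem_atlas E x) = natChart r (chart_mem_atlas E y) := by
    rintro x _ rfl
    rfl
  exact this _ _ (baseProj_jetProj h p)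

theorem natChart_jetProj (he : e ∈ atlas E Q) (h : r ≤ k) (p : HOTangent E Q k) :
    natChart r he (jetProj h p) = truncL h (natChart k he p) := by
  funext i
  exact jetCoord_jetProj h he p i

theorem jetProj_mem_source (he : e ∈ atlas E Q) (h : r ≤ k) {p : HOTangent E Q k}
    (hp : p ∈ (natChart k he).source) : jetProj h p ∈ (natChart r he).source := by
  rw [mem_natChart_source, baseProj_jetProj]
  exact hp

theorem truncL_mem_target (he : e ∈ atlas E Q) (h : r ≤ k) {y : Fin (k + 1) → E}
    (hy : y ∈ (natChart k he).target) : truncL h y ∈ (natChart r he).target := hy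

theorem natChart_transition (he : e ∈ atlas E Q) (he' : e' ∈ atlas E Q) {q : Fin (k + 1) → E}
    (hq : q ∈ ((natChart k he).symm.trans (natChart k he')).source) :
    natChart k he' ((natChart k he).symm q) = fun i : Fin (k + 1) =>
      iteratedDeriv (i : ℕ) ((e' ∘ e.symm) ∘ polyCurve q) 0 := by
  have hq1 : q 0 ∈ e.target := hq.1
  have hq2 : (coordCurve he q).1 0 ∈ e'.source := hq.2
  funext i
  show jetCoord k he' (jet k (coordCurve he q)) i = _
  rw [jetCoord_jet he' hq2, coordCurve_of_mem he hq1]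
  rfl

theorem natChart_transition_source (he : e ∈ atlas E Q) (he' : e' ∈ atlas E Q)
    {q : Fin (k + 1) → E} (hq : q ∈ ((natChart k he).symm.trans (natChart k he')).source) :
    q 0 ∈ (e.symm.trans e').source := by
  have := jetChart_trans_source (k := k) he he'
  exact (Set.ext_iff.1 this q).1 hq

/-- Coordinate changes commute with the vertical endomorphisms. -/
theorem fderiv_natChart_transition_vertL (he : e ∈ atlas E Q) (he' : e' ∈ atlas E Q)
    {q : Fin (k + 1) → E} (hq : q ∈ ((natChart k he).symm.trans (natChart k he')).source)
    (r : ℕ) (v : Fin (k + 1) → E) :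
    fderiv ℝ (natChart k he' ∘ (natChart k he).symm) q (vertL k r v) =
      vertL k r (fderiv ℝ (natChart k he' ∘ (natChart k he).symm) q v) := by
  refine vertL_comm_of_timeMul_comm (fun v => ?_) r v
  have hev : natChart k he' ∘ (natChart k he).symm =ᶠ[𝓝 q]
      fun (q : Fin (k + 1) → E) (i : Fin (k + 1)) =>
        iteratedDeriv (i : ℕ) ((e' ∘ e.symm) ∘ polyCurve q) 0 := by
    filter_upwards [((natChart k he).symm.trans (natChart k he')).open_source.mem_nhds hq]
      with z hz using natChart_transition he he' hz
  rw [hev.fderiv_eq]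
  exact fderiv_iteratedDeriv_polyCurve_timeMul (e.symm.trans e').open_source
    (contDiffOn_transition he he') (natChart_transition_source he he' hq) v

/-- The tangent space at a point is identified with the model by the preferred chart there, itself a
natural chart. So this derivative is that of a change of natural coordinates, which commutes with
the vertical endomorphisms. It follows that `vertEndo`, defined in preferred charts, has the same
matrix in every natural chart. -/
theorem chartSymmDeriv_vertL (he : e ∈ atlas E Q) {y : Fin (k + 1) → E}
    (hy : y ∈ (natChart k he).target) (r : ℕ) (v : Fin (k + 1) → E) :
    chartSymmDeriv (natChart k he) y (vertL k r v) =
      vertL k r (chartSymmDeriv (natChart k he) y v) := by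
  set p := (natChart k he).symm y with hp
  set d := chartAt (Fin (k + 1) → E) p with hd
  have hda : d ∈ atlas _ (HOTangent E Q k) := chart_mem_atlas _ p
  have hpd : p ∈ d.source := mem_chart_source _ p
  have hys : y ∈ ((natChart k he).symm.trans d).source := by
    rw [OpenPartialHomeomorph.trans_source]
    exact ⟨hy, hpd⟩
  have h2 : chartDeriv d p = ContinuousLinearMap.id ℝ (Fin (k + 1) → E) := by
    have := mfderiv_extChartAt_self (I := 𝓘(ℝ, Fin (k + 1) → E)) (x := p)
    simpa only [mfld_simps] using! this
  have h3 : ∀ w, chartSymmDeriv (natChart k he) y w = fderiv ℝ (d ∘ (natChart k he).symm) y w := by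
    intro w
    rw [← chartDeriv_trans (natChart_mem_atlas k he) hda hys, ← hp, h2]
    rfl
  rw [h3, h3]
  exact fderiv_natChart_transition_vertL he (chart_mem_atlas E (baseProj p)) hys r v

theorem formRep_vertDiff (he : e ∈ atlas E Q) {f : HOTangent E Q k → ℝ}
    (hf : MDifferentiable 𝓘(ℝ, Fin (k + 1) → E) 𝓘(ℝ, ℝ) f) (r : ℕ) {y : Fin (k + 1) → E}
    (hy : y ∈ (natChart k he).target) :
    formRep (natChart k he) (vertDiff r f) y =
      (fderiv ℝ (f ∘ (natChart k he).symm) y).comp (vertL k r) := by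
  rw [← formRep_diffFun (natChart_mem_atlas k he) hy (hf _)]
  ext v
  rw [ContinuousLinearMap.comp_apply, formRep, formRep, ContinuousLinearMap.comp_apply,
    ContinuousLinearMap.comp_apply, chartSymmDeriv_vertL he hy, ← vertEndo_eq_vertL r
      ((natChart k he).symm y)]
  rfl

theorem mdifferentiable_jetProj (h : r ≤ k) :
    MDifferentiable 𝓘(ℝ, Fin (k + 1) → E) 𝓘(ℝ, Fin (r + 1) → E)
      (jetProj h : HOTangent E Q k → HOTangent E Q r) :=
  (contMDiff_jetProj h).mdifferentiable (by simp)

/-- The derivative of `jetProj`, as a map of the model spaces. -/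
def jetProjDeriv (h : r ≤ k) (p : HOTangent E Q k) : (Fin (k + 1) → E) →L[ℝ] (Fin (r + 1) → E) :=
  mfderiv 𝓘(ℝ, Fin (k + 1) → E) 𝓘(ℝ, Fin (r + 1) → E) (jetProj h) p

theorem chartDeriv_jetProjDeriv (he : e ∈ atlas E Q) (h : r ≤ k) {p : HOTangent E Q k}
    (hp : p ∈ (natChart k he).source) (v : Fin (k + 1) → E) :
    chartDeriv (natChart r he) (jetProj h p) (jetProjDeriv h p v) =
      truncL h (chartDeriv (natChart k he) p v) := by
  have h1 := mfderiv_comp p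
    (mdifferentiableAt_chart (natChart_mem_atlas r he) (jetProj_mem_source he h hp))
    (mdifferentiable_jetProj h p)
  have h2 := mfderiv_comp p (I' := 𝓘(ℝ, Fin (k + 1) → E)) (I'' := 𝓘(ℝ, Fin (r + 1) → E))
    (g := truncL h) (f := natChart k he)
    (truncL h : (Fin (k + 1) → E) →L[ℝ] (Fin (r + 1) → E)).differentiableAt.mdifferentiableAt
    (mdifferentiableAt_chart (natChart_mem_atlas k he) hp)
  have h3 : natChart r he ∘ (jetProj h : HOTangent E Q k → HOTangent E Q r) = truncL h ∘ natChart k he := by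
    funext p
    exact natChart_jetProj he h p
  rw [h3, h2, mfderiv_eq_fderiv, ContinuousLinearMap.fderiv] at h1
  exact (DFunLike.congr_fun h1 v).symm

theorem formRep_pullOne (he : e ∈ atlas E Q) (h : r ≤ k)
    (α : OneForm 𝓘(ℝ, Fin (r + 1) → E) (HOTangent E Q r)) {y : Fin (k + 1) → E}
    (hy : y ∈ (natChart k he).target) :
    formRep (natChart k he) (pullOne h α) y =
      (formRep (natChart r he) α (truncL h y)).comp (truncL h) := by
  ext v
  have hp := (natChart k he).map_target hy
  have h1 := formRep_apply_chartDeriv (natChart_mem_atlas r he) (jetProj_mem_source he h hp) α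
    (jetProjDeriv h ((natChart k he).symm y) (chartSymmDeriv (natChart k he) y v))
  rw [chartDeriv_jetProjDeriv he h hp, chartDeriv_chartSymmDeriv (natChart_mem_atlas k he) hy,
    natChart_jetProj, (natChart k he).right_inv hy] at h1
  exact h1.symm

omit [IsManifold 𝓘(ℝ, E) ∞ Q] in
theorem canonicalLift_zero (r : ℕ) (σ : Curve E Q) :
    canonicalLift (E := E) r σ.1 0 = jet r σ := by
  have h : (shiftCurve (E := E) σ.1 0).1 = σ.1 := by
    rw [shiftCurve, dif_pos σ.smooth]
    funext s
    exact congrArg σ.1 (add_zero s)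
  refine Quotient.sound (s := jetSetoid E Q r) ⟨by rw [h], fun i _ => by rw [h]⟩

theorem hasDerivAt_iteratedDeriv_chart (σ : Curve E Q) (he : e ∈ atlas E Q)
    (hs : σ.1 0 ∈ e.source) (r : ℕ) :
    HasDerivAt (fun (t : ℝ) (i : Fin (r + 1)) => iteratedDeriv (i : ℕ) (e ∘ σ.1) t)
      (fun i : Fin (r + 1) => iteratedDeriv ((i : ℕ) + 1) (e ∘ σ.1) 0) 0 := by
  refine hasDerivAt_pi.2 fun i => ?_
  have h2 : ContDiffAt ℝ ((i : ℕ) + 1 : ℕ) (e ∘ σ.1) 0 :=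
    (σ.contDiffAt_chart he hs).of_le (by exact_mod_cast le_top)
  have h3 := (h2.contDiffWithinAt (s := univ)).differentiableWithinAt_iteratedDerivWithin
    (m := (i : ℕ)) (by exact_mod_cast Nat.lt_succ_self _) (by simp)
  rw [iteratedDerivWithin_univ] at h3
  rw [iteratedDeriv_succ]
  exact (h3.differentiableAt univ_mem).hasDerivAt

/-- In natural coordinates the canonical injection is `(q₁, …, q_{r+1})`. -/
theorem chartDeriv_canonicalInj (he : e ∈ atlas E Q) (h : r + 1 ≤ k) {p : HOTangent E Q k}
    (hp : p ∈ (natChart k he).source) :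
    chartDeriv (natChart r he) (jetProj (Nat.le_of_succ_le h) p) (canonicalInj h p) =
      shiftL h (natChart k he p) := by
  induction p using Quotient.inductionOn with
  | h σ =>
    have hs : σ.1 0 ∈ e.source := hp
    set c := natChart r he with hc
    set γ : ℝ → HOTangent E Q r := canonicalLift (E := E) r σ.1 with hγ
    set g : ℝ → (Fin (r + 1) → E) := fun t i => iteratedDeriv (i : ℕ) (e ∘ σ.1) t with hg
    have hev := canonicalLift_eventually (k := r) σ he hs
    have hcg : c ∘ γ =ᶠ[𝓝 0] g := by
      filter_upwards [hev] with t ht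
      funext i
      exact ht.2 i
    have hgd := hasDerivAt_iteratedDeriv_chart σ he hs r
    have hγ0 : γ 0 ∈ c.source := hev.self_of_nhds.1
    have hg0 : g 0 ∈ c.target := by
      rw [← hcg.self_of_nhds]
      exact c.map_source hγ0
    have hγg : γ =ᶠ[𝓝 0] c.symm ∘ g := by
      filter_upwards [hev, hcg] with t ht ht'
      rw [Function.comp_apply, ← ht']
      exact (c.left_inv ht.1).symm
    have hγd : MDifferentiableAt 𝓘(ℝ, ℝ) 𝓘(ℝ, Fin (r + 1) → E) γ 0 := by
      refine MDifferentiableAt.congr_of_eventuallyEq ?_ hγg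
      exact (mdifferentiableAt_chart_symm (natChart_mem_atlas r he) hg0).comp (0 : ℝ)
        hgd.differentiableAt.mdifferentiableAt
    have h1 := mfderiv_comp (0 : ℝ) (mdifferentiableAt_chart (natChart_mem_atlas r he) hγ0) hγd
    rw [hcg.mfderiv_eq, mfderiv_eq_fderiv] at h1
    have h2 : fderiv ℝ g 0 (1 : ℝ) = chartDeriv c (γ 0)
        ((mfderiv 𝓘(ℝ, ℝ) 𝓘(ℝ, Fin (r + 1) → E) γ 0 : ℝ →L[ℝ] (Fin (r + 1) → E)) 1) :=
      DFunLike.congr_fun h1 (1 : ℝ)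
    rw [fderiv_apply_one_eq_deriv, hgd.deriv, hγ, canonicalLift_zero] at h2
    refine Eq.trans (b := chartDeriv c (jet r σ) (liftVelocity r σ)) rfl (h2.symm.trans ?_)
    funext i
    rw [shiftL_apply]
    exact (jetCoord_jet he hs (⟨(i : ℕ) + 1, _⟩ : Fin (k + 1))).symm

end NaturalCharts

/-! ### Tulczyjew's derivation and the Lagrangian one-form in natural coordinates -/

section Tulczyjew

variable {E : Type*} [NormedAddCommGroup E] [NormedSpace ℝ E]
  {Q : Type*} [TopologicalSpace Q] [ChartedSpace E Q] [IsManifold 𝓘(ℝ, E) ∞ Q]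
  {e : OpenPartialHomeomorph Q E} {k : ℕ}

/-- The action of Tulczyjew's derivation on coordinate expressions of one-forms. -/
def tulczyjewRep (a : (Fin (k + 1) → E) → (Fin (k + 1) → E) →L[ℝ] ℝ) (y : Fin (k + 1 + 1) → E) :
    (Fin (k + 1 + 1) → E) →L[ℝ] ℝ :=
  (fderiv ℝ a (truncL (Nat.le_succ k) y) (shiftL le_rfl y)).comp (truncL (Nat.le_succ k)) +
    (a (truncL (Nat.le_succ k) y)).comp (shiftL le_rfl)

/-- Cartan's formula in coordinates: i_T dα contributes an antisymmetrized derivative of the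
coefficients, d i_T α contributes the derivative of a(sh y), and the derivative along the truncation
of v occurs in both with opposite signs. What remains is `tulczyjewRep`. -/
theorem formRep_tulczyjew (he : e ∈ atlas E Q)
    {α : OneForm 𝓘(ℝ, Fin (k + 1) → E) (HOTangent E Q k)}
    (hα : DifferentiableOn ℝ (formRep (natChart k he) α) (natChart k he).target)
    {y : Fin (k + 1 + 1) → E} (hy : y ∈ (natChart (k + 1) he).target) :
    formRep (natChart (k + 1) he) (tulczyjew α) y =
      tulczyjewRep (formRep (natChart k he) α) y := by
  set c := natChart k he with hc
  set c' := natChart (k + 1) he with hc'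
  have hca := natChart_mem_atlas k he
  have hca' := natChart_mem_atlas (k + 1) he
  set a := formRep c α with ha
  set tr : (Fin (k + 1 + 1) → E) →L[ℝ] (Fin (k + 1) → E) := truncL (Nat.le_succ k) with htr
  set sh : (Fin (k + 1 + 1) → E) →L[ℝ] (Fin (k + 1) → E) := shiftL le_rfl with hsh
  set f : HOTangent E Q (k + 1) → ℝ := fun p' =>
      α (jetProj (Nat.le_succ k) p') (canonicalInj le_rfl p') with hf
  have hfval : ∀ p' ∈ c'.source, f p' = a (tr (c' p')) (sh (c' p')) := by
    intro p' hp'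
    have h1 := formRep_apply_chartDeriv hca (jetProj_mem_source he (Nat.le_succ k) hp') α
      (canonicalInj le_rfl p')
    rw [chartDeriv_canonicalInj he le_rfl hp', natChart_jetProj] at h1
    exact h1.symm
  have hd : ∀ z ∈ c'.target, HasFDerivAt (fun z => a (tr z) (sh z))
      ((fderiv ℝ a (tr z)).flip (sh z) ∘L tr + (a (tr z)).comp sh) z := by
    intro z hz
    have h1 : HasFDerivAt (fun z => a (tr z)) ((fderiv ℝ a (tr z)).comp tr) z :=
      ((hα.differentiableAt (c.open_target.mem_nhds
        (truncL_mem_target he (Nat.le_succ k) hz))).hasFDerivAt).comp z tr.hasFDerivAt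
    have h2 := h1.clm_apply (sh.hasFDerivAt (x := z))
    convert! h2 using 1
    ext v
    simp [add_comm]
  set p := c'.symm y with hp
  have hps : p ∈ c'.source := c'.map_target hy
  have hcp : c' p = y := c'.right_inv hy
  have hfd : MDifferentiableAt 𝓘(ℝ, Fin (k + 1 + 1) → E) 𝓘(ℝ, ℝ) f p := by
    have h1 : MDifferentiableAt 𝓘(ℝ, Fin (k + 1 + 1) → E) 𝓘(ℝ, ℝ)
        ((fun z => a (tr z) (sh z)) ∘ c') p := by
      refine MDifferentiableAt.comp p (I' := 𝓘(ℝ, Fin (k + 1 + 1) → E)) ?_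
        (mdifferentiableAt_chart hca' hps)
      rw [hcp]
      exact (hd y hy).differentiableAt.mdifferentiableAt
    refine h1.congr_of_eventuallyEq ?_
    filter_upwards [c'.open_source.mem_nhds hps] with p' hp' using hfval p' hp'
  have hfc : f ∘ c'.symm =ᶠ[𝓝 y] fun z => a (tr z) (sh z) := by
    filter_upwards [c'.open_target.mem_nhds hy] with z hz
    rw [Function.comp_apply, hfval _ (c'.map_target hz), c'.right_inv hz]
  have hps' := jetProj_mem_source he (Nat.le_succ k) hps
  have hcp' : c (jetProj (Nat.le_succ k) p) = tr y := by rw [natChart_jetProj, hcp]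
  have had : DifferentiableAt ℝ a (c (jetProj (Nat.le_succ k) p)) :=
    hα.differentiableAt (c.open_target.mem_nhds (c.map_source hps'))
  ext v
  set w := chartSymmDeriv c' y v with hw
  have hA := extDerivOne_eq_of_chart hca hps' had (canonicalInj le_rfl p)
    (jetProjDeriv (Nat.le_succ k) p w)
  rw [chartDeriv_canonicalInj he le_rfl hps, chartDeriv_jetProjDeriv he _ hps, hw,
    chartDeriv_chartSymmDeriv hca' hy, hcp', hcp] at hA
  have hB : (show (Fin (k + 1 + 1) → E) →L[ℝ] ℝ from
      diffFun 𝓘(ℝ, Fin (k + 1 + 1) → E) f p) w = fderiv ℝ a (tr y) (tr v) (sh y) +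
        a (tr y) (sh v) := by
    have h1 := DFunLike.congr_fun (formRep_diffFun hca' hy hfd) v
    rw [hfc.fderiv_eq, (hd y hy).fderiv] at h1
    exact h1
  have hsum : formRep c' (tulczyjew α) y v =
      extDerivOne α (jetProj (Nat.le_succ k) p) (canonicalInj le_rfl p)
        (jetProjDeriv (Nat.le_succ k) p w) +
      (show (Fin (k + 1 + 1) → E) →L[ℝ] ℝ from diffFun 𝓘(ℝ, Fin (k + 1 + 1) → E) f p) w := rfl
  rw [hsum, hB, hA]
  simp only [tulczyjewRep, add_apply, ContinuousLinearMap.comp_apply]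
  ring

theorem contDiffOn_tulczyjewRep {T : Set (Fin (k + 1) → E)} (hT : IsOpen T)
    {a : (Fin (k + 1) → E) → (Fin (k + 1) → E) →L[ℝ] ℝ} (ha : ContDiffOn ℝ ∞ a T) :
    ContDiffOn ℝ ∞ (tulczyjewRep a) {y | truncL (Nat.le_succ k) y ∈ T} := by
  have htr : ContDiffOn ℝ ∞ (truncL (Nat.le_succ k) : (Fin (k + 1 + 1) → E) →L[ℝ] _)
      {y : Fin (k + 1 + 1) → E | truncL (Nat.le_succ k) y ∈ T} :=
    (truncL (Nat.le_succ k) : (Fin (k + 1 + 1) → E) →L[ℝ] _).contDiff.contDiffOn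
  have h1 := (ha.fderiv_of_isOpen hT (m := ∞) (by simp)).comp htr fun y hy => hy
  have h2 := ha.comp htr fun y hy => hy
  exact ((h1.clm_apply (shiftL le_rfl : (Fin (k + 1 + 1) → E) →L[ℝ] _).contDiff.contDiffOn).clm_comp
    contDiffOn_const).add (h2.clm_comp contDiffOn_const)

/-- The iterates of `tulczyjewRep`. -/
def tulczyjewRepIter (a : (Fin (k + 1) → E) → (Fin (k + 1) → E) →L[ℝ] ℝ) :
    (s : ℕ) → (Fin (k + s + 1) → E) → (Fin (k + s + 1) → E) →L[ℝ] ℝ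
  | 0 => a
  | s + 1 => tulczyjewRep (tulczyjewRepIter a s)

theorem contDiffOn_tulczyjewRepIter {T : Set E} (hT : IsOpen T)
    {a : (Fin (k + 1) → E) → (Fin (k + 1) → E) →L[ℝ] ℝ} (ha : ContDiffOn ℝ ∞ a {y | y 0 ∈ T})
    (s : ℕ) : ContDiffOn ℝ ∞ (tulczyjewRepIter a s) {y | y 0 ∈ T} := by
  induction s with
  | zero => exact ha
  | succ s ih => exact contDiffOn_tulczyjewRep (hT.preimage (continuous_apply 0)) ih

theorem tulczyjewRep_congr {T : Set (Fin (k + 1) → E)} (hT : IsOpen T)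
    {a b : (Fin (k + 1) → E) → (Fin (k + 1) → E) →L[ℝ] ℝ} (h : EqOn a b T)
    {y : Fin (k + 1 + 1) → E} (hy : truncL (Nat.le_succ k) y ∈ T) :
    tulczyjewRep a y = tulczyjewRep b y := by
  have h1 : a =ᶠ[𝓝 (truncL (Nat.le_succ k) y)] b := h.eventuallyEq_of_mem (hT.mem_nhds hy)
  rw [tulczyjewRep, tulczyjewRep, h1.fderiv_eq, h1.eq_of_nhds]

/-- Each application of d_T needs differentiability of the preceding coefficients. A one-form
carries no smoothness, so it is taken from the explicit smooth expression `a` with which the form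
agrees on the chart. -/
theorem formRep_tulczyjewIter (he : e ∈ atlas E Q)
    {α : OneForm 𝓘(ℝ, Fin (k + 1) → E) (HOTangent E Q k)}
    {a : (Fin (k + 1) → E) → (Fin (k + 1) → E) →L[ℝ] ℝ}
    (ha : ContDiffOn ℝ ∞ a {y | y 0 ∈ e.target})
    (hα : EqOn (formRep (natChart k he) α) a (natChart k he).target) (s : ℕ) :
    EqOn (formRep (natChart (k + s) he) (tulczyjewIter α s)) (tulczyjewRepIter a s)
      (natChart (k + s) he).target := by
  induction s with
  | zero => exact hα
  | succ s ih =>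
    intro y hy
    have h1 : DifferentiableOn ℝ (formRep (natChart (k + s) he) (tulczyjewIter α s))
        (natChart (k + s) he).target :=
      ((contDiffOn_tulczyjewRepIter e.open_target ha s).congr ih).differentiableOn (by simp)
    refine (formRep_tulczyjew he h1 hy).trans ?_
    exact tulczyjewRep_congr (natChart (k + s) he).open_target ih
      (truncL_mem_target he (Nat.le_succ (k + s)) hy)

/-- The coordinate expression of the Lagrangian one-form. -/
def lagrangianRep {m : ℕ} (f : (Fin (m + 1 + 1) → E) → ℝ) (y : Fin (2 * m + 1 + 1) → E) :
    (Fin (2 * m + 1 + 1) → E) →L[ℝ] ℝ :=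
  ∑ s : Fin (m + 1), ((-1 : ℝ) ^ (s : ℕ) / (((s : ℕ) + 1).factorial : ℝ)) •
    (tulczyjewRepIter (fun z => (fderiv ℝ f z).comp (vertL (m + 1) ((s : ℕ) + 1))) s
      (truncL (r := m + 1 + s) (by have := s.2; omega) y)).comp
        (truncL (r := m + 1 + s) (by have := s.2; omega))

theorem contDiffOn_fderiv_comp_vertL {T : Set E} (hT : IsOpen T) {f : (Fin (k + 1) → E) → ℝ}
    (hf : ContDiffOn ℝ ∞ f {y | y 0 ∈ T}) (r : ℕ) :
    ContDiffOn ℝ ∞ (fun z => (fderiv ℝ f z).comp (vertL k r)) {y | y 0 ∈ T} :=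
  (hf.fderiv_of_isOpen (hT.preimage (continuous_apply 0)) (m := ∞) (by simp)).clm_comp
    contDiffOn_const

theorem contDiffOn_lagrangianRep {T : Set E} (hT : IsOpen T) {m : ℕ}
    {f : (Fin (m + 1 + 1) → E) → ℝ} (hf : ContDiffOn ℝ ∞ f {y | y 0 ∈ T}) :
    ContDiffOn ℝ ∞ (lagrangianRep f) {y | y 0 ∈ T} := by
  refine ContDiffOn.sum fun s _ => ?_
  have h1 := (contDiffOn_tulczyjewRepIter hT
    (contDiffOn_fderiv_comp_vertL hT hf ((s : ℕ) + 1)) (s : ℕ)).comp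
    (s := {y : Fin (2 * m + 1 + 1) → E | y 0 ∈ T})
    (truncL (r := m + 1 + s) (k := 2 * m + 1) (by have := s.2; omega)).contDiff.contDiffOn
    fun y hy => hy
  exact ContDiffOn.const_smul _ (h1.clm_comp contDiffOn_const)

theorem contDiffOn_comp_natChart_symm (he : e ∈ atlas E Q) {L : HOTangent E Q k → ℝ}
    (hL : ContMDiff 𝓘(ℝ, Fin (k + 1) → E) 𝓘(ℝ, ℝ) ∞ L) :
    ContDiffOn ℝ ∞ (L ∘ (natChart k he).symm) (natChart k he).target :=
  (hL.comp_contMDiffOn (contMDiffOn_symm_of_mem_maximalAtlas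
    (IsManifold.subset_maximalAtlas (natChart_mem_atlas k he)))).contDiffOn

theorem formRep_lagrangianOne (he : e ∈ atlas E Q) {m : ℕ} {L : HOTangent E Q (m + 1) → ℝ}
    (hL : ContMDiff 𝓘(ℝ, Fin (m + 1 + 1) → E) 𝓘(ℝ, ℝ) ∞ L) :
    EqOn (formRep (natChart (2 * m + 1) he) (lagrangianOne L))
      (lagrangianRep (L ∘ (natChart (m + 1) he).symm)) (natChart (2 * m + 1) he).target := by
  intro y hy
  have h1 : formRep (natChart (2 * m + 1) he) (lagrangianOne L) y =
      ∑ s : Fin (m + 1), ((-1 : ℝ) ^ (s : ℕ) / (((s : ℕ) + 1).factorial : ℝ)) •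
        formRep (natChart (2 * m + 1) he) (pullOne (r := m + 1 + s) (k := 2 * m + 1)
          (by have := s.2; omega) (tulczyjewIter (vertDiff ((s : ℕ) + 1) L) s)) y := by
    refine (ContinuousLinearMap.finsetSum_comp (g := fun s : Fin (m + 1) =>
      ((-1 : ℝ) ^ (s : ℕ) / (((s : ℕ) + 1).factorial : ℝ)) •
        (show (Fin (2 * m + 1 + 1) → E) →L[ℝ] ℝ from
          pullOne (r := m + 1 + s) (k := 2 * m + 1) (by have := s.2; omega)
            (tulczyjewIter (vertDiff ((s : ℕ) + 1) L) s) ((natChart (2 * m + 1) he).symm y)))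
        (f := chartSymmDeriv (natChart (2 * m + 1) he) y)).trans ?_
    exact Finset.sum_congr rfl fun s _ => ContinuousLinearMap.smul_comp _ _ _
  rw [h1, lagrangianRep]
  refine Finset.sum_congr rfl fun s _ => ?_
  rw [formRep_pullOne he _ _ hy]
  congr 2
  exact formRep_tulczyjewIter he
    (contDiffOn_fderiv_comp_vertL e.open_target (contDiffOn_comp_natChart_symm he hL) _)
    (fun z hz => formRep_vertDiff he (hL.mdifferentiable (by simp)) _ hz) s
    (truncL_mem_target he _ hy)

end Tulczyjew

/-! ### The Euler-Lagrange identity in natural coordinates -/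

section EulerLagrange

variable {E : Type*} [NormedAddCommGroup E] [NormedSpace ℝ E] {N : ℕ}

/-- The shift `(q₀, …, q_N) ↦ (q₁, …, q_N, 0)`. -/
def shiftZero (N : ℕ) : (Fin (N + 1) → E) →L[ℝ] (Fin (N + 1) → E) :=
  ContinuousLinearMap.pi fun i : Fin (N + 1) =>
    if h : (i : ℕ) + 1 < N + 1 then
      ContinuousLinearMap.proj (R := ℝ) (φ := fun _ : Fin (N + 1) => E) ⟨(i : ℕ) + 1, h⟩
    else 0

theorem shiftZero_apply_of_lt (q : Fin (N + 1) → E) {i : Fin (N + 1)} (h : (i : ℕ) + 1 < N + 1) :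
    shiftZero N q i = q ⟨(i : ℕ) + 1, h⟩ := by
  have h1 : shiftZero N q i = (if h : (i : ℕ) + 1 < N + 1 then
      ContinuousLinearMap.proj (R := ℝ) (φ := fun _ : Fin (N + 1) => E) ⟨(i : ℕ) + 1, h⟩
    else 0 : (Fin (N + 1) → E) →L[ℝ] E) q := rfl
  rw [h1, dif_pos h]
  rfl

theorem shiftZero_apply_of_not_lt (q : Fin (N + 1) → E) {i : Fin (N + 1)}
    (h : ¬ (i : ℕ) + 1 < N + 1) : shiftZero N q i = 0 := by
  have h1 : shiftZero N q i = (if h : (i : ℕ) + 1 < N + 1 then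
      ContinuousLinearMap.proj (R := ℝ) (φ := fun _ : Fin (N + 1) => E) ⟨(i : ℕ) + 1, h⟩
    else 0 : (Fin (N + 1) → E) →L[ℝ] E) q := rfl
  rw [h1, dif_neg h]
  rfl

/-- On Taylor coefficients this is (t v)' = t v' + v. It can fail in the last slot, where
`shiftZero` inserts 0 for the missing next coefficient. -/
theorem shiftZero_timeMul_apply_of_lt (v : Fin (N + 1) → E) {i : Fin (N + 1)}
    (h : (i : ℕ) + 1 < N + 1) :
    shiftZero N (timeMul N v) i = timeMul N (shiftZero N v) i + v i := by
  rw [shiftZero_apply_of_lt _ h, timeMul_apply, timeMul_apply]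
  obtain ⟨i, hi⟩ := i
  cases i with
  | zero => simp
  | succ i =>
    rw [shiftZero_apply_of_lt]
    · simp only [Nat.add_sub_cancel]
      push_cast
      module
    · simp only [Nat.add_sub_cancel]
      exact hi

/-- Tulczyjew's derivation on one-forms in the coordinates `(q₀, …, q_N)`. -/
def totalDeriv (β : (Fin (N + 1) → E) → (Fin (N + 1) → E) →L[ℝ] ℝ) (y : Fin (N + 1) → E) :
    (Fin (N + 1) → E) →L[ℝ] ℝ :=
  fderiv ℝ β y (shiftZero N y) + (β y).comp (shiftZero N)

theorem totalDeriv_apply (β : (Fin (N + 1) → E) → (Fin (N + 1) → E) →L[ℝ] ℝ)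
    (y v : Fin (N + 1) → E) :
    totalDeriv β y v = fderiv ℝ β y (shiftZero N y) v + β y (shiftZero N v) := rfl

theorem totalDeriv_congr {U : Set (Fin (N + 1) → E)} (hU : IsOpen U)
    {β γ : (Fin (N + 1) → E) → (Fin (N + 1) → E) →L[ℝ] ℝ} (h : EqOn β γ U) :
    EqOn (totalDeriv β) (totalDeriv γ) U := by
  intro y hy
  have h1 : β =ᶠ[𝓝 y] γ := h.eventuallyEq_of_mem (hU.mem_nhds hy)
  rw [totalDeriv, totalDeriv, h1.fderiv_eq, h1.eq_of_nhds]

theorem contDiffOn_totalDeriv {U : Set (Fin (N + 1) → E)} (hU : IsOpen U)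
    {β : (Fin (N + 1) → E) → (Fin (N + 1) → E) →L[ℝ] ℝ} (h : ContDiffOn ℝ ∞ β U) :
    ContDiffOn ℝ ∞ (totalDeriv β) U := by
  have h1 : ContDiffOn ℝ ∞ (fun y => fderiv ℝ β y (shiftZero N y)) U :=
    (h.fderiv_of_isOpen hU (m := ∞) (by simp)).clm_apply
      (shiftZero N : (Fin (N + 1) → E) →L[ℝ] _).contDiff.contDiffOn
  have h2 : ContDiffOn ℝ ∞ (fun y => (β y).comp (shiftZero N)) U :=
    h.clm_comp contDiffOn_const
  exact h1.add h2

theorem contDiffOn_totalDeriv_iterate {U : Set (Fin (N + 1) → E)} (hU : IsOpen U)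
    {β : (Fin (N + 1) → E) → (Fin (N + 1) → E) →L[ℝ] ℝ} (h : ContDiffOn ℝ ∞ β U) (a : ℕ) :
    ContDiffOn ℝ ∞ (totalDeriv^[a] β) U := by
  induction a with
  | zero => exact h
  | succ a ih =>
    rw [Function.iterate_succ_apply']
    exact contDiffOn_totalDeriv hU ih

/-- The one-form `β` only involves `dq_i` for `i < l`. -/
def HasLevel (U : Set (Fin (N + 1) → E)) (l : ℕ)
    (β : (Fin (N + 1) → E) → (Fin (N + 1) → E) →L[ℝ] ℝ) : Prop :=
  ∀ y ∈ U, ∀ v : Fin (N + 1) → E, (∀ i : Fin (N + 1), (i : ℕ) < l → v i = 0) → β y v = 0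

theorem fderiv_apply_of_isOpen {G : Type*} [NormedAddCommGroup G] [NormedSpace ℝ G] {U : Set G}
    (hU : IsOpen U) {β : G → G →L[ℝ] ℝ} (h : ContDiffOn ℝ ∞ β U) {y : G} (hy : y ∈ U) (u v : G) :
    fderiv ℝ β y u v = fderiv ℝ (fun z => β z v) y u := by
  have h1 : DifferentiableAt ℝ β y := (h.contDiffAt (hU.mem_nhds hy)).differentiableAt (by simp)
  rw [fderiv_clm_apply h1 (by fun_prop)]
  simp

/-- From d_T(a dq_i) = (d_T a) dq_i + a dq_{i+1}, the highest differential goes up by one. Levels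
are tracked so that the cut-off in `shiftZero` is never felt. -/
theorem hasLevel_totalDeriv {U : Set (Fin (N + 1) → E)} (hU : IsOpen U) {l : ℕ}
    {β : (Fin (N + 1) → E) → (Fin (N + 1) → E) →L[ℝ] ℝ} (h : ContDiffOn ℝ ∞ β U)
    (hβ : HasLevel U l β) : HasLevel U (l + 1) (totalDeriv β) := by
  intro y hy v hv
  rw [totalDeriv_apply, fderiv_apply_of_isOpen hU h hy]
  have h1 : (fun z => β z v) =ᶠ[𝓝 y] fun _ => 0 := by
    filter_upwards [hU.mem_nhds hy] with z hz
    exact hβ z hz v fun i hi => hv i (by omega)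
  rw [h1.fderiv_eq, fderiv_fun_const, hβ y hy]
  · simp
  · intro i hi
    by_cases h2 : (i : ℕ) + 1 < N + 1
    · rw [shiftZero_apply_of_lt _ h2]
      exact hv _ (by simpa using hi)
    · exact shiftZero_apply_of_not_lt _ h2

theorem hasLevel_totalDeriv_iterate {U : Set (Fin (N + 1) → E)} (hU : IsOpen U) {l : ℕ}
    {β : (Fin (N + 1) → E) → (Fin (N + 1) → E) →L[ℝ] ℝ} (h : ContDiffOn ℝ ∞ β U)
    (hβ : HasLevel U l β) (a : ℕ) : HasLevel U (l + a) (totalDeriv^[a] β) := by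
  induction a with
  | zero => exact hβ
  | succ a ih =>
    rw [Function.iterate_succ_apply']
    exact hasLevel_totalDeriv hU (contDiffOn_totalDeriv_iterate hU h a) ih

/-- The commutator of `d_T` and the first vertical endomorphism. -/
theorem totalDeriv_iterate_timeMul {U : Set (Fin (N + 1) → E)} (hU : IsOpen U) {l : ℕ}
    {β γ : (Fin (N + 1) → E) → (Fin (N + 1) → E) →L[ℝ] ℝ} (h : ContDiffOn ℝ ∞ β U)
    (hγ : ContDiffOn ℝ ∞ γ U) (hβγ : ∀ y ∈ U, ∀ v, β y (timeMul N v) = γ y v)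
    (hβ : HasLevel U l β) (a : ℕ) (ha : l + a ≤ N + 1) :
    ∀ y ∈ U, ∀ v, (totalDeriv^[a] β) y (timeMul N v) =
      (totalDeriv^[a] γ) y v + (a : ℝ) * (totalDeriv^[a - 1] β) y v := by
  induction a with
  | zero => simpa using hβγ
  | succ a ih =>
    intro y hy v
    have ih := ih (by omega)
    have hs := contDiffOn_totalDeriv_iterate hU h a
    have hs' := contDiffOn_totalDeriv_iterate hU hγ a
    have hs1 := contDiffOn_totalDeriv_iterate hU h (a - 1)
    have hda : ∀ {δ : (Fin (N + 1) → E) → (Fin (N + 1) → E) →L[ℝ] ℝ}, ContDiffOn ℝ ∞ δ U →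
        DifferentiableAt ℝ (fun z => δ z v) y := fun hδ =>
      ((hδ.contDiffAt (hU.mem_nhds hy)).differentiableAt (by simp)).clm_apply (by fun_prop)
    rw [Function.iterate_succ_apply', Function.iterate_succ_apply', totalDeriv_apply,
      totalDeriv_apply, fderiv_apply_of_isOpen hU hs hy, fderiv_apply_of_isOpen hU hs' hy]
    have h1 : (fun z => (totalDeriv^[a] β) z (timeMul N v)) =ᶠ[𝓝 y] fun z =>
        (totalDeriv^[a] γ) z v + (a : ℝ) * (totalDeriv^[a - 1] β) z v := by
      filter_upwards [hU.mem_nhds hy] with z hz using ih z hz v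
    rw [h1.fderiv_eq, fderiv_fun_add (hda hs') ((hda hs1).const_mul _),
      fderiv_const_mul (hda hs1)]
    -- The relation between `shiftZero` and `timeMul` holds below the last slot, and the level `l +
    -- a ≤ N` of the form makes that slot invisible.
    have h2 : (totalDeriv^[a] β) y (shiftZero N (timeMul N v)) =
        (totalDeriv^[a] β) y (timeMul N (shiftZero N v)) + (totalDeriv^[a] β) y v := by
      rw [← map_add, ← sub_eq_zero, ← map_sub]
      refine hasLevel_totalDeriv_iterate hU h hβ a y hy _ fun i hi => ?_
      rw [Pi.sub_apply, Pi.add_apply, shiftZero_timeMul_apply_of_lt _ (by omega), sub_self]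
    -- The factor `a` covers the case `a = 0`, in which `a - 1` is truncated.
    have h3 : (a : ℝ) * (totalDeriv^[a] β) y v = (a : ℝ) *
        (fderiv ℝ (fun z => (totalDeriv^[a - 1] β) z v) y (shiftZero N y) +
          (totalDeriv^[a - 1] β) y (shiftZero N v)) := by
      cases a with
      | zero => simp
      | succ a =>
        rw [Function.iterate_succ_apply', totalDeriv_apply, ← fderiv_apply_of_isOpen hU hs1 hy]
        rfl
    rw [h2, ih y hy, Nat.add_sub_cancel]
    simp only [add_apply, smul_apply, smul_eq_mul]
    push_cast
    linear_combination -h3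

theorem vertL_timeMul (k r : ℕ) (v : Fin (k + 1) → E) :
    vertL k r (timeMul k v) = vertL k (r + 1) v := by
  rw [vertL_succ, ContinuousLinearMap.comp_apply,
    vertL_comm_of_timeMul_comm (D := timeMul k) (fun _ => rfl)]

end EulerLagrange

/-! ### The Lagrangian one-form at a fixed jet order and the telescoping sum. -/

section EulerLagrangeIdentity

variable {E : Type*} [NormedAddCommGroup E] [NormedSpace ℝ E] {N : ℕ} {T : Set E}

/-- The one-form in the coordinates `(q₀, …, q_N)` induced by a one-form in `(q₀, …, q_k)`. -/
def liftForm {k : ℕ} (h : k ≤ N) (a : (Fin (k + 1) → E) → (Fin (k + 1) → E) →L[ℝ] ℝ)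
    (y : Fin (N + 1) → E) : (Fin (N + 1) → E) →L[ℝ] ℝ :=
  (a (truncL h y)).comp (truncL h)

theorem liftForm_apply {k : ℕ} (h : k ≤ N) (a : (Fin (k + 1) → E) → (Fin (k + 1) → E) →L[ℝ] ℝ)
    (y v : Fin (N + 1) → E) : liftForm h a y v = a (truncL h y) (truncL h v) := rfl

theorem contDiffOn_liftForm {k : ℕ} (h : k ≤ N)
    {a : (Fin (k + 1) → E) → (Fin (k + 1) → E) →L[ℝ] ℝ} (ha : ContDiffOn ℝ ∞ a {y | y 0 ∈ T}) :
    ContDiffOn ℝ ∞ (liftForm h a) {y | y 0 ∈ T} := by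
  have h1 := ha.comp (s := {y : Fin (N + 1) → E | y 0 ∈ T})
    (truncL h : (Fin (N + 1) → E) →L[ℝ] _).contDiff.contDiffOn fun y hy => hy
  exact h1.clm_comp contDiffOn_const

theorem fderiv_liftForm {k : ℕ} (h : k ≤ N) (hT : IsOpen T)
    {a : (Fin (k + 1) → E) → (Fin (k + 1) → E) →L[ℝ] ℝ} (ha : ContDiffOn ℝ ∞ a {y | y 0 ∈ T})
    {y : Fin (N + 1) → E} (hy : y 0 ∈ T) (u v : Fin (N + 1) → E) :
    fderiv ℝ (liftForm h a) y u v = fderiv ℝ a (truncL h y) (truncL h u) (truncL h v) := by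
  have hO : ∀ n : ℕ, IsOpen {y : Fin (n + 1) → E | y 0 ∈ T} := fun n =>
    hT.preimage (continuous_apply 0)
  have hy' : truncL h y ∈ {y : Fin (k + 1) → E | y 0 ∈ T} := hy
  rw [fderiv_apply_of_isOpen (hO N) (contDiffOn_liftForm h ha) hy,
    fderiv_apply_of_isOpen (hO k) ha hy']
  have h1 : DifferentiableAt ℝ (fun z => a z (truncL h v)) (truncL h y) :=
    ((ha.contDiffAt ((hO k).mem_nhds hy')).differentiableAt (by simp)).clm_apply (by fun_prop)
  have h2 := (h1.hasFDerivAt.comp y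
    (truncL h : (Fin (N + 1) → E) →L[ℝ] (Fin (k + 1) → E)).hasFDerivAt).fderiv
  exact DFunLike.congr_fun h2 u

theorem truncL_shiftZero {k : ℕ} (h : k + 1 ≤ N) (y : Fin (N + 1) → E) :
    truncL (Nat.le_of_succ_le h) (shiftZero N y) = shiftL le_rfl (truncL h y) := by
  funext i
  rw [truncL_apply, shiftL_apply, truncL_apply, shiftZero_apply_of_lt]
  · rfl

/-- Coefficients in q_0, …, q_k need only q_1, …, q_{k+1} for their total derivative, and these
exist when k + 1 ≤ N. So d_T, which raises the jet order, is replaced by an operator on one fixed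
space, where its iterates can be added and commuted. -/
theorem totalDeriv_liftForm {k : ℕ} (h : k + 1 ≤ N) (hT : IsOpen T)
    {a : (Fin (k + 1) → E) → (Fin (k + 1) → E) →L[ℝ] ℝ} (ha : ContDiffOn ℝ ∞ a {y | y 0 ∈ T})
    {y : Fin (N + 1) → E} (hy : y 0 ∈ T) :
    totalDeriv (liftForm (Nat.le_of_succ_le h) a) y = liftForm h (tulczyjewRep a) y := by
  ext v
  rw [totalDeriv_apply, fderiv_liftForm _ hT ha hy, liftForm_apply, liftForm_apply,
    truncL_shiftZero h, truncL_shiftZero h]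
  rfl

theorem liftForm_tulczyjewRepIter {k : ℕ} (hT : IsOpen T)
    {a : (Fin (k + 1) → E) → (Fin (k + 1) → E) →L[ℝ] ℝ} (ha : ContDiffOn ℝ ∞ a {y | y 0 ∈ T})
    (s : ℕ) (h : k + s ≤ N) :
    EqOn (liftForm h (tulczyjewRepIter a s)) (totalDeriv^[s] (liftForm (by omega) a))
      {y | y 0 ∈ T} := by
  induction s with
  | zero => exact fun y _ => rfl
  | succ s ih =>
    intro y hy
    rw [Function.iterate_succ_apply',
      ← totalDeriv_congr (hT.preimage (continuous_apply 0)) (ih (by omega)) hy]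
    exact (totalDeriv_liftForm h hT (contDiffOn_tulczyjewRepIter hT ha s) hy).symm

variable {m : ℕ} {f : (Fin (m + 1 + 1) → E) → ℝ}

/-- The one-form `d_{J_r} f` in the coordinates `(q₀, …, q_N)`. -/
def vertForm (f : (Fin (m + 1 + 1) → E) → ℝ) (h : m + 1 ≤ N) (r : ℕ) :
    (Fin (N + 1) → E) → (Fin (N + 1) → E) →L[ℝ] ℝ :=
  liftForm h fun z => (fderiv ℝ f z).comp (vertL (m + 1) r)

theorem vertForm_apply (h : m + 1 ≤ N) (r : ℕ) (y v : Fin (N + 1) → E) :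
    vertForm f h r y v = fderiv ℝ f (truncL h y) (vertL (m + 1) r (truncL h v)) := rfl

theorem contDiffOn_vertForm (hT : IsOpen T) (hf : ContDiffOn ℝ ∞ f {y | y 0 ∈ T})
    (h : m + 1 ≤ N) (r : ℕ) : ContDiffOn ℝ ∞ (vertForm f h r) {y | y 0 ∈ T} :=
  contDiffOn_liftForm h (contDiffOn_fderiv_comp_vertL hT hf r)

theorem vertForm_timeMul (h : m + 1 ≤ N) (r : ℕ) (y v : Fin (N + 1) → E) :
    vertForm f h r y (timeMul N v) = vertForm f h (r + 1) y v := by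
  rw [vertForm_apply, vertForm_apply, ← vertL_timeMul]
  rfl

/-- J_r sends the component v_i to slot i + r, and only slots up to m + 1 exist. For r ≥ m + 2 the
truncated subtraction gives level 0, so the form vanishes. -/
theorem hasLevel_vertForm (U : Set (Fin (N + 1) → E)) (h : m + 1 ≤ N) (r : ℕ) :
    HasLevel U (m + 2 - r) (vertForm f h r) := by
  intro y _ v hv
  rw [vertForm_apply]
  have h1 : vertL (m + 1) r (truncL h v) = 0 := by
    funext i
    rw [vertL_apply]
    by_cases hi : (i : ℕ) < r
    · rw [Nat.descFactorial_eq_zero_iff_lt.2 hi]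
      simp
    · rw [truncL_apply, hv]
      · simp
      · have := i.2
        simp only [Fin.val_castLE]
        omega
  rw [h1, map_zero]

theorem hasLevel_vertForm_iterate (hT : IsOpen T) (hf : ContDiffOn ℝ ∞ f {y | y 0 ∈ T})
    (h : m + 1 ≤ N) (r a : ℕ) :
    HasLevel {y | y 0 ∈ T} (m + 2 - r + a) (totalDeriv^[a] (vertForm f h r)) :=
  hasLevel_totalDeriv_iterate (hT.preimage (continuous_apply 0)) (contDiffOn_vertForm hT hf h r)
    (hasLevel_vertForm _ h r) a

/-- The Euler-Lagrange one-form `∑ (-1)ʳ/r! d_Tʳ d_{J_r} f` is a combination of the `dq₀^A`. -/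
theorem sum_totalDeriv_vertForm_eq_zero (hT : IsOpen T) (hf : ContDiffOn ℝ ∞ f {y | y 0 ∈ T})
    (h : m + 1 ≤ N) {y v : Fin (N + 1) → E} (hy : y 0 ∈ T) (hv : v 0 = 0) :
    ∑ r ∈ Finset.range (m + 2), ((-1 : ℝ) ^ r / (r.factorial : ℝ)) *
      (totalDeriv^[r] (vertForm f h r)) y v = 0 := by
  -- A preimage of `v` under `timeMul`, with components v_{i+1}/(i+1); one exists precisely because
  -- v_0 = 0.
  set w : Fin (N + 1) → E := fun i => ((i : ℕ) + 1 : ℝ)⁻¹ • shiftZero N v i with hw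
  have hvw : v = timeMul N w := by
    funext i
    obtain ⟨i, hi⟩ := i
    rw [timeMul_apply]
    cases i with
    | zero => simpa using hv
    | succ i =>
      have h1 : (((i + 1 : ℕ) : ℝ)) ≠ 0 := by positivity
      simp only [hw, Nat.add_sub_cancel]
      rw [shiftZero_apply_of_lt v (i := ⟨i, by omega⟩) hi, smul_smul]
      push_cast at h1 ⊢
      rw [mul_inv_cancel₀ h1, one_smul]
  -- By the commutator, the rth term splits into one with d_T^r d_{J_{r+1}} and r times one with
  -- d_T^{r-1} d_{J_r}. With weights (-1)^r / r! the second part cancels the first part of the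
  -- preceding term, so only the last first part survives.
  have key : ∀ M : ℕ, M ≤ m + 1 → ∑ r ∈ Finset.range (M + 1),
      ((-1 : ℝ) ^ r / (r.factorial : ℝ)) * (totalDeriv^[r] (vertForm f h r)) y v =
        ((-1 : ℝ) ^ M / (M.factorial : ℝ)) * (totalDeriv^[M] (vertForm f h (M + 1))) y w := by
    intro M hM
    have comm : ∀ r ≤ m + 1, (totalDeriv^[r] (vertForm f h r)) y v =
        (totalDeriv^[r] (vertForm f h (r + 1))) y w +
          (r : ℝ) * (totalDeriv^[r - 1] (vertForm f h r)) y w := by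
      intro r hr
      rw [hvw]
      exact totalDeriv_iterate_timeMul (U := {y | y 0 ∈ T}) (hT.preimage (continuous_apply 0))
        (contDiffOn_vertForm hT hf h r) (contDiffOn_vertForm hT hf h (r + 1))
        (fun y _ v => vertForm_timeMul h r y v) (hasLevel_vertForm _ h r) r (by omega) y hy w
    induction M with
    | zero =>
      rw [Finset.sum_range_one, comm 0 (by omega)]
      simp
    | succ M ih =>
      rw [Finset.sum_range_succ, ih (by omega), comm (M + 1) hM, Nat.add_sub_cancel,
        Nat.factorial_succ]
      have h1 : ((M.factorial : ℕ) : ℝ) ≠ 0 := by exact_mod_cast Nat.factorial_ne_zero _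
      have h2 : ((M + 1 : ℕ) : ℝ) ≠ 0 := by positivity
      push_cast at h2 ⊢
      field_simp
      ring
  rw [key (m + 1) le_rfl]
  have h1 := hasLevel_vertForm (f := f) {y | y 0 ∈ T} h (m + 2)
  -- The surviving term contains J_{m+2}, which is zero on jets of order m + 1.
  have h2 : EqOn (totalDeriv^[m + 1] (vertForm f h (m + 2))) 0 {y | y 0 ∈ T} := by
    have h3 : vertForm f h (m + 2) = 0 := by
      funext y
      ext v
      exact hasLevel_vertForm univ h (m + 2) y (mem_univ _) v fun i hi => by omega
    have h4 : totalDeriv (0 : (Fin (N + 1) → E) → (Fin (N + 1) → E) →L[ℝ] ℝ) = 0 := by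
      funext y
      simp [totalDeriv]
    intro y _
    rw [h3, Function.iterate_fixed h4]
  rw [h2 hy]
  simp

theorem liftForm_lagrangianRep (hT : IsOpen T) (hf : ContDiffOn ℝ ∞ f {y | y 0 ∈ T})
    (h : 2 * m + 1 ≤ N) {y : Fin (N + 1) → E} (hy : y 0 ∈ T) :
    liftForm h (lagrangianRep f) y = ∑ s ∈ Finset.range (m + 1),
      ((-1 : ℝ) ^ s / ((s + 1).factorial : ℝ)) •
        (totalDeriv^[s] (vertForm f (show m + 1 ≤ N by omega) (s + 1))) y := by
  rw [Finset.sum_range]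
  ext v
  rw [liftForm_apply, lagrangianRep, sum_apply, sum_apply]
  refine Finset.sum_congr rfl fun s _ => ?_
  have h1 := liftForm_tulczyjewRepIter (N := N) hT (contDiffOn_fderiv_comp_vertL hT hf ((s : ℕ) + 1))
    s (by have := s.2; omega) hy
  rw [vertForm, smul_apply, smul_apply, ← h1]
  rfl

/-- The Lagrangian one-form is semibasic over `TᵐQ`. -/
theorem lagrangianRep_apply_eq_zero (hT : IsOpen T) (hf : ContDiffOn ℝ ∞ f {y | y 0 ∈ T})
    {y v : Fin (2 * m + 1 + 1) → E} (hy : y 0 ∈ T)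
    (hv : ∀ i : Fin (2 * m + 1 + 1), (i : ℕ) ≤ m → v i = 0) : lagrangianRep f y v = 0 := by
  have h1 := DFunLike.congr_fun (liftForm_lagrangianRep (N := 2 * m + 1) hT hf le_rfl hy) v
  refine Eq.trans (b := liftForm le_rfl (lagrangianRep f) y v) rfl (h1.trans ?_)
  rw [sum_apply]
  refine Finset.sum_eq_zero fun s hs => ?_
  -- Every summand has the same level, (m + 2 − (s + 1)) + s = m + 1: each further d_T compensates
  -- for one more power of J.
  rw [smul_apply, hasLevel_vertForm_iterate hT hf _ _ _ y hy v, smul_zero]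
  intro i hi
  have := Finset.mem_range.1 hs
  exact hv i (by omega)

/-- The Euler-Lagrange identity `d_T θ_L = dL` modulo the `dq₀^A`. -/
theorem fderiv_lagrangianRep_add (hT : IsOpen T) (hf : ContDiffOn ℝ ∞ f {y | y 0 ∈ T})
    {y Y v w : Fin (2 * m + 1 + 1) → E} (hy : y 0 ∈ T)
    (hY : ∀ (i : ℕ) (hi : i + 1 < 2 * m + 1 + 1), Y ⟨i, by omega⟩ = y ⟨i + 1, hi⟩)
    (hv : v 0 = 0)
    (hw : ∀ (i : ℕ) (hi : i ≤ m), w ⟨i, by omega⟩ = v ⟨i + 1, by omega⟩) :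
    fderiv ℝ (lagrangianRep f) y Y v + lagrangianRep f y w =
      fderiv ℝ f (truncL (by omega) y) (truncL (by omega) v) := by
  have hO : ∀ n : ℕ, IsOpen {y : Fin (n + 1) → E | y 0 ∈ T} := fun n =>
    hT.preimage (continuous_apply 0)
  -- One extra coordinate makes room for d_T of θ_L: the free last component of `Y` serves as
  -- q_{2m+2}, so that the shift of `z` truncates to `Y`. The padding of `v` is never seen and is
  -- taken to be 0.
  set z : Fin (2 * m + 1 + 1 + 1) → E := Fin.snoc (α := fun _ => E) y (Y (Fin.last (2 * m + 1))) with hz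
  set v' : Fin (2 * m + 1 + 1 + 1) → E := Fin.snoc (α := fun _ => E) v 0 with hv'
  have hsn : ∀ (x : Fin (2 * m + 1 + 1) → E) (c : E) (i : ℕ) (hi : i < 2 * m + 1 + 1),
      (Fin.snoc (α := fun _ => E) x c : Fin (2 * m + 1 + 1 + 1) → E) ⟨i, by omega⟩ = x ⟨i, hi⟩ := by
    intro x c i hi
    exact Fin.snoc_castSucc (α := fun _ => E) c x ⟨i, hi⟩
  have hsl : ∀ (x : Fin (2 * m + 1 + 1) → E) (c : E) (i : ℕ) (hi : i = 2 * m + 1 + 1),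
      (Fin.snoc (α := fun _ => E) x c : Fin (2 * m + 1 + 1 + 1) → E) ⟨i, by omega⟩ = c := by
    rintro x c i rfl
    exact Fin.snoc_last (α := fun _ => E) c x
  have hle : 2 * m + 1 ≤ 2 * m + 1 + 1 := by omega
  have hty : truncL hle z = y := by
    funext i
    exact hsn _ _ _ i.2
  have htv : truncL hle v' = v := by
    funext i
    exact hsn _ _ _ i.2
  have hz0 : z 0 ∈ T := by
    have : z 0 = y 0 := congrFun hty 0
    rwa [this]
  have hθ := contDiffOn_lagrangianRep hT hf
  have htS : truncL hle (shiftZero (2 * m + 1 + 1) z) = Y := by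
    funext i
    rw [truncL_apply, shiftZero_apply_of_lt _ (by have := i.2; simp only [Fin.val_castLE]; omega)]
    by_cases hi : (i : ℕ) + 1 < 2 * m + 1 + 1
    · exact (hsn _ _ _ hi).trans (hY i hi).symm
    · have h1 : i = Fin.last (2 * m + 1) := by
        ext
        have := i.2
        simp only [Fin.val_last]
        omega
      rw [h1]
      exact hsl _ _ _ rfl
  -- θ_L is semibasic, so only the components of `w` up to m matter, and these are the ones
  -- prescribed by `v`.
  have hwS : lagrangianRep f y w = lagrangianRep f y (truncL hle (shiftZero (2 * m + 1 + 1) v')) := by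
    rw [← sub_eq_zero, ← map_sub]
    refine lagrangianRep_apply_eq_zero hT hf hy fun i hi => ?_
    rw [Pi.sub_apply, truncL_apply,
      shiftZero_apply_of_lt _ (by have := i.2; simp only [Fin.val_castLE]; omega), sub_eq_zero]
    refine (hw i hi).trans (hsn _ _ _ ?_).symm
    omega
  have hD : totalDeriv (liftForm hle (lagrangianRep f)) z v' =
      fderiv ℝ (lagrangianRep f) y Y v + lagrangianRep f y w := by
    rw [totalDeriv_apply, fderiv_liftForm hle hT hθ hz0, liftForm_apply, hty, htv, htS, hwS]
  have hmN : m + 1 ≤ 2 * m + 1 + 1 := by omega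
  have hD2 : totalDeriv (liftForm hle (lagrangianRep f)) z v' = ∑ s ∈ Finset.range (m + 1),
      ((-1 : ℝ) ^ s / ((s + 1).factorial : ℝ)) *
        (totalDeriv^[s + 1] (vertForm f hmN (s + 1))) z v' := by
    rw [totalDeriv_congr (hO (2 * m + 1 + 1)) (fun y hy => liftForm_lagrangianRep hT hf hle hy) hz0]
    have hds : ∀ s ∈ Finset.range (m + 1), DifferentiableAt ℝ
        (fun y => ((-1 : ℝ) ^ s / ((s + 1).factorial : ℝ)) •
          (totalDeriv^[s] (vertForm f hmN (s + 1))) y) z := fun s _ =>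
      (((contDiffOn_totalDeriv_iterate (hO (2 * m + 1 + 1)) (contDiffOn_vertForm hT hf hmN (s + 1))
        s).contDiffAt ((hO (2 * m + 1 + 1)).mem_nhds hz0)).differentiableAt (by simp)).fun_const_smul _
    rw [totalDeriv_apply, fderiv_fun_sum hds]
    simp only [sum_apply]
    rw [← Finset.sum_add_distrib]
    refine Finset.sum_congr rfl fun s _ => ?_
    rw [fderiv_fun_const_smul (((contDiffOn_totalDeriv_iterate (hO (2 * m + 1 + 1))
      (contDiffOn_vertForm hT hf hmN (s + 1)) s).contDiffAt
        ((hO (2 * m + 1 + 1)).mem_nhds hz0)).differentiableAt (by simp)), Function.iterate_succ_apply',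
      totalDeriv_apply]
    simp only [smul_apply, smul_eq_mul]
    ring
  have hv0 : v' 0 = 0 := by
    have : v' 0 = v 0 := congrFun htv 0
    rw [this, hv]
  have hsum := sum_totalDeriv_vertForm_eq_zero hT hf hmN hz0 hv0
  rw [Finset.sum_range_succ'] at hsum
  have h0 : vertForm f hmN 0 z v' = fderiv ℝ f (truncL (by omega) y) (truncL (by omega) v) := by
    rw [vertForm_apply, vertL_zero, ContinuousLinearMap.id_apply, ← hty, ← htv]
    rfl
  rw [← hD, hD2, ← h0]
  simp only [Function.iterate_zero, id_eq, pow_zero, Nat.factorial_zero, Nat.cast_one, div_one,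
    one_mul] at hsum
  -- In the vanishing alternating sum the r = 0 term is df, and the terms with r = s + 1 add up to
  -- −d_T θ_L.
  rw [← sub_eq_zero, ← neg_eq_zero, neg_sub, ← hsum, sub_eq_add_neg, add_comm,
    ← Finset.sum_neg_distrib]
  congr 1
  refine Finset.sum_congr rfl fun s _ => ?_
  ring

end EulerLagrangeIdentity

/-! ### Second-order conditions from regularity -/

section Regularity

variable {E : Type*} [NormedAddCommGroup E] [NormedSpace ℝ E] {T : Set E} {m : ℕ}
  {f : (Fin (m + 1 + 1) → E) → ℝ}

theorem fderiv_lagrangianRep_apply_eq_zero (hT : IsOpen T) (hf : ContDiffOn ℝ ∞ f {y | y 0 ∈ T})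
    {y u v : Fin (2 * m + 1 + 1) → E} (hy : y 0 ∈ T)
    (hu : ∀ i : Fin (2 * m + 1 + 1), (i : ℕ) ≤ m → u i = 0) :
    fderiv ℝ (lagrangianRep f) y v u = 0 := by
  have hO : IsOpen {y : Fin (2 * m + 1 + 1) → E | y 0 ∈ T} := hT.preimage (continuous_apply 0)
  rw [fderiv_apply_of_isOpen hO (contDiffOn_lagrangianRep hT hf) hy]
  have h1 : (fun z => lagrangianRep f z u) =ᶠ[𝓝 y] fun _ => 0 := by
    filter_upwards [hO.mem_nhds hy] with z hz using lagrangianRep_apply_eq_zero hT hf hz hu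
  rw [h1.fderiv_eq, fderiv_fun_const]
  rfl

/-- If `ω_L` is nondegenerate, a vector at `y` that satisfies the Euler-Lagrange identity modulo
`dq₀^A` and whose first components are those of a holonomic vector is holonomic. -/
theorem holonomic_of_nondegenerate [FiniteDimensional ℝ E] (hT : IsOpen T)
    (hf : ContDiffOn ℝ ∞ f {y | y 0 ∈ T}) {y X : Fin (2 * m + 1 + 1) → E} (hy : y 0 ∈ T)
    (hreg : ∀ u, (∀ v, fderiv ℝ (lagrangianRep f) y u v - fderiv ℝ (lagrangianRep f) y v u = 0) →
      u = 0)
    (hX : ∀ (i : ℕ) (hi : i ≤ m), X ⟨i, by omega⟩ = y ⟨i + 1, by omega⟩)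
    (hEL : ∀ v w : Fin (2 * m + 1 + 1) → E, v 0 = 0 →
      (∀ (i : ℕ) (hi : i ≤ m), w ⟨i, by omega⟩ = v ⟨i + 1, by omega⟩) →
      fderiv ℝ (lagrangianRep f) y X v + lagrangianRep f y w =
        fderiv ℝ f (truncL (by omega) y) (truncL (by omega) v))
    (i : ℕ) (hi : i + 1 < 2 * m + 1 + 1) : X ⟨i, by omega⟩ = y ⟨i + 1, hi⟩ := by
  set θ := lagrangianRep f with hθ
  set B : (Fin (2 * m + 1 + 1) → E) →L[ℝ] (Fin (2 * m + 1 + 1) → E) →L[ℝ] ℝ :=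
    fderiv ℝ θ y - (fderiv ℝ θ y).flip with hB
  have hBapp : ∀ u v, B u v = fderiv ℝ θ y u v - fderiv ℝ θ y v u := fun _ _ => rfl
  -- The holonomic vector with the same last component as `X`; this choice is what finally kills the
  -- last-coordinate ambiguity.
  set Y : Fin (2 * m + 1 + 1) → E := fun j =>
    if h : (j : ℕ) + 1 < 2 * m + 1 + 1 then y ⟨(j : ℕ) + 1, h⟩ else X j with hY
  have hYlt : ∀ (j : ℕ) (hj : j + 1 < 2 * m + 1 + 1), Y ⟨j, by omega⟩ = y ⟨j + 1, hj⟩ := by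
    intro j hj
    simp only [hY, hj, dif_pos]
  have hYlast : Y (Fin.last (2 * m + 1)) = X (Fin.last (2 * m + 1)) := by
    simp [hY]
  set sh : (Fin (2 * m + 1 + 1) → E) →L[ℝ] (Fin (2 * m + 1 + 1) → E) :=
    shiftZero (2 * m + 1) with hsh
  have hshv : ∀ (v : Fin (2 * m + 1 + 1) → E) (j : ℕ) (hj : j ≤ m),
      sh v ⟨j, by omega⟩ = v ⟨j + 1, by omega⟩ := fun v j hj =>
    shiftZero_apply_of_lt v (i := ⟨j, by omega⟩) (by simp only; omega)
  set ℓ : E →ₗ[ℝ] (Fin (2 * m + 1 + 1) → E) :=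
    LinearMap.single ℝ (fun _ : Fin (2 * m + 1 + 1) => E) (Fin.last (2 * m + 1)) with hℓ
  set z : E →ₗ[ℝ] (Fin (2 * m + 1 + 1) → E) :=
    LinearMap.single ℝ (fun _ : Fin (2 * m + 1 + 1) => E) 0 with hz
  have hℓlast : ∀ u, ℓ u (Fin.last (2 * m + 1)) = u := fun u => Pi.single_eq_same _ _
  have hℓlt : ∀ u (j : Fin (2 * m + 1 + 1)), (j : ℕ) + 1 < 2 * m + 1 + 1 → ℓ u j = 0 := by
    intro u j hj
    refine Pi.single_eq_of_ne (fun h => ?_) _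
    rw [h, Fin.val_last] at hj
    omega
  -- The equation for `X` minus the universal identity for `Y`: the terms in θ_L and dL are the same
  -- in both.
  have hEL1 : ∀ v, v 0 = 0 → fderiv ℝ θ y (X - Y) v = 0 := by
    intro v hv
    have h1 := hEL v (sh v) hv (hshv v)
    have h2 := fderiv_lagrangianRep_add hT hf hy hYlt hv (hshv v)
    rw [map_sub, sub_apply]
    linarith
  -- Two holonomic vectors at `y` may differ by any `ℓ u`, and the universal identity holds for
  -- both.
  have hEL2 : ∀ u v, v 0 = 0 → fderiv ℝ θ y (ℓ u) v = 0 := by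
    intro u v hv
    have h1 := fderiv_lagrangianRep_add (Y := Y + ℓ u) hT hf hy (fun j hj => by
      rw [Pi.add_apply, hYlt j hj, hℓlt u _ hj, add_zero]) hv (hshv v)
    have h2 := fderiv_lagrangianRep_add hT hf hy hYlt hv (hshv v)
    rw [map_add, add_apply] at h1
    linarith
  have hZ0 : ∀ j : Fin (2 * m + 1 + 1), (j : ℕ) ≤ m → (X - Y) j = 0 := by
    intro j hj
    have h1 := hX j hj
    have h2 := hYlt j (by omega)
    rw [Pi.sub_apply, sub_eq_zero]
    exact h1.trans h2.symm
  -- The other half of the two-form vanishes because `X - Y` has no components up to m and θ_L is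
  -- semibasic.
  have hBZ : ∀ v, v 0 = 0 → B (X - Y) v = 0 := by
    intro v hv
    rw [hBapp, hEL1 v hv, fderiv_lagrangianRep_apply_eq_zero hT hf hy hZ0, sub_zero]
  have hBℓ : ∀ u v, v 0 = 0 → B (ℓ u) v = 0 := by
    intro u v hv
    rw [hBapp, hEL2 u v hv, fderiv_lagrangianRep_apply_eq_zero hT hf hy, sub_zero]
    intro j hj
    exact hℓlt u j (by omega)
  have hsplit : ∀ v : Fin (2 * m + 1 + 1) → E, (v - z (v 0)) 0 = 0 := by
    intro v
    rw [Pi.sub_apply, sub_eq_zero, hz, LinearMap.single_apply, Pi.single_eq_same]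
  have hext : ∀ u : Fin (2 * m + 1 + 1) → E, (∀ v, v 0 = 0 → B u v = 0) →
      ∀ v, B u v = B u (z (v 0)) := by
    intro u hu v
    rw [← sub_eq_zero, ← map_sub]
    exact hu _ (hsplit v)
  -- A vector orthogonal to {v_0 = 0} is determined by its pairing with the q_0 directions.
  -- Restricted to last-coordinate vectors this pairing is injective by nondegeneracy, hence onto
  -- the dual in finite dimension; so some `ℓ u` pairs exactly as `X - Y` does.
  set Λ : E →ₗ[ℝ] Module.Dual ℝ E :=
    LinearMap.mk₂ ℝ (fun u x => B (ℓ u) (z x)) (by simp) (by simp) (by simp) (by simp) with hΛ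
  have hΛapp : ∀ u x, Λ u x = B (ℓ u) (z x) := fun _ _ => rfl
  have hinj : Function.Injective Λ := by
    rw [← LinearMap.ker_eq_bot, LinearMap.ker_eq_bot']
    intro u hu
    have h1 : ℓ u = 0 := by
      refine hreg _ fun v => ?_
      rw [← hBapp, hext _ (hBℓ u), ← hΛapp, hu]
      rfl
    rw [← hℓlast u, h1]
    rfl
  have hsurj : Function.Surjective Λ :=
    (LinearMap.injective_iff_surjective_of_finrank_eq_finrank
      (Subspace.dual_finrank_eq (K := ℝ) (V := E)).symm).1 hinj
  obtain ⟨u, hu⟩ := hsurj ((B (X - Y) : (Fin (2 * m + 1 + 1) → E) →ₗ[ℝ] ℝ).comp z)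
  have hZ : X - Y - ℓ u = 0 := by
    refine hreg _ fun v => ?_
    rw [← hBapp, map_sub, sub_apply, hext _ hBZ, hext _ (hBℓ u), ← hΛapp, hu]
    exact sub_self _
  have hu0 : u = 0 := by
    have h1 := congrFun hZ (Fin.last (2 * m + 1))
    rw [Pi.sub_apply, Pi.sub_apply, hYlast, hℓlast] at h1
    simpa using h1
  rw [hu0, map_zero, sub_zero, sub_eq_zero] at hZ
  rw [hZ, hYlt i hi]

end Regularity

/-! ### Bundles in preferred charts -/

section FiberBundles

variable {V B F : Type*} [NormedAddCommGroup V] [NormedSpace ℝ V] [NormedAddCommGroup F]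
  [NormedSpace ℝ F] [TopologicalSpace B] [ChartedSpace V B] {W : B → Type*}
  [TopologicalSpace (TotalSpace F W)] [∀ x, TopologicalSpace (W x)] [FiberBundle F W]

theorem extChartAt_totalSpace_fst (w w' : TotalSpace F W) :
    (extChartAt (𝓘(ℝ, V).prod 𝓘(ℝ, F)) w w' : V × F).1 =
      chartAt V w.proj (trivializationAt F W w.proj w').1 := by
  simp only [FiberBundle.chartedSpace_chartAt, mfld_simps]

theorem extChartAt_totalSpace_apply (w : TotalSpace F W) {w' : TotalSpace F W}
    (h : w'.proj ∈ (trivializationAt F W w.proj).baseSet) :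
    extChartAt (𝓘(ℝ, V).prod 𝓘(ℝ, F)) w w' =
      (chartAt V w.proj w'.proj, (trivializationAt F W w.proj w').2) := by
  refine Prod.ext ?_ rfl
  rw [extChartAt_totalSpace_fst, (trivializationAt F W w.proj).coe_fst' h]

omit [NormedSpace ℝ F] in
theorem eventually_mem_baseSet (w : TotalSpace F W) :
    ∀ᶠ w' in 𝓝 w, w'.proj ∈ (trivializationAt F W w.proj).baseSet :=
  (FiberBundle.continuous_proj F W).continuousAt.preimage_mem_nhds
    ((trivializationAt F W w.proj).open_baseSet.mem_nhds (FiberBundle.mem_baseSet_trivializationAt' _))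

variable [IsManifold (𝓘(ℝ, V).prod 𝓘(ℝ, F)) 1 (TotalSpace F W)]

/-- Tangent vectors at `w` are by construction their coordinates in the preferred chart at `w`.
Derivatives at `w` can therefore be read off from coordinate expressions in that chart. -/
theorem hasMFDerivAt_extChartAt_totalSpace (w : TotalSpace F W) :
    HasMFDerivAt (𝓘(ℝ, V).prod 𝓘(ℝ, F)) 𝓘(ℝ, V × F) (extChartAt (𝓘(ℝ, V).prod 𝓘(ℝ, F)) w) w
      (ContinuousLinearMap.id ℝ (V × F)) := by
  have h1 := (mdifferentiableAt_extChartAt (I := 𝓘(ℝ, V).prod 𝓘(ℝ, F))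
    (mem_chart_source (ModelProd V F) w)).hasMFDerivAt
  rw [mfderiv_extChartAt_self] at h1
  exact h1

theorem hasMFDerivAt_of_comp_extChartAt {G : Type*} [NormedAddCommGroup G] [NormedSpace ℝ G]
    {w : TotalSpace F W} {f : TotalSpace F W → G} {g : V × F → G} {g' : V × F →L[ℝ] G}
    (hf : f =ᶠ[𝓝 w] g ∘ extChartAt (𝓘(ℝ, V).prod 𝓘(ℝ, F)) w)
    (hg : HasFDerivAt g g' (extChartAt (𝓘(ℝ, V).prod 𝓘(ℝ, F)) w w)) :
    HasMFDerivAt (𝓘(ℝ, V).prod 𝓘(ℝ, F)) 𝓘(ℝ, G) f w g' := by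
  refine HasMFDerivAt.congr_of_eventuallyEq ?_ hf
  exact (hg.hasMFDerivAt).comp w (hasMFDerivAt_extChartAt_totalSpace w)

theorem hasMFDerivAt_trivializationAt_snd (w : TotalSpace F W) :
    HasMFDerivAt (𝓘(ℝ, V).prod 𝓘(ℝ, F)) 𝓘(ℝ, F) (fun w' => (trivializationAt F W w.proj w').2) w
      (ContinuousLinearMap.snd ℝ V F) :=
  hasMFDerivAt_of_comp_extChartAt (.of_forall fun _ => rfl) hasFDerivAt_snd

end FiberBundles

/-! ### Cotangent bundles and the canonical two-form. -/

section CotangentBundles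

variable {V M : Type*} [NormedAddCommGroup V] [NormedSpace ℝ V] [TopologicalSpace M]
  [ChartedSpace V M] [IsManifold 𝓘(ℝ, V) ∞ M]

/-- The trivialization of a bundle of linear maps precomposes with the inverse tangent
trivialization, which is the derivative of the inverse chart; the trivial real factor contributes
the identity. -/
theorem cotangent_trivializationAt_snd (x₀ : M) {α : CotangentBundle 𝓘(ℝ, V) M}
    (hα : α.proj ∈ (chartAt V x₀).source) (v : V) :
    (trivializationAt (V →L[ℝ] ℝ) (CotangentSpace 𝓘(ℝ, V) M) x₀ α).2 v =
      (show V →L[ℝ] ℝ from α.2)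
        (chartSymmDeriv (chartAt V x₀) (chartAt V x₀ α.proj) v) := by
  have h1 := TangentBundle.symmL_trivializationAt (I := 𝓘(ℝ, V)) hα
  have h2 : (trivializationAt V (TangentSpace 𝓘(ℝ, V)) x₀).symmL ℝ α.proj v =
      chartSymmDeriv (chartAt V x₀) (chartAt V x₀ α.proj) v := by
    rw [h1]
    simp only [mfld_simps, mfderivWithin_univ]
    rfl
  rw [← h2, hom_trivializationAt_apply]
  simp only [ContinuousLinearMap.inCoordinates]
  exact DFunLike.congr_fun (Bundle.Trivial.continuousLinearMapAt_trivialization ℝ M ℝ α.proj) _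

theorem cotangent_mem_baseSet (x₀ : M) {x : M} (hx : x ∈ (chartAt V x₀).source) :
    x ∈ (trivializationAt (V →L[ℝ] ℝ) (CotangentSpace 𝓘(ℝ, V) M) x₀).baseSet :=
  ⟨hx, mem_univ _⟩

theorem fderiv_snd_comp_fst {V : Type*} [NormedAddCommGroup V] [NormedSpace ℝ V]
    (z u v : V × (V →L[ℝ] ℝ)) :
    fderiv ℝ (fun y : V × (V →L[ℝ] ℝ) =>
      ContinuousLinearMap.comp y.2 (ContinuousLinearMap.fst ℝ V (V →L[ℝ] ℝ))) z u v = u.2 v.1 := by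
  have h1 := (hasFDerivAt_snd (𝕜 := ℝ) (p := z)).clm_comp
    (hasFDerivAt_const (ContinuousLinearMap.fst ℝ V (V →L[ℝ] ℝ)) z)
  rw [h1.fderiv]
  simp

set_option synthInstance.maxHeartbeats 200000 in
/-- In the preferred chart at a covector the canonical form is `dqᴬ ∧ dp_A`. -/
theorem canonicalTwo_apply (α : CotangentBundle 𝓘(ℝ, V) M) (u v : V × (V →L[ℝ] ℝ)) :
    canonicalTwo 𝓘(ℝ, V) M α u v = v.2 u.1 - u.2 v.1 := by
  set I2 := 𝓘(ℝ, V).prod 𝓘(ℝ, V →L[ℝ] ℝ) with hI2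
  set x₀ := α.proj with hx₀
  set c := chartAt V x₀ with hc
  set φ := extChartAt I2 α with hφ
  have hrange : range I2 = univ := by simp [hI2]
  have hev : ∀ᶠ y in 𝓝 (φ α), y ∈ φ.target ∧ (φ.symm y).proj ∈ c.source := by
    have h1 : φ.target ∈ 𝓝 (φ α) := by
      have := extChartAt_target_mem_nhdsWithin (I := I2) α
      rwa [hrange, nhdsWithin_univ] at this
    have h2 : ContinuousAt (fun y => (φ.symm y).proj) (φ α) :=
      (FiberBundle.continuous_proj _ _).continuousAt.comp (continuousAt_extChartAt_symm α)
    have h3 : (φ.symm (φ α)).proj ∈ c.source := by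
      rw [extChartAt_to_inv]
      exact mem_chart_source V x₀
    filter_upwards [h1, h2.preimage_mem_nhds (c.open_source.mem_nhds h3)] with y hy hy'
      using ⟨hy, hy'⟩
  have hval : ∀ y ∈ φ.target, (φ.symm y).proj ∈ c.source →
      y = (c (φ.symm y).proj, (trivializationAt (V →L[ℝ] ℝ) (CotangentSpace 𝓘(ℝ, V) M) x₀
        (φ.symm y)).2) := by
    intro y hy hy'
    rw [← extChartAt_totalSpace_apply α (cotangent_mem_baseSet x₀ hy')]
    exact (φ.right_inv hy).symm
  have hproj : (fun y => (φ.symm y).proj) =ᶠ[𝓝 (φ α)] fun y => c.symm y.1 := by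
    filter_upwards [hev] with y hy
    have h1 : y.1 = c (φ.symm y).proj := congrArg Prod.fst (hval y hy.1 hy.2)
    rw [h1, c.left_inv hy.2]
  set a : V × (V →L[ℝ] ℝ) → (V × (V →L[ℝ] ℝ) →L[ℝ] ℝ) := fun y =>
    ContinuousLinearMap.comp (canonicalOne 𝓘(ℝ, V) M (φ.symm y))
      (mfderivWithin 𝓘(ℝ, V × (V →L[ℝ] ℝ)) I2 φ.symm (range I2) y) with ha_def
  -- In the preferred chart the tautological form is p dq: the bundle projection reads as the first
  -- coordinate and the covector as the second.
  have ha : a =ᶠ[𝓝 (φ α)]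
      fun y => ContinuousLinearMap.comp y.2 (ContinuousLinearMap.fst ℝ V (V →L[ℝ] ℝ)) := by
    filter_upwards [hev, hproj.eventuallyEq_nhds] with y hy hp
    have hc1 : c ∈ atlas V M := chart_mem_atlas V x₀
    have hy1 : y.1 = c (φ.symm y).proj := congrArg Prod.fst (hval y hy.1 hy.2)
    have hy2 : y.2 = (trivializationAt (V →L[ℝ] ℝ) (CotangentSpace 𝓘(ℝ, V) M) x₀
        (φ.symm y)).2 := congrArg Prod.snd (hval y hy.1 hy.2)
    have hyt : y.1 ∈ c.target := by
      rw [hy1]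
      exact c.map_source hy.2
    have hφd : MDifferentiableAt 𝓘(ℝ, V × (V →L[ℝ] ℝ)) I2 φ.symm y := by
      have h1 := mdifferentiableWithinAt_extChartAt_symm (I := I2) hy.1
      rwa [hrange, mdifferentiableWithinAt_univ] at h1
    have hpd : MDifferentiableAt I2 𝓘(ℝ, V)
        (TotalSpace.proj : CotangentBundle 𝓘(ℝ, V) M → M) (φ.symm y) :=
      (contMDiff_proj (n := 1) _).mdifferentiable (by simp) _
    have h1 := mfderiv_comp y hpd hφd
    have h2 := mfderiv_comp y (I' := 𝓘(ℝ, V)) (f := (Prod.fst : V × (V →L[ℝ] ℝ) → V))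
      (g := c.symm) (mdifferentiableAt_chart_symm hc1 hyt)
      differentiableAt_fst.mdifferentiableAt
    have h3 : (TotalSpace.proj : CotangentBundle 𝓘(ℝ, V) M → M) ∘ φ.symm =ᶠ[𝓝 y]
        c.symm ∘ (Prod.fst : V × (V →L[ℝ] ℝ) → V) := hp
    rw [h3.mfderiv_eq, h2, mfderiv_eq_fderiv, fderiv_fst] at h1
    have hay : a y = ContinuousLinearMap.comp (canonicalOne 𝓘(ℝ, V) M (φ.symm y))
        (mfderiv 𝓘(ℝ, V × (V →L[ℝ] ℝ)) I2 φ.symm y) := by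
      simp only [ha_def, hrange, mfderivWithin_univ]
      rfl
    rw [hay]
    ext u
    · refine Eq.trans (b := (show V →L[ℝ] ℝ from (φ.symm y).2) (chartSymmDeriv c y.1 u)) ?_ ?_
      · exact congrArg (show V →L[ℝ] ℝ from (φ.symm y).2)
          (DFunLike.congr_fun h1 ((u, 0) : V × (V →L[ℝ] ℝ))).symm
      · rw [hy1, ← cotangent_trivializationAt_snd x₀ hy.2, ← hy2]
        rfl
    · refine Eq.trans (b := (show V →L[ℝ] ℝ from (φ.symm y).2) (chartSymmDeriv c y.1 0)) ?_ ?_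
      · exact congrArg (show V →L[ℝ] ℝ from (φ.symm y).2)
          (DFunLike.congr_fun h1 ((0, u) : V × (V →L[ℝ] ℝ))).symm
      · exact (congrArg _ (map_zero _)).trans
          ((map_zero (show V →L[ℝ] ℝ from (φ.symm y).2)).trans (map_zero y.2).symm)
  have hD : fderivWithin ℝ a (range I2) (φ α) = fderiv ℝ (fun y : V × (V →L[ℝ] ℝ) =>
      ContinuousLinearMap.comp y.2 (ContinuousLinearMap.fst ℝ V (V →L[ℝ] ℝ))) (φ α) := by
    rw [hrange, fderivWithin_univ, ha.fderiv_eq]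
  have hfinal : canonicalTwo 𝓘(ℝ, V) M α u v = -(fderivWithin ℝ a (range I2) (φ α) u v -
      fderivWithin ℝ a (range I2) (φ α) v u) := rfl
  rw [hfinal, neg_sub, hD, fderiv_snd_comp_fst, fderiv_snd_comp_fst]

end CotangentBundles

/-! ### The unified phase space in preferred charts -/

section UnifiedPhaseSpace

variable {E : Type*} [NormedAddCommGroup E] [NormedSpace ℝ E]
  {Q : Type*} [TopologicalSpace Q] [ChartedSpace E Q] [IsManifold 𝓘(ℝ, E) ∞ Q]

theorem chartDeriv_chartAt {V M : Type*} [NormedAddCommGroup V] [NormedSpace ℝ V]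
    [TopologicalSpace M] [ChartedSpace V M] [IsManifold 𝓘(ℝ, V) ∞ M] (x : M) :
    chartDeriv (chartAt V x) x = ContinuousLinearMap.id ℝ V := by
  have h1 : IsManifold 𝓘(ℝ, V) 1 M := IsManifold.of_le (n := ∞) (by simp)
  have := mfderiv_extChartAt_self (I := 𝓘(ℝ, V)) (x := x)
  simpa only [mfld_simps] using! this

/-- A jet and its projection have the same base point, so their preferred charts come from one chart
of Q, and in such a pair of charts the projection is exactly truncation. -/
theorem jetProjDeriv_eq_truncL {r k : ℕ} (h : r ≤ k) (p : HOTangent E Q k) :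
    jetProjDeriv h p = truncL h := by
  ext1 v
  have h1 := chartDeriv_jetProjDeriv (chart_mem_atlas E (baseProj p)) h (mem_chart_source E _) v
  rw [← chartAt_jetProj h, chartDeriv_chartAt, ← chartAt_eq_natChart, chartDeriv_chartAt] at h1
  exact h1

theorem canonicalInj_eq_shiftL {r k : ℕ} (h : r + 1 ≤ k) (p : HOTangent E Q k) :
    (show Fin (r + 1) → E from canonicalInj h p) =
      shiftL h (chartAt (Fin (k + 1) → E) p p) := by
  have h1 := chartDeriv_canonicalInj (chart_mem_atlas E (baseProj p)) h (mem_chart_source E _)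
  rw [← chartAt_jetProj (Nat.le_of_succ_le h), chartDeriv_chartAt] at h1
  exact h1

variable {m : ℕ}

/-- The momentum coordinates on `W` in the preferred trivialization at `w`. -/
def momentum (w w' : UnifiedSpace E Q m) : (Fin (m + 1) → E) →L[ℝ] ℝ :=
  (trivializationAt ((Fin (m + 1) → E) →L[ℝ] ℝ)
    (rho E Q m *ᵖ (CotangentSpace 𝓘(ℝ, Fin (m + 1) → E) (HOTangent E Q m))) w.proj w').2

theorem momentum_eq_prTwo (w w' : UnifiedSpace E Q m) :
    momentum w w' = (trivializationAt ((Fin (m + 1) → E) →L[ℝ] ℝ)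
      (CotangentSpace 𝓘(ℝ, Fin (m + 1) → E) (HOTangent E Q m)) (prTwo w).proj (prTwo w')).2 := rfl

theorem momentum_apply (w : UnifiedSpace E Q m) {w' : UnifiedSpace E Q m}
    (h : w'.proj ∈ (chartAt (Fin (2 * m + 1 + 1) → E) w.proj).source) (v : Fin (m + 1) → E) :
    momentum w w' v = (show (Fin (m + 1) → E) →L[ℝ] ℝ from covector w')
      (chartSymmDeriv (natChart m (chart_mem_atlas E (baseProj w.proj)))
        (natChart m (chart_mem_atlas E (baseProj w.proj)) (rho E Q m w'.proj)) v) := by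
  have h2 : chartAt (Fin (m + 1) → E) (prTwo w).proj =
      natChart m (chart_mem_atlas E (baseProj w.proj)) := chartAt_jetProj (by omega) _
  have h1 : (prTwo w').proj ∈ (chartAt (Fin (m + 1) → E) (prTwo w).proj).source := by
    rw [h2]
    exact jetProj_mem_source _ (by omega) h
  rw [momentum_eq_prTwo, cotangent_trivializationAt_snd _ h1, h2]
  rfl

theorem unified_mem_baseSet (w : UnifiedSpace E Q m) {p : HOTangent E Q (2 * m + 1)}
    (h : p ∈ (chartAt (Fin (2 * m + 1 + 1) → E) w.proj).source) :
    p ∈ (trivializationAt ((Fin (m + 1) → E) →L[ℝ] ℝ)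
      (rho E Q m *ᵖ (CotangentSpace 𝓘(ℝ, Fin (m + 1) → E) (HOTangent E Q m)))
        w.proj).baseSet := by
  refine cotangent_mem_baseSet (rho E Q m w.proj) (x := rho E Q m p) ?_
  have : chartAt (Fin (m + 1) → E) (rho E Q m w.proj) =
    natChart m (chart_mem_atlas E (baseProj w.proj)) := chartAt_jetProj (by omega) _
  rw [this]
  exact jetProj_mem_source _ (by omega) h

theorem extChartAt_unified (w : UnifiedSpace E Q m) {w' : UnifiedSpace E Q m}
    (h : w'.proj ∈ (chartAt (Fin (2 * m + 1 + 1) → E) w.proj).source) :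
    (extChartAt (unifiedModel E m) w w' : (Fin (2 * m + 1 + 1) → E) × _) =
      (natChart (2 * m + 1) (chart_mem_atlas E (baseProj w.proj)) w'.proj, momentum w w') :=
  extChartAt_totalSpace_apply w (unified_mem_baseSet w h)

theorem eventually_proj_mem_source (w : UnifiedSpace E Q m) :
    ∀ᶠ w' in 𝓝 w, w'.proj ∈ (chartAt (Fin (2 * m + 1 + 1) → E) w.proj).source :=
  (FiberBundle.continuous_proj _ _).continuousAt.preimage_mem_nhds
    ((chartAt _ w.proj).open_source.mem_nhds (mem_chart_source _ _))

instance : IsManifold (unifiedModel E m) 1 (UnifiedSpace E Q m) :=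
  IsManifold.of_le (n := ∞) (by simp)

theorem hasMFDerivAt_momentum (w : UnifiedSpace E Q m) :
    HasMFDerivAt (unifiedModel E m) 𝓘(ℝ, (Fin (m + 1) → E) →L[ℝ] ℝ) (momentum w) w
      (ContinuousLinearMap.snd ℝ (Fin (2 * m + 1 + 1) → E) ((Fin (m + 1) → E) →L[ℝ] ℝ)) :=
  hasMFDerivAt_trivializationAt_snd w

section ProjectionDerivative

variable {V B F : Type*} [NormedAddCommGroup V] [NormedSpace ℝ V]
  [NormedAddCommGroup F] [NormedSpace ℝ F] [TopologicalSpace B] [ChartedSpace V B]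
  {W : B → Type*} [TopologicalSpace (TotalSpace F W)] [∀ x, TopologicalSpace (W x)]
  [FiberBundle F W]

/-- The derivative of the projection of a bundle, as a map of the model spaces. -/
def projDeriv (w : TotalSpace F W) : V × F →L[ℝ] V :=
  mfderiv (𝓘(ℝ, V).prod 𝓘(ℝ, F)) 𝓘(ℝ, V) TotalSpace.proj w

theorem projDeriv_eq_fst [IsManifold 𝓘(ℝ, V) ∞ B]
    [IsManifold (𝓘(ℝ, V).prod 𝓘(ℝ, F)) 1 (TotalSpace F W)] (w : TotalSpace F W) :
    projDeriv w = ContinuousLinearMap.fst ℝ V F := by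
  have h1 : HasMFDerivAt (𝓘(ℝ, V).prod 𝓘(ℝ, F)) 𝓘(ℝ, V)
      (chartAt V w.proj ∘ (TotalSpace.proj : TotalSpace F W → B)) w
      (ContinuousLinearMap.fst ℝ V F) := by
    refine hasMFDerivAt_of_comp_extChartAt ?_ hasFDerivAt_fst
    filter_upwards [eventually_mem_baseSet w] with w' hw'
    rw [Function.comp_apply, Function.comp_apply, extChartAt_totalSpace_apply w hw']
  have h2 := mfderiv_comp w
    (mdifferentiableAt_chart (chart_mem_atlas V w.proj) (mem_chart_source V w.proj))
    ((contMDiff_proj (n := 1) (IB := 𝓘(ℝ, V)) W).mdifferentiable (by simp) w)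
  rw [h1.mfderiv] at h2
  refine ContinuousLinearMap.ext fun u => ?_
  have h3 : _ = chartDeriv (chartAt V w.proj) w.proj (projDeriv w u) := DFunLike.congr_fun h2 u
  rw [chartDeriv_chartAt] at h3
  exact h3.symm

end ProjectionDerivative

/-- W carries the pulled-back bundle structure, so the fibre coordinate of `prTwo` is literally that
of the identity map of W, and the base part is `rho` after the projection. -/
theorem contMDiff_prTwo : ContMDiff (unifiedModel E m)
    (𝓘(ℝ, Fin (m + 1) → E).prod 𝓘(ℝ, (Fin (m + 1) → E) →L[ℝ] ℝ)) ∞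
    (prTwo : UnifiedSpace E Q m → _) := by
  intro w
  rw [contMDiffAt_totalSpace]
  refine ⟨((rho E Q m).contMDiff.comp (contMDiff_proj _)) w, ?_⟩
  exact ((contMDiffAt_totalSpace (f := fun w' : UnifiedSpace E Q m => w')).1 contMDiffAt_id).2

set_option synthInstance.maxHeartbeats 200000 in
/-- The derivative of `pr₂`, as a map of the model spaces. -/
def prTwoDeriv (w : UnifiedSpace E Q m) :
    (Fin (2 * m + 1 + 1) → E) × ((Fin (m + 1) → E) →L[ℝ] ℝ) →L[ℝ]
      (Fin (m + 1) → E) × ((Fin (m + 1) → E) →L[ℝ] ℝ) :=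
  mfderiv (unifiedModel E m) (𝓘(ℝ, Fin (m + 1) → E).prod 𝓘(ℝ, (Fin (m + 1) → E) →L[ℝ] ℝ)) prTwo w

set_option synthInstance.maxHeartbeats 200000 in
theorem prTwoDeriv_apply (w : UnifiedSpace E Q m)
    (u : (Fin (2 * m + 1 + 1) → E) × ((Fin (m + 1) → E) →L[ℝ] ℝ)) :
    prTwoDeriv w u = (truncL (by omega) u.1, u.2) := by
  have hd := (contMDiff_prTwo (E := E) (Q := Q) (m := m)).mdifferentiable (by simp) w
  refine Prod.ext ?_ ?_
  -- Base component: the cotangent projection after `prTwo` equals `rho` after the projection of W;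
  -- both sides are differentiated.
  · refine (DFunLike.congr_fun (projDeriv_eq_fst (prTwo w)) (prTwoDeriv w u)).symm.trans ?_
    have h1 := mfderiv_comp w ((contMDiff_proj (n := 1) (IB := 𝓘(ℝ, Fin (m + 1) → E))
      (CotangentSpace 𝓘(ℝ, Fin (m + 1) → E) (HOTangent E Q m))).mdifferentiable (by simp) _) hd
    have h2 := mfderiv_comp w ((rho E Q m).contMDiff.mdifferentiable (by simp) w.proj)
      ((contMDiff_proj (n := 1) (IB := 𝓘(ℝ, Fin (2 * m + 1 + 1) → E))
      (rho E Q m *ᵖ (CotangentSpace 𝓘(ℝ, Fin (m + 1) → E) (HOTangent E Q m)))).mdifferentiable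
        (by simp) w)
    have h3 := DFunLike.congr_fun (h1.symm.trans h2) u
    refine h3.trans ?_
    refine Eq.trans (b := jetProjDeriv (r := m) (by omega) w.proj (projDeriv w u)) rfl ?_
    rw [jetProjDeriv_eq_truncL, projDeriv_eq_fst]
    rfl
  -- Fibre component: in the preferred trivialization the fibre coordinate of `prTwo` is `momentum
  -- w`.
  · have h1 := ((hasMFDerivAt_trivializationAt_snd (prTwo w)).comp w hd.hasMFDerivAt).mfderiv
    have h2 := h1.symm.trans (hasMFDerivAt_momentum w).mfderiv
    exact DFunLike.congr_fun h2 u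

/-- The presymplectic form is `dqᵢᴬ ∧ dpⁱ_A`. -/
theorem unifiedTwo_apply (w : UnifiedSpace E Q m)
    (u v : (Fin (2 * m + 1 + 1) → E) × ((Fin (m + 1) → E) →L[ℝ] ℝ)) :
    unifiedTwo w u v = v.2 (truncL (by omega) u.1) - u.2 (truncL (by omega) v.1) := by
  refine (canonicalTwo_apply (prTwo w) (prTwoDeriv w u) (prTwoDeriv w v)).trans ?_
  rw [prTwoDeriv_apply, prTwoDeriv_apply]

end UnifiedPhaseSpace

/-! ### The Hamiltonian and the Legendre graph in coordinates -/

section UnifiedCoordinates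

variable {E : Type*} [NormedAddCommGroup E] [NormedSpace ℝ E]
  {Q : Type*} [TopologicalSpace Q] [ChartedSpace E Q] [IsManifold 𝓘(ℝ, E) ∞ Q] {m : ℕ}

theorem covector_apply (w : UnifiedSpace E Q m) {w' : UnifiedSpace E Q m}
    (h : w'.proj ∈ (chartAt (Fin (2 * m + 1 + 1) → E) w.proj).source) (z : Fin (m + 1) → E) :
    (show (Fin (m + 1) → E) →L[ℝ] ℝ from covector w') z = momentum w w'
      (chartDeriv (natChart m (chart_mem_atlas E (baseProj w.proj)))
        (jetProj (by omega) w'.proj) z) := by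
  have h1 := chartSymmDeriv_chartDeriv (natChart_mem_atlas m (chart_mem_atlas E (baseProj w.proj)))
    (jetProj_mem_source (chart_mem_atlas E (baseProj w.proj)) (by omega : m ≤ 2 * m + 1) h) z
  rw [momentum_apply w h]
  exact congrArg _ h1.symm

/-- The local form p^i q_{i+1} − L: the canonical injection is the coordinate shift, and the pairing
is evaluated in the trivialization at `w`. Keeping `w` fixed while `w'` varies is what permits
differentiation at `w`. -/
theorem unifiedHamiltonian_eq (L : HOTangent E Q (m + 1) → ℝ) (w : UnifiedSpace E Q m)
    {w' : UnifiedSpace E Q m}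
    (h : w'.proj ∈ (chartAt (Fin (2 * m + 1 + 1) → E) w.proj).source) :
    unifiedHamiltonian L w' = momentum w w' (shiftL (by omega)
        (natChart (2 * m + 1) (chart_mem_atlas E (baseProj w.proj)) w'.proj)) -
      (L ∘ (natChart (m + 1) (chart_mem_atlas E (baseProj w.proj))).symm) (truncL (by omega)
        (natChart (2 * m + 1) (chart_mem_atlas E (baseProj w.proj)) w'.proj)) := by
  have h1 := covector_apply w h (canonicalInj (r := m) (k := 2 * m + 1) (by omega) w'.proj)
  rw [chartDeriv_canonicalInj _ _ h] at h1
  have h2 : m + 1 ≤ 2 * m + 1 := by omega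
  rw [← h1, ← natChart_jetProj _ h2, Function.comp_apply,
    (natChart (m + 1) _).left_inv (jetProj_mem_source _ h2 h)]
  rfl

theorem hasFDerivAt_coordinate_hamiltonian {f : (Fin (m + 1 + 1) → E) → ℝ}
    (y : (Fin (2 * m + 1 + 1) → E) × ((Fin (m + 1) → E) →L[ℝ] ℝ))
    (hf : DifferentiableAt ℝ f (truncL (by omega) y.1)) :
    HasFDerivAt (fun y : (Fin (2 * m + 1 + 1) → E) × ((Fin (m + 1) → E) →L[ℝ] ℝ) =>
        y.2 (shiftL (by omega) y.1) - f (truncL (by omega) y.1))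
      ((y.2.comp (shiftL (by omega))).comp (ContinuousLinearMap.fst ℝ _ _) +
        (ContinuousLinearMap.apply ℝ ℝ (shiftL (by omega) y.1)).comp
          (ContinuousLinearMap.snd ℝ (Fin (2 * m + 1 + 1) → E) ((Fin (m + 1) → E) →L[ℝ] ℝ)) -
        ((fderiv ℝ f (truncL (by omega) y.1)).comp (truncL (by omega))).comp
          (ContinuousLinearMap.fst ℝ _ _)) y := by
  have h1 := (shiftL (E := E) (by omega : m + 1 ≤ 2 * m + 1)).hasFDerivAt.comp y
    (hasFDerivAt_fst (𝕜 := ℝ) (p := y))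
  have h2 := hf.hasFDerivAt.comp y
    ((truncL (E := E) (by omega : m + 1 ≤ 2 * m + 1)).hasFDerivAt.comp y
    (hasFDerivAt_fst (𝕜 := ℝ) (p := y)))
  refine (((hasFDerivAt_snd (𝕜 := ℝ) (p := y)).clm_apply h1).sub h2).congr_fderiv ?_
  rfl

theorem diffFun_unifiedHamiltonian {L : HOTangent E Q (m + 1) → ℝ}
    (hL : ContMDiff 𝓘(ℝ, Fin (m + 1 + 1) → E) 𝓘(ℝ, ℝ) ∞ L) (w : UnifiedSpace E Q m)
    (v : (Fin (2 * m + 1 + 1) → E) × ((Fin (m + 1) → E) →L[ℝ] ℝ)) :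
    diffFun (unifiedModel E m) (unifiedHamiltonian L) w v =
      momentum w w (shiftL (by omega) v.1) +
      v.2 (shiftL (by omega)
        (natChart (2 * m + 1) (chart_mem_atlas E (baseProj w.proj)) w.proj)) -
      fderiv ℝ (L ∘ (natChart (m + 1) (chart_mem_atlas E (baseProj w.proj))).symm)
        (truncL (by omega) (natChart (2 * m + 1) (chart_mem_atlas E (baseProj w.proj)) w.proj))
        (truncL (by omega) v.1) := by
  have hw : w.proj ∈ (chartAt (Fin (2 * m + 1 + 1) → E) w.proj).source := mem_chart_source _ _
  have h2 : m + 1 ≤ 2 * m + 1 := by omega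
  have h3 : DifferentiableAt ℝ (L ∘ (natChart (m + 1) (chart_mem_atlas E (baseProj w.proj))).symm)
      (truncL h2 (natChart (2 * m + 1) (chart_mem_atlas E (baseProj w.proj)) w.proj)) := by
    refine ((contDiffOn_comp_natChart_symm _ hL).contDiffAt
      ((natChart _ _).open_target.mem_nhds ?_)).differentiableAt (by simp)
    exact truncL_mem_target _ h2 ((natChart _ _).map_source hw)
  have h4 := hasFDerivAt_coordinate_hamiltonian (extChartAt (unifiedModel E m) w w)
    (f := L ∘ (natChart (m + 1) (chart_mem_atlas E (baseProj w.proj))).symm)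
    (by rw [extChartAt_unified w hw]; exact h3)
  have h5 := hasMFDerivAt_of_comp_extChartAt (f := unifiedHamiltonian L) (by
    filter_upwards [eventually_proj_mem_source w] with w' hw'
    rw [unifiedHamiltonian_eq L w hw']
    exact congrArg (fun y : (Fin (2 * m + 1 + 1) → E) × ((Fin (m + 1) → E) →L[ℝ] ℝ) =>
      y.2 (shiftL (by omega) y.1) -
        (L ∘ (natChart (m + 1) (chart_mem_atlas E (baseProj w.proj))).symm)
          (truncL (by omega) y.1)) (extChartAt_unified w hw').symm) h4
  rw [extChartAt_unified w hw] at h5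
  exact DFunLike.congr_fun h5.mfderiv v

/-- On the graph the momenta are the coefficients of θ_L. The relation is needed at points `w'` near
`w`, in the chart at `w`, so that it can be differentiated along a curve. -/
theorem lagrangianRep_eq_momentum {L : HOTangent E Q (m + 1) → ℝ}
    (hL : ContMDiff 𝓘(ℝ, Fin (m + 1 + 1) → E) 𝓘(ℝ, ℝ) ∞ L) (w : UnifiedSpace E Q m)
    {w' : UnifiedSpace E Q m}
    (h : w'.proj ∈ (chartAt (Fin (2 * m + 1 + 1) → E) w.proj).source)
    (hw' : w' ∈ legendreGraph L) (v : Fin (2 * m + 1 + 1) → E) :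
    lagrangianRep (L ∘ (natChart (m + 1) (chart_mem_atlas E (baseProj w.proj))).symm)
      (natChart (2 * m + 1) (chart_mem_atlas E (baseProj w.proj)) w'.proj) v =
      momentum w w' (truncL (by omega) v) := by
  have he := chart_mem_atlas E (baseProj w.proj)
  have hc := natChart_mem_atlas (2 * m + 1) he
  have hy := (natChart (2 * m + 1) he).map_source h
  have h1 := chartDeriv_chartSymmDeriv hc hy v
  rw [(natChart (2 * m + 1) he).left_inv h] at h1
  have h2 := formRep_apply_chartDeriv hc h (lagrangianOne L)
    (chartSymmDeriv (natChart (2 * m + 1) he) (natChart (2 * m + 1) he w'.proj) v)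
  rw [h1, formRep_lagrangianOne he hL hy] at h2
  have h3 := covector_apply w h (jetProjDeriv (r := m) (by omega) w'.proj
    (chartSymmDeriv (natChart (2 * m + 1) he) (natChart (2 * m + 1) he w'.proj) v))
  rw [chartDeriv_jetProjDeriv he _ h, h1] at h3
  rw [h2, ← h3]
  exact hw' _

end UnifiedCoordinates

/-! ### Integral curves of solutions -/

section IntegralCurves

variable {E : Type*} [NormedAddCommGroup E] [NormedSpace ℝ E]
  {Q : Type*} [TopologicalSpace Q] [ChartedSpace E Q] [IsManifold 𝓘(ℝ, E) ∞ Q] {m : ℕ}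

theorem hasDerivAt_extChartAt_comp {V B F : Type*} [NormedAddCommGroup V] [NormedSpace ℝ V]
    [NormedAddCommGroup F] [NormedSpace ℝ F] [TopologicalSpace B] [ChartedSpace V B]
    {W : B → Type*} [TopologicalSpace (TotalSpace F W)] [∀ x, TopologicalSpace (W x)]
    [FiberBundle F W] [IsManifold (𝓘(ℝ, V).prod 𝓘(ℝ, F)) 1 (TotalSpace F W)]
    {X : ∀ w : TotalSpace F W, TangentSpace (𝓘(ℝ, V).prod 𝓘(ℝ, F)) w} {I : Set ℝ} (hI : IsOpen I)
    {σ : ℝ → TotalSpace F W} (hσ : IsMIntegralCurveOn σ X I) {t : ℝ} (ht : t ∈ I) :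
    HasDerivAt (fun s => (extChartAt (𝓘(ℝ, V).prod 𝓘(ℝ, F)) (σ t) (σ s) : V × F))
      (show V × F from X (σ t)) t := by
  have h1 := (hσ t ht).hasMFDerivAt (hI.mem_nhds ht)
  have h2 := (hasMFDerivAt_extChartAt_totalSpace (σ t)).comp t h1
  rw [hasMFDerivAt_iff_hasFDerivAt] at h2
  have h3 : HasFDerivAt (fun s => (extChartAt (𝓘(ℝ, V).prod 𝓘(ℝ, F)) (σ t) (σ s) : V × F))
      (ContinuousLinearMap.toSpanSingleton ℝ (show V × F from X (σ t))) t := h2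
  exact h3

/-- Time derivative of the Legendre relation θ(x(s)) = ξ(s) ∘ P. It uses only that the curve stays
on the graph, so tangency of the vector field to the graph need not be discussed. -/
theorem fderiv_apply_eq_of_eventually {V W : Type*} [NormedAddCommGroup V] [NormedSpace ℝ V]
    [NormedAddCommGroup W] [NormedSpace ℝ W] {θ : V → (V →L[ℝ] ℝ)} {x : ℝ → V}
    {ξ : ℝ → (W →L[ℝ] ℝ)} {t : ℝ} {x' : V} {ξ' : W →L[ℝ] ℝ} (hθ : DifferentiableAt ℝ θ (x t))
    (hx : HasDerivAt x x' t) (hξ : HasDerivAt ξ ξ' t) (P : V →L[ℝ] W)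
    (h : ∀ᶠ s in 𝓝 t, ∀ v, θ (x s) v = ξ s (P v)) (v : V) :
    fderiv ℝ θ (x t) x' v = ξ' (P v) := by
  have h1 := (hθ.hasFDerivAt.comp_hasDerivAt t hx).clm_apply (hasDerivAt_const t v)
  have h2 := hξ.clm_apply (hasDerivAt_const t (P v))
  have h3 : HasDerivAt (fun s => θ (x s) v) _ t :=
    h2.congr_of_eventuallyEq (h.mono fun s hs => hs v)
  simpa using h1.unique h3

variable {X : ∀ w : UnifiedSpace E Q m, TangentSpace (unifiedModel E m) w} {I : Set ℝ}
  {σ : ℝ → UnifiedSpace E Q m}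

theorem eventually_curve_mem (hI : IsOpen I) (hσ : IsMIntegralCurveOn σ X I) {t : ℝ} (ht : t ∈ I) :
    ∀ᶠ s in 𝓝 t, s ∈ I ∧ (σ s).proj ∈ (chartAt (Fin (2 * m + 1 + 1) → E) (σ t).proj).source :=
  Filter.Eventually.and (hI.mem_nhds ht)
    ((hσ.continuousOn.continuousAt (hI.mem_nhds ht)).eventually (eventually_proj_mem_source (σ t)))

theorem hasDerivAt_natChart_curve (hI : IsOpen I) (hσ : IsMIntegralCurveOn σ X I) {t : ℝ}
    (ht : t ∈ I) : HasDerivAt (fun s => natChart (2 * m + 1)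
      (chart_mem_atlas E (baseProj (σ t).proj)) (σ s).proj)
      (show (Fin (2 * m + 1 + 1) → E) × ((Fin (m + 1) → E) →L[ℝ] ℝ) from X (σ t)).1 t := by
  refine HasDerivAt.congr_of_eventuallyEq (hasDerivAt_extChartAt_comp hI hσ ht).fst ?_
  filter_upwards [eventually_curve_mem hI hσ ht] with s hs
  exact (congrArg Prod.fst (extChartAt_unified (σ t) hs.2)).symm

theorem hasDerivAt_momentum_curve (hI : IsOpen I) (hσ : IsMIntegralCurveOn σ X I) {t : ℝ}
    (ht : t ∈ I) : HasDerivAt (fun s => momentum (σ t) (σ s))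
      (show (Fin (2 * m + 1 + 1) → E) × ((Fin (m + 1) → E) →L[ℝ] ℝ) from X (σ t)).2 t :=
  (hasDerivAt_extChartAt_comp hI hσ ht).snd

theorem IsUnifiedSolution.coordinate_equation {L : HOTangent E Q (m + 1) → ℝ}
    (hL : ContMDiff 𝓘(ℝ, Fin (m + 1 + 1) → E) 𝓘(ℝ, ℝ) ∞ L) (hX : IsUnifiedSolution L X)
    {w : UnifiedSpace E Q m} (hw : w ∈ legendreGraph L)
    {X₁ : Fin (2 * m + 1 + 1) → E} {X₂ : (Fin (m + 1) → E) →L[ℝ] ℝ} (hXw : X w = (X₁, X₂))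
    (v : (Fin (2 * m + 1 + 1) → E) × ((Fin (m + 1) → E) →L[ℝ] ℝ)) :
    v.2 (truncL (by omega) X₁) - X₂ (truncL (by omega) v.1) =
      momentum w w (shiftL (by omega) v.1) +
      v.2 (shiftL (by omega)
        (natChart (2 * m + 1) (chart_mem_atlas E (baseProj w.proj)) w.proj)) -
      fderiv ℝ (L ∘ (natChart (m + 1) (chart_mem_atlas E (baseProj w.proj))).symm)
        (truncL (by omega) (natChart (2 * m + 1) (chart_mem_atlas E (baseProj w.proj)) w.proj))
        (truncL (by omega) v.1) := by
  have h1 := hX.equation w hw v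
  rw [hXw] at h1
  exact (unifiedTwo_apply w (X₁, X₂) v).symm.trans (h1.trans (diffFun_unifiedHamiltonian hL w v))

theorem IsRegularLagrangian.coordinate_nondegenerate {L : HOTangent E Q (m + 1) → ℝ}
    (hL : ContMDiff 𝓘(ℝ, Fin (m + 1 + 1) → E) 𝓘(ℝ, ℝ) ∞ L) (hreg : IsRegularLagrangian L)
    (p : HOTangent E Q (2 * m + 1)) (u : Fin (2 * m + 1 + 1) → E)
    (hu : ∀ v, fderiv ℝ (lagrangianRep (L ∘ (natChart (m + 1)
        (chart_mem_atlas E (baseProj p))).symm))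
        (natChart (2 * m + 1) (chart_mem_atlas E (baseProj p)) p) u v -
      fderiv ℝ (lagrangianRep (L ∘ (natChart (m + 1) (chart_mem_atlas E (baseProj p))).symm))
        (natChart (2 * m + 1) (chart_mem_atlas E (baseProj p)) p) v u = 0) : u = 0 := by
  refine hreg p u fun v => ?_
  have he := chart_mem_atlas E (baseProj p)
  have h1 : formRep (chartAt (Fin (2 * m + 1 + 1) → E) p) (lagrangianOne L) =ᶠ[𝓝 (chartAt _ p p)]
      lagrangianRep (L ∘ (natChart (m + 1) he).symm) := by
    filter_upwards [(chartAt (Fin (2 * m + 1 + 1) → E) p).open_target.mem_nhds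
      (mem_chart_target _ p)] with y hy
    exact formRep_lagrangianOne he hL hy
  have h2 := extDerivOne_eq_formRep (lagrangianOne L) p u v
  rw [h1.fderiv_eq] at h2
  exact neg_eq_zero.2 (h2.trans (hu v))

/-- The dynamical equation supplies half of the holonomy conditions and the momentum components of
X; the time derivative of the Legendre relation converts the latter into the Euler–Lagrange
identity, and regularity gives the other half. -/
theorem holonomic_along_curve [FiniteDimensional ℝ E] {L : HOTangent E Q (m + 1) → ℝ}
    (hL : ContMDiff 𝓘(ℝ, Fin (m + 1 + 1) → E) 𝓘(ℝ, ℝ) ∞ L) (hreg : IsRegularLagrangian L)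
    (hX : IsUnifiedSolution L X) (hI : IsOpen I) (hσ : IsMIntegralCurveOn σ X I)
    (hσo : ∀ t ∈ I, σ t ∈ legendreGraph L) {t : ℝ} (ht : t ∈ I)
    {X₁ : Fin (2 * m + 1 + 1) → E} {X₂ : (Fin (m + 1) → E) →L[ℝ] ℝ} (hXt : X (σ t) = (X₁, X₂)) :
    truncL (by omega : 2 * m ≤ 2 * m + 1) X₁ = shiftL (by omega) (natChart (2 * m + 1)
      (chart_mem_atlas E (baseProj (σ t).proj)) (σ t).proj) := by
  have he := chart_mem_atlas E (baseProj (σ t).proj)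
  have hx := hasDerivAt_natChart_curve hI hσ ht
  have hξ := hasDerivAt_momentum_curve hI hσ ht
  rw [hXt] at hx hξ
  have hev := eventually_curve_mem hI hσ ht
  have hsrc := hev.self_of_nhds.2
  have heq := hX.coordinate_equation hL (hσo t ht) hXt
  have hnd := hreg.coordinate_nondegenerate hL (σ t).proj
  have hgraph := fun (s : ℝ) (hs : s ∈ I) => lagrangianRep_eq_momentum hL (σ t) (w' := σ s)
  have hf := contDiffOn_comp_natChart_symm he hL
  have hT := (chartAt E (baseProj (σ t).proj)).open_target
  have hy : natChart (2 * m + 1) he (σ t).proj 0 ∈ (chartAt E (baseProj (σ t).proj)).target :=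
    (natChart (2 * m + 1) he).map_source hsrc
  revert hf heq hnd hgraph
  -- The collected facts are purely about the local expression of L, so it can be an arbitrary
  -- function from here on.
  generalize L ∘ (natChart (m + 1) he).symm = f
  intro heq hnd hgraph hf
  have hθ : DifferentiableAt ℝ (lagrangianRep f) (natChart (2 * m + 1) he (σ t).proj) :=
    ((contDiffOn_lagrangianRep hT hf).contDiffAt
      ((hT.preimage (continuous_apply 0)).mem_nhds hy)).differentiableAt (by simp)
  have hderiv := fderiv_apply_eq_of_eventually hθ hx hξ (truncL (by omega)) (by
    filter_upwards [hev] with s hs v using hgraph s hs.1 hs.2 (hσo s hs.1) v)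
  -- Testing on pure momentum directions (0, ℓ); linear functionals separate points.
  have hfirst : truncL (by omega : m ≤ 2 * m + 1) X₁ = shiftL (by omega)
      (natChart (2 * m + 1) he (σ t).proj) := by
    refine (SeparatingDual.eq_iff_forall_dual_eq (R := ℝ)).2 fun ℓ => ?_
    simpa using heq (0, ℓ)
  funext i
  refine holonomic_of_nondegenerate hT hf hy hnd
    (fun i hi => congrFun hfirst ⟨i, by omega⟩) (fun v w hv hw => ?_) i (by omega)
  have h1 : truncL (by omega : m ≤ 2 * m + 1) w = shiftL (by omega) v :=
    funext fun i => hw i (by omega)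
  -- Testing on directions without momentum part yields the equation for `X₂`, which `hderiv` has
  -- identified with the derivative of θ_L along `X₁`.
  have h2 := heq (v, 0)
  rw [hderiv, hgraph t ht hsrc (hσo t ht), h1]
  simp only [zero_apply, zero_sub, add_zero] at h2
  linarith

end IntegralCurves

/-! ### Smoothness of integral curves -/

section Smoothness

variable {V H M : Type*} [NormedAddCommGroup V] [NormedSpace ℝ V] [TopologicalSpace H]
  {J : ModelWithCorners ℝ V H} [TopologicalSpace M] [ChartedSpace H M] [IsManifold J ∞ M]

/-- Bootstrap: if σ is of class C^n then so is its velocity X ∘ σ, hence σ is of class C^{n+1}.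
Smoothness of X along a set containing the image of σ suffices. -/
theorem contMDiffOn_nat_of_isMIntegralCurveOn {X : ∀ x : M, TangentSpace J x} {S : Set M}
    (hX : ContMDiffOn J J.tangent ∞ (fun x => (⟨x, X x⟩ : TangentBundle J M)) S)
    {I : Set ℝ} (hI : IsOpen I) {σ : ℝ → M} (hσ : IsMIntegralCurveOn σ X I)
    (hS : ∀ t ∈ I, σ t ∈ S) (n : ℕ) : ContMDiffOn 𝓘(ℝ, ℝ) J n σ I := by
  have hM : IsManifold J 1 M := IsManifold.of_le (n := ∞) (by simp)
  induction n with
  | zero => exact contMDiffOn_zero_iff.2 hσ.continuousOn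
  | succ n ih =>
    intro t ht
    have hc := hσ.continuousOn.continuousAt (hI.mem_nhds ht)
    refine ContMDiffAt.contMDiffWithinAt (contMDiffAt_iff_target.2 ⟨hc, ?_⟩)
    have h1 : ContMDiffAt 𝓘(ℝ, ℝ) J.tangent n
        (fun s => (⟨σ s, X (σ s)⟩ : TangentBundle J M)) t :=
      ((hX.of_le (by exact_mod_cast le_top)).comp ih hS).contMDiffAt (hI.mem_nhds ht)
    have h2 := (contMDiffAt_totalSpace.1 h1).2.contDiffAt
    -- Near `t` the coordinate expression of σ has as derivative the fibre coordinate of X ∘ σ in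
    -- the tangent trivialization at σ(t), which is C^n.
    refine ContDiffAt.contMDiffAt (contDiffAt_succ_iff_hasFDerivAt.2 ⟨fun s =>
      ContinuousLinearMap.toSpanSingleton ℝ (trivializationAt V (TangentSpace J) (σ t)
        ⟨σ s, X (σ s)⟩).2, ⟨{s | s ∈ I ∧ σ s ∈ (extChartAt J (σ t)).source}, ?_, ?_⟩, ?_⟩)
    · exact Filter.Eventually.and (hI.mem_nhds ht)
        (hc.preimage_mem_nhds (extChartAt_source_mem_nhds (σ t)))
    · intro s hs
      exact ((hσ.hasDerivWithinAt (t₀ := t) hs.1 hs.2).hasDerivAt (hI.mem_nhds hs.1)).hasFDerivAt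
    · exact (ContinuousLinearMap.toSpanSingletonCLE (𝕜 := ℝ) (E := V)).contDiff.contDiffAt.comp t h2

/-- Integral curves of a vector field that is smooth along a set containing them are smooth. -/
theorem contMDiffOn_of_isMIntegralCurveOn {X : ∀ x : M, TangentSpace J x} {S : Set M}
    (hX : ContMDiffOn J J.tangent ∞ (fun x => (⟨x, X x⟩ : TangentBundle J M)) S)
    {I : Set ℝ} (hI : IsOpen I) {σ : ℝ → M} (hσ : IsMIntegralCurveOn σ X I)
    (hS : ∀ t ∈ I, σ t ∈ S) : ContMDiffOn 𝓘(ℝ, ℝ) J ∞ σ I :=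
  contMDiffOn_infty.2 (contMDiffOn_nat_of_isMIntegralCurveOn hX hI hσ hS)

end Smoothness

/-! ### Holonomic curves are canonical liftings -/

section Holonomic

theorem hasDerivAt_chart_comp {V M : Type*} [NormedAddCommGroup V] [NormedSpace ℝ V]
    [TopologicalSpace M] [ChartedSpace V M] [IsManifold 𝓘(ℝ, V) ∞ M]
    {c : OpenPartialHomeomorph M V} (hc : c ∈ atlas V M) {p : ℝ → M} {t : ℝ}
    (hp : MDifferentiableAt 𝓘(ℝ, ℝ) 𝓘(ℝ, V) p t) (ht : p t ∈ c.source) :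
    HasDerivAt (fun s => c (p s))
      (chartDeriv c (p t) ((mfderiv 𝓘(ℝ, ℝ) 𝓘(ℝ, V) p t : ℝ →L[ℝ] V) 1)) t := by
  have h1 := (mdifferentiableAt_chart hc ht).hasMFDerivAt.comp t hp.hasMFDerivAt
  rw [hasMFDerivAt_iff_hasFDerivAt] at h1
  have h2 : HasFDerivAt (fun s => c (p s))
    ((chartDeriv c (p t)).comp (mfderiv 𝓘(ℝ, ℝ) 𝓘(ℝ, V) p t : ℝ →L[ℝ] V)) t := h1
  exact h2.hasDerivAt

variable {E : Type*} [NormedAddCommGroup E] [NormedSpace ℝ E]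
  {Q : Type*} [TopologicalSpace Q] [ChartedSpace E Q] [IsManifold 𝓘(ℝ, E) ∞ Q]
  {e : OpenPartialHomeomorph Q E} {k : ℕ}

theorem natChart_zero (he : e ∈ atlas E Q) {p : HOTangent E Q k}
    (hp : p ∈ (natChart k he).source) : natChart k he p 0 = e (baseProj p) := by
  induction p using Quotient.inductionOn with
  | h σ =>
    refine (jetCoord_jet he hp 0).trans ?_
    simp only [Fin.val_zero, iteratedDeriv_zero]
    rfl

theorem contMDiff_baseProj :
    ContMDiff 𝓘(ℝ, Fin (k + 1) → E) 𝓘(ℝ, E) ∞ (baseProj : HOTangent E Q k → Q) := by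
  intro p
  have he := chart_mem_atlas E (baseProj p)
  have hp : p ∈ (natChart k he).source := mem_chart_source E (baseProj p)
  have h1 := contMDiffAt_of_mem_maximalAtlas (I := 𝓘(ℝ, Fin (k + 1) → E)) (n := ∞)
    (IsManifold.subset_maximalAtlas (natChart_mem_atlas k he)) hp
  have h2 : ContMDiffAt 𝓘(ℝ, Fin (k + 1) → E) 𝓘(ℝ, E) ∞ (fun y : Fin (k + 1) → E => y 0)
      (natChart k he p) := (contDiff_apply ℝ E (0 : Fin (k + 1))).contMDiff _
  have h3 : ContMDiffAt 𝓘(ℝ, E) 𝓘(ℝ, E) ∞ (chartAt E (baseProj p)).symm (natChart k he p 0) := by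
    refine contMDiffAt_symm_of_mem_maximalAtlas (IsManifold.subset_maximalAtlas he) ?_
    exact (natChart k he).map_source hp
  refine (h3.comp p (h2.comp p h1)).congr_of_eventuallyEq ?_
  filter_upwards [(natChart k he).open_source.mem_nhds hp] with p' hp'
  rw [Function.comp_apply, Function.comp_apply, natChart_zero he hp']
  exact ((chartAt E (baseProj p)).left_inv hp').symm

/-- In a chain where each entry is the derivative of the one before, all entries are determined by
the zeroth. Openness lets the induction differentiate an identity valid near `t`. -/
theorem iteratedDeriv_eq_of_hasDerivAt {U : Set ℝ} (hU : IsOpen U) {g : ℝ → E} {y : ℝ → ℕ → E}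
    (h0 : ∀ t ∈ U, g t = y t 0) (h : ∀ t ∈ U, ∀ i < k, HasDerivAt (fun s => y s i) (y t (i + 1)) t)
    {i : ℕ} (hi : i ≤ k) {t : ℝ} (ht : t ∈ U) : iteratedDeriv i g t = y t i := by
  induction i generalizing t with
  | zero => simpa using h0 t ht
  | succ i ih =>
    have h1 : iteratedDeriv i g =ᶠ[𝓝 t] fun s => y s i := by
      filter_upwards [hU.mem_nhds ht] with s hs using ih (by omega) hs
    rw [iteratedDeriv_succ, h1.deriv_eq]
    exact (h t ht i (by omega)).deriv

theorem natChart_canonicalLift (he : e ∈ atlas E Q) {γ : ℝ → Q} {t : ℝ}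
    (hγ : ∀ᶠ s in 𝓝 t, ContMDiffAt 𝓘(ℝ, ℝ) 𝓘(ℝ, E) ∞ γ s) (ht : γ t ∈ e.source)
    (i : Fin (k + 1)) :
    natChart k he (canonicalLift k γ t) i = iteratedDeriv (i : ℕ) (e ∘ γ) t := by
  have h1 : (shiftCurve (E := E) γ t).1 = fun s => γ (s + t) := by rw [shiftCurve, dif_pos hγ]
  have h2 : (shiftCurve (E := E) γ t).1 0 ∈ e.source := by
    rw [h1]
    simpa using ht
  refine (jetCoord_jet he h2 i).trans ?_
  rw [h1]
  simpa only [zero_add] using! congrFun (iteratedDeriv_comp_add_const (i : ℕ) (e ∘ γ) t) 0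

/-- A curve in `T^{r+1}Q` whose velocity projects to the canonical injection is the canonical
lifting of its projection. -/
theorem eq_canonicalLift_of_holonomic {r : ℕ} {I : Set ℝ} (hI : IsOpen I)
    {p : ℝ → HOTangent E Q (r + 1)}
    (hp : ContMDiffOn 𝓘(ℝ, ℝ) 𝓘(ℝ, Fin (r + 1 + 1) → E) ∞ p I)
    (h : ∀ t ∈ I, truncL (Nat.le_succ r)
      ((mfderiv 𝓘(ℝ, ℝ) 𝓘(ℝ, Fin (r + 1 + 1) → E) p t : ℝ →L[ℝ] (Fin (r + 1 + 1) → E)) 1) =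
        (show Fin (r + 1) → E from canonicalInj le_rfl (p t)))
    {t : ℝ} (ht : t ∈ I) : p t = canonicalLift (r + 1) (fun s => baseProj (p s)) t := by
  have hpd : ∀ s ∈ I, ContMDiffAt 𝓘(ℝ, ℝ) 𝓘(ℝ, Fin (r + 1 + 1) → E) ∞ p s := fun s hs =>
    hp.contMDiffAt (hI.mem_nhds hs)
  set γ : ℝ → Q := fun s => baseProj (p s) with hγ
  have hγd : ∀ᶠ s in 𝓝 t, ContMDiffAt 𝓘(ℝ, ℝ) 𝓘(ℝ, E) ∞ γ s := by
    filter_upwards [hI.mem_nhds ht] with s hs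
    exact (contMDiff_baseProj (p s)).comp s (hpd s hs)
  set e := chartAt E (γ t)
  have he : e ∈ atlas E Q := chart_mem_atlas E _
  set c := natChart (r + 1) he
  set U : Set ℝ := I ∩ p ⁻¹' c.source
  have hU : IsOpen U := hp.continuousOn.isOpen_inter_preimage hI c.open_source
  have htU : t ∈ U := ⟨ht, mem_chart_source E (γ t)⟩
  set y : ℝ → ℕ → E := fun s i => if hi : i < r + 1 + 1 then c (p s) ⟨i, hi⟩ else 0 with hy
  have hyi : ∀ s (i : ℕ) (hi : i < r + 1 + 1), y s i = c (p s) ⟨i, hi⟩ := fun s i hi => dif_pos hi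
  have hder : ∀ s ∈ U, ∀ i < r + 1, HasDerivAt (fun s => y s i) (y s (i + 1)) s := by
    intro s hs i hi
    have h1 := hasDerivAt_chart_comp (natChart_mem_atlas (r + 1) he)
      ((hpd s hs.1).mdifferentiableAt (by simp)) hs.2
    have h2 := hasDerivAt_pi.1 h1 ⟨i, by omega⟩
    -- The hypothesis is expressed in the preferred charts at each p(s); applying the chart
    -- derivative transports it to the single chart `c`, where it says that the coordinates form a
    -- chain of derivatives.
    have h3 := chartDeriv_jetProjDeriv he (Nat.le_succ r) hs.2
      ((mfderiv 𝓘(ℝ, ℝ) 𝓘(ℝ, Fin (r + 1 + 1) → E) p s : ℝ →L[ℝ] (Fin (r + 1 + 1) → E)) 1)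
    rw [jetProjDeriv_eq_truncL, h s hs.1] at h3
    have h4 := congrFun (h3.symm.trans (chartDeriv_canonicalInj he le_rfl hs.2)) ⟨i, hi⟩
    rw [hyi s (i + 1) (by omega)]
    have h5 : (fun s => y s i) = fun s => c (p s) ⟨i, by omega⟩ := funext fun s => hyi s i _
    rw [h5]
    exact h2.congr_deriv h4
  have hmem : canonicalLift (r + 1) γ t ∈ c.source := by
    rw [mem_natChart_source, baseProj_canonicalLift]
    exact mem_chart_source E (γ t)
  -- Both jets lie in the domain of `c`, so it suffices that their coordinates are the derivatives
  -- of the base curve there.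
  refine c.injOn htU.2 hmem (funext fun i => ?_)
  rw [natChart_canonicalLift he hγd (mem_chart_source E (γ t)) i,
    iteratedDeriv_eq_of_hasDerivAt (k := r + 1) hU (fun s hs => ?_) hder (by omega) htU, hyi t i i.2]
  rw [hyi s 0 (by omega)]
  exact (natChart_zero he hs.2).symm

theorem eq_canonicalLift_of_isUnifiedSolution [FiniteDimensional ℝ E] {m : ℕ}
    {L : HOTangent E Q (m + 1) → ℝ}
    (hL : ContMDiff 𝓘(ℝ, Fin (m + 1 + 1) → E) 𝓘(ℝ, ℝ) ∞ L) (hreg : IsRegularLagrangian L)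
    {X : ∀ w : UnifiedSpace E Q m, TangentSpace (unifiedModel E m) w}
    (hX : IsUnifiedSolution L X) {I : Set ℝ} (hI : IsOpen I) {σ : ℝ → UnifiedSpace E Q m}
    (hσ : IsMIntegralCurveOn σ X I) (hσo : ∀ t ∈ I, σ t ∈ legendreGraph L) :
    ContMDiffOn 𝓘(ℝ, ℝ) 𝓘(ℝ, Fin (2 * m + 1 + 1) → E) ∞ (fun t => (σ t).proj) I ∧
      ∀ t ∈ I, (σ t).proj = canonicalLift (2 * m + 1) (fun s => baseProj (σ s).proj) t := by
  have hs : ContMDiffOn 𝓘(ℝ, ℝ) 𝓘(ℝ, Fin (2 * m + 1 + 1) → E) ∞ (fun t => (σ t).proj) I :=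
    (contMDiff_proj (n := ∞) (IB := 𝓘(ℝ, Fin (2 * m + 1 + 1) → E))
    (rho E Q m *ᵖ (CotangentSpace 𝓘(ℝ, Fin (m + 1) → E) (HOTangent E Q m)))).comp_contMDiffOn
      (contMDiffOn_of_isMIntegralCurveOn hX.smooth hI hσ hσo)
  refine ⟨hs, fun t ht => eq_canonicalLift_of_holonomic hI hs (fun t ht => ?_) ht⟩
  have h1 := holonomic_along_curve hL hreg hX hI hσ hσo ht rfl
  -- Two computations of the velocity of pr₁ ∘ σ in the preferred chart at `t`: as a manifold
  -- derivative, and as the first component of X.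
  have h2 := (hasDerivAt_chart_comp (chart_mem_atlas _ (σ t).proj)
    ((hs.contMDiffAt (hI.mem_nhds ht)).mdifferentiableAt (by simp)) (mem_chart_source _ _)).unique
    (hasDerivAt_natChart_curve hI hσ ht)
  rw [chartDeriv_chartAt] at h2
  refine Eq.trans ?_ (h1.trans (canonicalInj_eq_shiftL le_rfl (σ t).proj).symm)
  exact congrArg _ h2

end Holonomic

end HigherOrder
end

theorem mainTheorem8 {E : Type*} [NormedAddCommGroup E] [NormedSpace ℝ E] [FiniteDimensional ℝ E]
    {Q : Type*} [TopologicalSpace Q] [ChartedSpace E Q] [IsManifold 𝓘(ℝ, E) ∞ Q]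
    (m : ℕ) (L : HOTangent E Q (m + 1) → ℝ)
    (hL : ContMDiff 𝓘(ℝ, Fin (m + 1 + 1) → E) 𝓘(ℝ, ℝ) ∞ L) (hreg : IsRegularLagrangian L)
    (X : ∀ w : UnifiedSpace E Q m, TangentSpace (unifiedModel E m) w)
    (hX : IsUnifiedSolution L X)
    (I : Set ℝ) (hI : IsOpen I) (σ : ℝ → UnifiedSpace E Q m)
    (hσ : IsMIntegralCurveOn σ X I) (hσo : ∀ t ∈ I, σ t ∈ legendreGraph L) :
    ∃ γ : ℝ → Q, ContMDiffOn 𝓘(ℝ, ℝ) 𝓘(ℝ, E) ∞ γ I ∧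
      ∀ t ∈ I, (σ t).proj = canonicalLift (2 * m + 1) γ t := by
  obtain ⟨h1, h2⟩ := eq_canonicalLift_of_isUnifiedSolution hL hreg hX hI hσ hσo
  exact ⟨fun t => baseProj (σ t).proj, contMDiff_baseProj.comp_contMDiffOn h1, h2⟩
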